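/- Let $\mathbb{T}^2=(\mathbb{R}/\mathbb{Z})^2$ with Haar probability measure. Functions and distributions on $\mathbb{T}^2$ are complex-valued and are described by their Fourier coefficients $\widehat u(n)$, $n\in\mathbb{Z}^2$. The usual factors $2\pi$ are dropped: $D=\sqrt{-\Delta}$ is the Fourier multiplier with symbol $|n|$ (the Euclidean length of $n$). For $\sigma\in\mathbb{R}$ let $H^\sigma=H^\sigma(\mathbb{T}^2)$ have the norm $\|u\|_{H^\sigma}=\big(\sum_{n}(1+|n|^2)^{\sigma}|\widehat u(n)|^2\big)^{1/2}$, and let $\mathcal{H}^\sigma=H^\sigma\times H^{\sigma-1}$. Put $\langle\!\langle D\rangle\!\rangle=\sqrt{1-\tfrac34\Delta}$, $$S(t)=e^{-\frac D2t}\frac{\sin(t\langle\!\langle D\rangle\!\rangle)}{\langle\!\langle D\rangle\!\rangle},\qquad V(t)(u_0,u_1)=e^{-\frac D2t}\Big(\cos(t\langle\!\langle D\rangle\!\rangle)+\frac{D}{2\langle\!\langle D\rangle\!\rangle}\sin(t\langle\!\langle D\rangle\!\rangle)\Big)u_0+S(t)u_1 .$$ **Theorem.** Let $p>1$, let $s_{\mathrm{crit}}=\max\big(1-\frac{2}{p-1},0\big)$,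 and let $s\ge s_{\mathrm{crit}}$, with $s>s_{\mathrm{crit}}$ if $p=3$. If $p$ is not an odd integer, assume moreover that $s<p+\frac52$. Fix one of the two signs $\pm$. Then the viscous nonlinear wave equation $$\partial_t^2u+(1-\Delta)u+D\partial_tu\pm|u|^{p-1}u=0,\qquad (u,\partial_tu)|_{t=0}=(u_0,u_1)$$ is locally well-posed in $\mathcal{H}^s(\mathbb{T}^2)$ in the following sense. There exist finite exponents $q,r\ge\max(2,p)$ such that for every $(u_0,u_1)\in\mathcal{H}^s(\mathbb{T}^2)$ there exist $0<T=T(u_0,u_1)\le1$ and a unique solution $(u,\partial_tu)$ on $[0,T]$ in the class $$(u,\partial_tu)\in C([0,T];\mathcal{H}^s(\mathbb{T}^2)),\qquad u\in L^q([0,T];L^r(\mathbb{T}^2)).$$ Here a solution is a function $u$ with $|u|^{p-1}u\in L^1([0,T]\times\mathbb{T}^2)$, with the initial data above, and satisfying the Duhamel formula $$u(t)=V(t)(u_0,u_1)\mp\int_0^tS(t-t')\big(|u|^{p-1}u\big)(t')\,dt',\qquad 0\le t\le T .$$ If $u_0$ and $u_1$ are real-valued, then so are $u(t)$ and $\partial_tu(t)$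 for all $t\in[0,T]$. -/

import Mathlib

open MeasureTheory Set Filter
open scoped Topology ENNReal

noncomputable section

namespace VNLW

/-- The two-dimensional torus `𝕋² = (ℝ/ℤ)²`. -/
abbrev Torus : Type := UnitAddTorus (Fin 2)

/-- The frequency lattice `ℤ²`. -/
abbrev Freq : Type := Fin 2 → ℤ

/-- The Haar probability measure on `𝕋²` (the one with respect to which Mathlib's Fourier
coefficients `UnitAddTorus.mFourierCoeff` are taken). -/
abbrev torusMeasure : Measure Torus := Measure.pi fun _ => AddCircle.haarAddCircle

/-- The space `L²(𝕋²)` of complex-valued functions. -/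
abbrev L2 : Type := Lp ℂ 2 torusMeasure

/-- A periodic distribution, given through its family of Fourier coefficients. -/
abbrev Dist : Type := Freq → ℂ

/-- The Fourier coefficients of a function on the torus. -/
def coeffs (f : Torus → ℂ) : Dist := fun n => UnitAddTorus.mFourierCoeff f n

/-- The Euclidean length `|n|` of a frequency: the symbol of `D = √(-Δ)`. -/
def freqNorm (n : Freq) : ℝ := Real.sqrt (∑ i, (n i : ℝ) ^ 2)

/-- The Japanese bracket `⟨n⟩ = (1 + |n|²)^{1/2}`. -/
def bracket (n : Freq) : ℝ := Real.sqrt (1 + freqNorm n ^ 2)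

/-- The symbol `(1 + ¾|n|²)^{1/2}` of the operator `√(1 - ¾Δ)`. -/
def dispersion (n : Freq) : ℝ := Real.sqrt (1 + 3 / 4 * freqNorm n ^ 2)

/-! ### Sobolev spaces -/

/-- Membership of a periodic distribution in `H^s(𝕋²)`. -/
def MemSobolev (s : ℝ) (a : Dist) : Prop :=
  Summable fun n => bracket n ^ (2 * s) * ‖a n‖ ^ 2

/-- The norm of `H^s(𝕋²)`; it is meaningful on distributions satisfying `MemSobolev s`. -/
def sobolevNorm (s : ℝ) (a : Dist) : ℝ :=
  Real.sqrt (∑' n, bracket n ^ (2 * s) * ‖a n‖ ^ 2)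

/-- `a ∈ C([0,T]; H^s(𝕋²))`. -/
def ContinuousInSobolev (s T : ℝ) (a : ℝ → Dist) : Prop :=
  (∀ t ∈ Icc 0 T, MemSobolev s (a t)) ∧
    ∀ t ∈ Icc 0 T, Tendsto (fun τ => sobolevNorm s (a τ - a t)) (𝓝[Icc 0 T] t) (𝓝 0)

/-- A periodic distribution is real-valued when its Fourier coefficients satisfy
`â(-n) = conj (â n)`. -/
def IsRealValued (a : Dist) : Prop := ∀ n, a (-n) = star (a n)

/-! ### Linear propagators and the nonlinearity -/

/-- The symbol of `S(t) = e^{-Dt/2} sin(t√(1-¾Δ)) / √(1-¾Δ)`. -/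
def symbolS (t : ℝ) (n : Freq) : ℝ :=
  Real.exp (-(freqNorm n / 2) * t) * (Real.sin (t * dispersion n) / dispersion n)

/-- The symbol of
`e^{-Dt/2} (cos(t√(1-¾Δ)) + D / (2√(1-¾Δ)) sin(t√(1-¾Δ)))`. -/
def symbolC (t : ℝ) (n : Freq) : ℝ :=
  Real.exp (-(freqNorm n / 2) * t) *
    (Real.cos (t * dispersion n) +
      freqNorm n / (2 * dispersion n) * Real.sin (t * dispersion n))

/-- The Fourier multiplier `S(t)`. -/
def propS (t : ℝ) (a : Dist) : Dist := fun n => (symbolS t n : ℂ) * a n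

/-- The propagator `V(t)(φ₀, φ₁)` of `∂ₜ²u + (1-Δ)u + D∂ₜu = 0` with data `(φ₀, φ₁)`. -/
def propV (t : ℝ) (φ₀ φ₁ : Dist) : Dist := fun n => (symbolC t n : ℂ) * φ₀ n + propS t φ₁ n

/-- The power nonlinearity `z ↦ |z|^{p-1} z`. -/
def powerNonlin (p : ℝ) (z : ℂ) : ℂ := ((‖z‖ ^ (p - 1) : ℝ) : ℂ) * z

/-- The scaling critical regularity `max (1 - 2/(p-1), 0)`, for `p > 1`. -/
def sCrit (p : ℝ) : ℝ := max (1 - 2 / (p - 1)) 0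

/-! ### Solutions -/

/-- `u ∈ L^q([0,T]; L^r(𝕋²))`, for finite exponents. It is used for paths `u` that are
continuous into `L²(𝕋²)` on `[0,T]`, so that measurability in time is automatic. -/
def MemLqLr (q r T : ℝ) (u : ℝ → L2) : Prop :=
  ∫⁻ t in Icc 0 T, (eLpNorm (u t) (ENNReal.ofReal r) torusMeasure) ^ q < ∞

/-- The class of pairs `(u, v)`, `v = ∂ₜu`, with `(u, ∂ₜu) ∈ C([0,T]; H^s × H^{s-1})` and
`u ∈ L^q([0,T]; L^r)`, for `s ≥ 0`. Given the continuity of `v` in `H^{s-1}`, the relation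
`v = ∂ₜu` holds in `H^{s-1}`, equivalently in the sense of distributions, if and only if it holds
for every Fourier coefficient. -/
structure InSolutionClass (s q r T : ℝ) (u : ℝ → L2) (v : ℝ → Dist) : Prop where
  continuous_fst : ContinuousInSobolev s T fun t => coeffs (u t)
  continuous_snd : ContinuousInSobolev (s - 1) T v
  deriv_eq : ∀ n, ∀ t ∈ Icc 0 T,
    HasDerivWithinAt (fun τ => coeffs (u τ) n) (v t n) (Icc 0 T) t
  mem_LqLr : MemLqLr q r T u

/-- `(u, v)`, with `v = ∂ₜu`, solves
`∂ₜ²u + (1-Δ)u + D∂ₜu + κ|u|^{p-1}u = 0`, `(u, ∂ₜu)|_{t=0} = (u₀, u₁)` on `[0,T]`, i.e. the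
nonlinear term is integrable on `[0,T] × 𝕋²` and
`u(t) = V(t)(u₀,u₁) - κ ∫₀ᵗ S(t-t') (|u|^{p-1}u)(t') dt'` as distributions for `t ∈ [0,T]`. -/
structure IsSolution (κ p T : ℝ) (u₀ u₁ : Dist) (u : ℝ → L2) (v : ℝ → Dist) : Prop where
  init_fst : coeffs (u 0) = u₀
  init_snd : v 0 = u₁
  integrable : ∫⁻ t in Icc 0 T, ∫⁻ x, ‖powerNonlin p (u t x)‖ₑ ∂torusMeasure < ∞
  duhamel : ∀ t ∈ Icc 0 T, ∀ n,
    coeffs (u t) n = propV t u₀ u₁ n -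
      (κ : ℂ) * ∫ τ in (0 : ℝ)..t, propS (t - τ) (coeffs fun x => powerNonlin p (u τ x)) n

end VNLW

end

/-!
The equation is semilinear with a parabolic gain: for times at most one both propagators are
bounded by `e^{-⟨n⟩t/2}` on the frequency `n`, up to the weight `⟨n⟩^{-1}` for `S(t)`. The solution
is the fixed point of the Duhamel map in `L^q_t L^r_x`.

*Linear estimates.* The `L^q` norm in time of `e^{-⟨n⟩t/2}` is of order `⟨n⟩^{-1/q}`. Minkowski's
inequality therefore gives Strichartz estimates with a gain of `1/q` derivatives for the free
evolution (`strichartz_decay`) and for the Duhamel term of a source in `L¹_t`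
(`strichartz_causalConv`). They are combined with the sharp embedding `H^{1-2/r} ⊂ L^r` on the
two-dimensional torus (`sobolev_embedding`), which is proved by cutting `f` into low and high
frequencies at a threshold depending on the level in the layer cake formula, and with its dual
(`sobolev_embedding_dual`).

*Contraction.* Hölder's inequality in space and the dual embedding show that `|u|^{p-1}u` is locally
Lipschitz from `L^r` to `H^{s-1}` (`eH_nonlin_sub_le`); with `q ≥ p`, Hölder's inequality in time
bounds the difference of two sources in `L¹_t H^{s-1}` (`lintegral_source_sub_le`). The exponents
`q`, `r` for which all of this fits together exist for the regularity `min(s, 1)` throughout the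
stated range of `s` (`exists_admissible`). Because the free evolution has small `L^q_t L^r_x` norm on
a short time interval, Picard iteration converges, and it preserves real-valuedness
(`exists_fixedPoint`). Uniqueness holds in the whole class, since the norm of a solution is small on
short intervals and the difference of two solutions sees only the part of the source after they
separate (`duhamel_sub_le`, `eq_of_fixedPoint`).

*Higher regularity.* For `s > 1` the solution is the one obtained at regularity `1`, and only its
regularity has to be improved (`persistence_of_regularity`). The Duhamel operator gains almost two
derivatives on sources bounded in time (`eH_causalConv_smoothing`), so that it suffices to bound
`|u|^{p-1}u` in `H^σ` for some `σ > s - 2` (`eH_powerNonlin_le`). The nonlinearity is a sum of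
rescalings `2^{-jp} φ(2^j z)` of a smooth function `φ` supported in an annulus. The chain
rule alone bounds `φ(2^j u)` in `H^σ` by `2^{jσ}`; half a derivative is gained because the gradient
of `u` has mean square of order `2^{-j}` on the set where `|u|` is at most a multiple of `2^{-j}`
(`integral_strip_le`, `eH_comp_trigPoly_le`). The sum converges for `σ < p + 1/2`, which is where the
condition `s < p + 5/2` comes from. For odd `p` the nonlinearity is smooth and there is no such
restriction.
-/


noncomputable section

namespace VNLW

/-! ### Minkowski's integral inequality -/

section Minkowski

variable {α β : Type*} [MeasurableSpace α] [MeasurableSpace β] {μ : Measure α} {ν : Measure β}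

/-- With `h x` the `L^p` norm of `f x`, Hölder's inequality for `f x y * h x ^ (-1/q)` and
`h x ^ (1/q)`, `q` conjugate to `p`, reduces the claim to Tonelli's theorem. -/
theorem lintegral_minkowski_of_measurable [SFinite μ] [SFinite ν] {f : α → β → ℝ≥0∞}
    (hf : Measurable (Function.uncurry f)) {p : ℝ} (hp : 1 ≤ p) :
    (∫⁻ y, (∫⁻ x, f x y ∂μ) ^ p ∂ν) ^ (1 / p) ≤ ∫⁻ x, (∫⁻ y, f x y ^ p ∂ν) ^ (1 / p) ∂μ := by
  rcases hp.eq_or_lt with rfl | hp1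
  · simp only [ENNReal.rpow_one, div_one]
    exact (lintegral_lintegral_swap hf.aemeasurable).ge
  have hp0 : 0 < p := by linarith
  set h : α → ℝ≥0∞ := fun x => (∫⁻ y, f x y ^ p ∂ν) ^ (1 / p) with hh
  have hfm : ∀ y, Measurable fun x => f x y := fun y => hf.comp measurable_prodMk_right
  have hfm' : ∀ x, Measurable fun y => f x y := fun x => hf.comp measurable_prodMk_left
  have hm : Measurable h :=
    (Measurable.lintegral_prod_right' (ν := ν) (f := fun z : α × β => f z.1 z.2 ^ p)
      (hf.pow_const p)).pow_const _
  have hhp : ∀ x, ∫⁻ y, f x y ^ p ∂ν = h x ^ p := fun x => by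
    rw [hh]; simp only [← ENNReal.rpow_mul]; rw [one_div_mul_cancel hp0.ne', ENNReal.rpow_one]
  by_cases hH : ∫⁻ x, h x ∂μ = ∞
  · rw [hH]; exact le_top
  have hfin : ∀ᵐ x ∂μ, h x < ∞ := ae_lt_top hm hH
  -- where `h` vanishes, so does `f x ·` almost everywhere
  have hzero : ∀ᵐ y ∂ν, ∀ᵐ x ∂μ, h x = 0 → f x y = 0 := by
    have h1 : ∫⁻ y, ∫⁻ x, (h ⁻¹' {0}).indicator (fun x => f x y) x ∂μ ∂ν = 0 := by
      have hms : MeasurableSet (h ⁻¹' {0}) := hm (measurableSet_singleton 0)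
      have hmi : Measurable (Function.uncurry fun x y =>
          (h ⁻¹' {0}).indicator (fun x => f x y) x) := by
        have : (Function.uncurry fun x y => (h ⁻¹' {0}).indicator (fun x => f x y) x)
            = ((h ⁻¹' {0}) ×ˢ univ).indicator (Function.uncurry f) := by
          ext ⟨x, y⟩
          by_cases hx : x ∈ h ⁻¹' {0} <;> simp [Function.uncurry, indicator, hx]
        rw [this]; exact hf.indicator (hms.prod MeasurableSet.univ)
      rw [← lintegral_lintegral_swap hmi.aemeasurable]
      refine (lintegral_congr fun x => ?_).trans lintegral_zero
      by_cases hx : h x = 0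
      · have h2 : ∫⁻ y, f x y ^ p ∂ν = 0 := by rw [hhp, hx, ENNReal.zero_rpow_of_pos hp0]
        have h3 := (lintegral_eq_zero_iff ((hfm' x).pow_const p)).1 h2
        refine (lintegral_congr_ae ?_).trans lintegral_zero
        filter_upwards [h3] with y hy
        have : f x y = 0 := by simpa [hp0.not_gt, hp0] using hy
        simp [indicator, this]
      · simp [indicator, hx]
    have h4 := (lintegral_eq_zero_iff' ?_).1 h1
    · filter_upwards [h4] with y hy
      have hms : MeasurableSet (h ⁻¹' {0}) := hm (measurableSet_singleton 0)
      have h5 := (lintegral_eq_zero_iff ((hfm y).indicator hms)).1 hy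
      filter_upwards [h5] with x hx h0
      simpa [indicator, h0] using hx
    · have hms : MeasurableSet (h ⁻¹' {0}) := hm (measurableSet_singleton 0)
      have : (fun y => ∫⁻ x, (h ⁻¹' {0}).indicator (fun x => f x y) x ∂μ)
          = fun y => ∫⁻ x in h ⁻¹' {0}, f x y ∂μ := by
        ext y; rw [lintegral_indicator hms]
      rw [this]
      exact (Measurable.lintegral_prod_left' (μ := μ.restrict (h ⁻¹' {0})) hf).aemeasurable
  have hpq : p.HolderConjugate (p.conjExponent) := .conjExponent hp1
  set q := p.conjExponent
  have hq0 : 0 < q := hpq.symm.pos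
  have hp1q : p * (1 / q) = p - 1 := by
    have := hpq.inv_add_inv_eq_one
    have h2 : 1 / q = 1 - p⁻¹ := by rw [one_div]; linarith
    rw [h2]; field_simp
  -- Hölder in `x`; the weight is undone on integrating the `p`-th power over `y`
  have key : ∀ᵐ y ∂ν, (∫⁻ x, f x y ∂μ) ^ p
      ≤ (∫⁻ x, h x ∂μ) ^ (p - 1) * ∫⁻ x, f x y ^ p * h x ^ (1 - p) ∂μ := by
    filter_upwards [hzero] with y hy
    have h1 : ∫⁻ x, f x y ∂μ ≤ ∫⁻ x, (f x y * h x ^ (-(1 / q))) * h x ^ (1 / q) ∂μ := by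
      refine lintegral_mono_ae ?_
      filter_upwards [hy, hfin] with x hx hx'
      by_cases h0 : h x = 0
      · rw [hx h0]; exact zero_le
      · rw [mul_assoc, ← ENNReal.rpow_add _ _ h0 hx'.ne]; simp
    have h2 := ENNReal.lintegral_mul_le_Lp_mul_Lq μ hpq
      ((hfm y).mul (hm.pow_const (-(1 / q)))).aemeasurable (hm.pow_const (1 / q)).aemeasurable
    have h3 := ENNReal.rpow_le_rpow (h1.trans h2) hp0.le
    refine h3.trans (le_of_eq ?_)
    rw [ENNReal.mul_rpow_of_nonneg _ _ hp0.le, ← ENNReal.rpow_mul, ← ENNReal.rpow_mul,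
      one_div_mul_cancel hp0.ne', ENNReal.rpow_one, mul_comm]
    congr 1
    · simp only [← ENNReal.rpow_mul, one_div_mul_cancel hq0.ne', ENNReal.rpow_one]
      rw [mul_comm, hp1q]
    · refine lintegral_congr fun x => ?_
      simp only [Pi.mul_apply]
      rw [ENNReal.mul_rpow_of_nonneg _ _ hp0.le, ← ENNReal.rpow_mul]
      congr 2
      rw [neg_mul, mul_comm, hp1q]; ring
  have hfin2 : ∫⁻ y, (∫⁻ x, f x y ∂μ) ^ p ∂ν ≤ (∫⁻ x, h x ∂μ) ^ p := by
    calc ∫⁻ y, (∫⁻ x, f x y ∂μ) ^ p ∂ν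
        ≤ ∫⁻ y, (∫⁻ x, h x ∂μ) ^ (p - 1) * ∫⁻ x, f x y ^ p * h x ^ (1 - p) ∂μ ∂ν :=
          lintegral_mono_ae key
      _ = (∫⁻ x, h x ∂μ) ^ (p - 1) * ∫⁻ y, ∫⁻ x, f x y ^ p * h x ^ (1 - p) ∂μ ∂ν :=
          lintegral_const_mul' _ _ (ENNReal.rpow_ne_top_of_nonneg (by linarith) hH)
      _ = (∫⁻ x, h x ∂μ) ^ (p - 1) * ∫⁻ x, ∫⁻ y, f x y ^ p * h x ^ (1 - p) ∂ν ∂μ := by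
          rw [← lintegral_lintegral_swap (f := fun x y => f x y ^ p * h x ^ (1 - p))]
          exact ((hf.pow_const p).mul ((hm.comp measurable_fst).pow_const (1 - p))).aemeasurable
      _ ≤ (∫⁻ x, h x ∂μ) ^ (p - 1) * ∫⁻ x, h x ∂μ := by
          refine mul_le_mul_right ?_ _
          refine lintegral_mono_ae ?_
          filter_upwards [hfin] with x hx
          rw [lintegral_mul_const _ ((hfm' x).pow_const p), hhp]
          by_cases h0 : h x = 0
          · rw [h0, ENNReal.zero_rpow_of_pos hp0, zero_mul]
          · rw [← ENNReal.rpow_add _ _ h0 hx.ne]; simp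
      _ = (∫⁻ x, h x ∂μ) ^ p := by
          by_cases h0 : ∫⁻ x, h x ∂μ = 0
          · rw [h0, mul_zero, ENNReal.zero_rpow_of_pos hp0]
          · nth_rewrite 2 [← ENNReal.rpow_one (∫⁻ x, h x ∂μ)]
            rw [← ENNReal.rpow_add _ _ h0 hH]; congr 1; ring
  calc (∫⁻ y, (∫⁻ x, f x y ∂μ) ^ p ∂ν) ^ (1 / p)
      ≤ ((∫⁻ x, h x ∂μ) ^ p) ^ (1 / p) := ENNReal.rpow_le_rpow hfin2 (by positivity)
    _ = ∫⁻ x, h x ∂μ := by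
      rw [← ENNReal.rpow_mul, mul_one_div_cancel hp0.ne', ENNReal.rpow_one]

/-- **Minkowski's integral inequality** for nonnegative functions: the `L^p` norm of an integral
is at most the integral of the `L^p` norms. -/
theorem lintegral_minkowski [SFinite μ] [SFinite ν] {f : α → β → ℝ≥0∞}
    (hf : AEMeasurable (Function.uncurry f) (μ.prod ν)) {p : ℝ} (hp : 1 ≤ p) :
    (∫⁻ y, (∫⁻ x, f x y ∂μ) ^ p ∂ν) ^ (1 / p) ≤ ∫⁻ x, (∫⁻ y, f x y ^ p ∂ν) ^ (1 / p) ∂μ := by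
  set g : α → β → ℝ≥0∞ := fun x y => hf.mk _ (x, y)
  have hg : Measurable (Function.uncurry g) := hf.measurable_mk
  have h1 : ∀ᵐ x ∂μ, ∀ᵐ y ∂ν, f x y = g x y := Measure.ae_ae_of_ae_prod hf.ae_eq_mk
  have h2 : ∀ᵐ y ∂ν, ∀ᵐ x ∂μ, f x y = g x y := by
    have := hf.prod_swap
    have h3 : ∀ᵐ z ∂(ν.prod μ), Function.uncurry f z.swap = hf.mk _ z.swap :=
      Measure.measurePreserving_swap.quasiMeasurePreserving.ae hf.ae_eq_mk
    exact Measure.ae_ae_of_ae_prod h3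
  have e1 : ∫⁻ y, (∫⁻ x, f x y ∂μ) ^ p ∂ν = ∫⁻ y, (∫⁻ x, g x y ∂μ) ^ p ∂ν := by
    refine lintegral_congr_ae ?_
    filter_upwards [h2] with y hy
    rw [lintegral_congr_ae hy]
  have e2 : ∫⁻ x, (∫⁻ y, f x y ^ p ∂ν) ^ (1 / p) ∂μ
      = ∫⁻ x, (∫⁻ y, g x y ^ p ∂ν) ^ (1 / p) ∂μ := by
    refine lintegral_congr_ae ?_
    filter_upwards [h1] with x hx
    have : ∫⁻ y, f x y ^ p ∂ν = ∫⁻ y, g x y ^ p ∂ν := by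
      refine lintegral_congr_ae ?_
      filter_upwards [hx] with y hy
      rw [hy]
    simp only [this]
  rw [e1, e2]
  exact lintegral_minkowski_of_measurable hg hp

theorem aemeasurable_uncurry_count {γ : Type*} [MeasurableSpace γ] [Countable γ]
    [MeasurableSingletonClass γ] [SFinite μ] {f : α → γ → ℝ≥0∞}
    (hf : ∀ c, AEMeasurable (fun x => f x c) μ) :
    AEMeasurable (Function.uncurry f) (μ.prod (Measure.count : Measure γ)) := by
  refine ⟨fun z => (hf z.2).mk _ z.1,
    measurable_from_prod_countable_left fun c => (hf c).measurable_mk, ?_⟩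
  have h : ∀ᵐ x ∂μ, ∀ c, f x c = (hf c).mk _ x := ae_all_iff.2 fun c => (hf c).ae_eq_mk
  exact Measure.quasiMeasurePreserving_fst.ae h |>.mono fun z hz => hz z.2

end Minkowski

/-! ### Weighted square norms of Fourier coefficients -/

theorem bracket_sq (n : Freq) : bracket n ^ 2 = 1 + freqNorm n ^ 2 :=
  Real.sq_sqrt (by positivity)

theorem freqNorm_nonneg (n : Freq) : 0 ≤ freqNorm n := Real.sqrt_nonneg _

theorem freqNorm_sq (n : Freq) : freqNorm n ^ 2 = ∑ i, (n i : ℝ) ^ 2 :=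
  Real.sq_sqrt (Finset.sum_nonneg fun _ _ => sq_nonneg _)

theorem one_le_bracket (n : Freq) : 1 ≤ bracket n :=
  Real.one_le_sqrt.2 (by nlinarith [sq_nonneg (freqNorm n)])

theorem bracket_pos (n : Freq) : 0 < bracket n := lt_of_lt_of_le one_pos (one_le_bracket n)

theorem bracket_le (n : Freq) : bracket n ≤ 1 + freqNorm n := by
  have := bracket_sq n
  nlinarith [freqNorm_nonneg n, bracket_pos n]

theorem freqNorm_le_bracket (n : Freq) : freqNorm n ≤ bracket n := by
  have := bracket_sq n
  nlinarith [freqNorm_nonneg n, bracket_pos n]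

/-- The Sobolev norm `‖a‖_{H^s}` as an extended nonnegative real number, infinite outside `H^s`.
It is written as an integral for the counting measure, to which the integral inequalities of
Hölder and Minkowski apply. -/
def eH (s : ℝ) (a : Dist) : ℝ≥0∞ :=
  (∫⁻ n, (ENNReal.ofReal (bracket n ^ s) * ‖a n‖ₑ) ^ (2 : ℝ) ∂Measure.count) ^ (1 / 2 : ℝ)

theorem eH_sq (s : ℝ) (a : Dist) :
    eH s a ^ (2 : ℝ) = ∑' n, (ENNReal.ofReal (bracket n ^ s) * ‖a n‖ₑ) ^ (2 : ℝ) := by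
  rw [eH, ← ENNReal.rpow_mul, lintegral_count]; norm_num

theorem eH_eq_tsum (s : ℝ) (a : Dist) :
    eH s a = (∑' n, (ENNReal.ofReal (bracket n ^ s) * ‖a n‖ₑ) ^ (2 : ℝ)) ^ (1 / 2 : ℝ) := by
  rw [eH, lintegral_count]

theorem weight_sq (s : ℝ) (a : Dist) (n : Freq) :
    (ENNReal.ofReal (bracket n ^ s) * ‖a n‖ₑ) ^ (2 : ℝ)
      = ENNReal.ofReal (bracket n ^ (2 * s) * ‖a n‖ ^ 2) := by
  have hb := bracket_pos n
  rw [← ofReal_norm, ← ENNReal.ofReal_mul (by positivity),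
    ENNReal.ofReal_rpow_of_nonneg (by positivity) (by norm_num)]
  congr 1
  rw [Real.mul_rpow (by positivity) (by positivity), ← Real.rpow_mul hb.le, mul_comm s 2]
  norm_num

theorem memSobolev_iff {s : ℝ} {a : Dist} : MemSobolev s a ↔ eH s a < ∞ := by
  have hnn : ∀ n, 0 ≤ bracket n ^ (2 * s) * ‖a n‖ ^ 2 := fun n => by
    have := bracket_pos n; positivity
  rw [eH_eq_tsum, ENNReal.rpow_lt_top_iff_of_pos (by norm_num)]
  simp only [weight_sq]
  constructor
  · intro h
    rw [← ENNReal.ofReal_tsum_of_nonneg hnn h]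
    exact ENNReal.ofReal_lt_top
  · intro h
    have := ENNReal.summable_toReal h.ne
    refine this.congr fun n => ?_
    rw [ENNReal.toReal_ofReal (hnn n)]

theorem sobolevNorm_eq {s : ℝ} (a : Dist) : sobolevNorm s a = (eH s a).toReal := by
  have hnn : ∀ n, 0 ≤ bracket n ^ (2 * s) * ‖a n‖ ^ 2 := fun n => by
    have := bracket_pos n; positivity
  rw [sobolevNorm, eH_eq_tsum, ← ENNReal.toReal_rpow, ENNReal.tsum_toReal_eq]
  · rw [Real.sqrt_eq_rpow]
    congr 1
    refine tsum_congr fun n => ?_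
    rw [weight_sq, ENNReal.toReal_ofReal (hnn n)]
  · intro n; rw [weight_sq]; exact ENNReal.ofReal_ne_top

theorem eH_mono {s s' : ℝ} (h : s ≤ s') {a b : Dist} (hab : ∀ n, ‖a n‖ₑ ≤ ‖b n‖ₑ) :
    eH s a ≤ eH s' b := by
  refine ENNReal.rpow_le_rpow (lintegral_mono fun n => ?_) (by norm_num)
  refine ENNReal.rpow_le_rpow (mul_le_mul' (ENNReal.ofReal_le_ofReal ?_) (hab n)) (by norm_num)
  exact Real.rpow_le_rpow_of_exponent_le (one_le_bracket n) h

theorem eH_mono_exp {s s' : ℝ} (h : s ≤ s') (a : Dist) : eH s a ≤ eH s' a :=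
  eH_mono h fun _ => le_rfl

/-- Weighted comparison of Sobolev norms: a multiplier bound gives a norm bound. -/
theorem eH_le_mul {s s' : ℝ} {a b : Dist} {C : ℝ≥0∞}
    (hab : ∀ n, ENNReal.ofReal (bracket n ^ s) * ‖a n‖ₑ
      ≤ C * (ENNReal.ofReal (bracket n ^ s') * ‖b n‖ₑ)) :
    eH s a ≤ C * eH s' b := by
  have h1 : eH s a ≤ (∫⁻ n, (C * (ENNReal.ofReal (bracket n ^ s') * ‖b n‖ₑ)) ^ (2 : ℝ)
      ∂Measure.count) ^ (1 / 2 : ℝ) :=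
    ENNReal.rpow_le_rpow (lintegral_mono fun n => ENNReal.rpow_le_rpow (hab n) (by norm_num))
      (by norm_num)
  refine h1.trans (le_of_eq ?_)
  simp only [ENNReal.mul_rpow_of_nonneg C _ (by norm_num : (0 : ℝ) ≤ 2)]
  rw [lintegral_const_mul _ (Measurable.of_discrete), ENNReal.mul_rpow_of_nonneg _ _ (by norm_num),
    ← ENNReal.rpow_mul, eH]
  norm_num

theorem eH_zero (s : ℝ) : eH s 0 = 0 := by
  have := eH_le_mul (s := s) (s' := s) (a := 0) (b := 0) (C := 0) (by simp)
  simpa using this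

theorem eH_smul_le (s : ℝ) (c : ℂ) (a : Dist) : eH s (c • a) ≤ ‖c‖ₑ * eH s a :=
  eH_le_mul fun n => by
    rw [Pi.smul_apply, smul_eq_mul, enorm_mul]; exact le_of_eq (by ring)

theorem eH_add_le (s : ℝ) (a b : Dist) : eH s (a + b) ≤ eH s a + eH s b := by
  have h := ENNReal.lintegral_Lp_add_le (μ := (Measure.count : Measure Freq)) (p := 2)
    (f := fun n => ENNReal.ofReal (bracket n ^ s) * ‖a n‖ₑ)
    (g := fun n => ENNReal.ofReal (bracket n ^ s) * ‖b n‖ₑ)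
    Measurable.of_discrete.aemeasurable Measurable.of_discrete.aemeasurable (by norm_num)
  refine le_trans (ENNReal.rpow_le_rpow (lintegral_mono fun n => ?_) (by norm_num)) h
  refine ENNReal.rpow_le_rpow ?_ (by norm_num)
  simp only [Pi.add_apply, ← mul_add]
  gcongr
  exact enorm_add_le _ _

theorem eH_neg (s : ℝ) (a : Dist) : eH s (-a) = eH s a := by simp [eH]

theorem eH_sub_le (s : ℝ) (a b : Dist) : eH s (a - b) ≤ eH s a + eH s b := by
  rw [sub_eq_add_neg]
  exact (eH_add_le s a (-b)).trans_eq (by rw [eH_neg])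

theorem weight_le_eH (s : ℝ) (a : Dist) (n : Freq) :
    ENNReal.ofReal (bracket n ^ s) * ‖a n‖ₑ ≤ eH s a := by
  have h : (ENNReal.ofReal (bracket n ^ s) * ‖a n‖ₑ) ^ (2 : ℝ) ≤ eH s a ^ (2 : ℝ) := by
    rw [eH_sq]; exact ENNReal.le_tsum n
  exact (ENNReal.rpow_le_rpow_iff (by norm_num)).1 h

/-- Lower semicontinuity of Sobolev norms under convergence of each Fourier coefficient. -/
theorem eH_le_of_tendsto {ι : Type*} {l : Filter ι} [l.NeBot] {s : ℝ} {a : ι → Dist} {b : Dist}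
    {C : ℝ≥0∞} (h : ∀ n, Tendsto (fun i => a i n) l (𝓝 (b n))) (hC : ∀ᶠ i in l, eH s (a i) ≤ C) :
    eH s b ≤ C := by
  rw [eH_eq_tsum, one_div, ENNReal.rpow_inv_le_iff (by norm_num)]
  refine ENNReal.summable.tsum_le_of_sum_le fun S => ?_
  have h1 : Tendsto (fun i => ∑ n ∈ S, (ENNReal.ofReal (bracket n ^ s) * ‖a i n‖ₑ) ^ (2 : ℝ)) l
      (𝓝 (∑ n ∈ S, (ENNReal.ofReal (bracket n ^ s) * ‖b n‖ₑ) ^ (2 : ℝ))) := by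
    refine tendsto_finsetSum S fun n _ => ?_
    exact (ENNReal.continuous_rpow_const.tendsto _).comp
      (ENNReal.Tendsto.const_mul ((continuous_enorm.tendsto _).comp (h n))
        (Or.inr ENNReal.ofReal_ne_top))
  refine le_of_tendsto h1 (hC.mono fun i hi => ?_)
  calc ∑ n ∈ S, (ENNReal.ofReal (bracket n ^ s) * ‖a i n‖ₑ) ^ (2 : ℝ)
      ≤ ∑' n, (ENNReal.ofReal (bracket n ^ s) * ‖a i n‖ₑ) ^ (2 : ℝ) := ENNReal.sum_le_tsum S
    _ = eH s (a i) ^ (2 : ℝ) := (eH_sq s _).symm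
    _ ≤ C ^ (2 : ℝ) := ENNReal.rpow_le_rpow hi (by norm_num)

/-- Minkowski's inequality for integrals of sequences measured in Sobolev norms. -/
theorem eH_lintegral_le {α : Type*} [MeasurableSpace α] {μ : Measure α} [SFinite μ] {s s' : ℝ}
    {f : α → Freq → ℝ≥0∞} {F : α → Dist} {b : Dist} {g : α → ℝ≥0∞}
    (hf : ∀ n, AEMeasurable (fun x => f x n) μ)
    (hb : ∀ n, ‖b n‖ₑ ≤ ∫⁻ x, f x n ∂μ)
    (hfF : ∀ᵐ x ∂μ, ∀ n, ENNReal.ofReal (bracket n ^ s) * f x n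
      ≤ g x * (ENNReal.ofReal (bracket n ^ s') * ‖F x n‖ₑ)) :
    eH s b ≤ ∫⁻ x, g x * eH s' (F x) ∂μ := by
  have h1 : eH s b ≤ (∫⁻ n, (∫⁻ x, ENNReal.ofReal (bracket n ^ s) * f x n ∂μ) ^ (2 : ℝ)
      ∂(Measure.count : Measure Freq)) ^ (1 / 2 : ℝ) := by
    refine ENNReal.rpow_le_rpow (lintegral_mono fun n => ?_) (by norm_num)
    refine ENNReal.rpow_le_rpow ?_ (by norm_num)
    rw [lintegral_const_mul' _ _ ENNReal.ofReal_ne_top]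
    gcongr
    exact hb n
  refine h1.trans ((lintegral_minkowski (aemeasurable_uncurry_count fun n =>
    (hf n).const_mul _) (by norm_num)).trans (lintegral_mono_ae ?_))
  filter_upwards [hfF] with x hx
  calc _ ≤ (∫⁻ n, (g x * (ENNReal.ofReal (bracket n ^ s') * ‖F x n‖ₑ)) ^ (2 : ℝ)
      ∂Measure.count) ^ (1 / 2 : ℝ) :=
        ENNReal.rpow_le_rpow (lintegral_mono fun n => ENNReal.rpow_le_rpow (hx n) (by norm_num))
          (by norm_num)
    _ = g x * eH s' (F x) := by
        simp only [ENNReal.mul_rpow_of_nonneg (g x) _ (by norm_num : (0 : ℝ) ≤ 2)]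
        rw [lintegral_const_mul _ (Measurable.of_discrete),
          ENNReal.mul_rpow_of_nonneg _ _ (by norm_num), ← ENNReal.rpow_mul, eH]
        norm_num

/-! ### Fourier series of square integrable functions -/

theorem torus_repr (f : L2) (n : Freq) :
    (UnitAddTorus.mFourierBasis (d := Fin 2)).repr f n = coeffs f n :=
  UnitAddTorus.mFourierBasis_repr f n

theorem coeffs_congr_ae {f g : Torus → ℂ} (h : f =ᵐ[torusMeasure] g) : coeffs f = coeffs g := by
  funext n
  exact integral_congr_ae (h.mono fun x hx => by simp only [hx])

theorem coeffs_eq (f : Torus → ℂ) (n : Freq) :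
    coeffs f n = ∫ x, UnitAddTorus.mFourier (-n) x * f x ∂torusMeasure := rfl

theorem mFourier_norm_apply (n : Freq) (x : Torus) : ‖UnitAddTorus.mFourier n x‖ = 1 := by
  simp [UnitAddTorus.mFourier, Circle.norm_coe]

theorem coeffs_sub (f g : L2) : coeffs (f - g : L2) = coeffs f - coeffs g := by
  funext n
  simp only [Pi.sub_apply, ← torus_repr, map_sub]
  rfl

theorem eH_zero_coeffs (f : L2) : eH 0 (coeffs f) = ‖f‖ₑ := by
  rw [eH_eq_tsum]
  simp only [weight_sq]
  simp only [mul_zero, Real.rpow_zero, one_mul]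
  have h1 : HasSum (fun n => ‖coeffs f n‖ ^ 2) (∫ x, ‖f x‖ ^ 2 ∂torusMeasure) :=
    UnitAddTorus.hasSum_sq_mFourierCoeff f
  have h2 : ∫ x, ‖f x‖ ^ 2 ∂torusMeasure = ‖f‖ ^ 2 := by
    have := L2.inner_def (𝕜 := ℂ) f f
    rw [inner_self_eq_norm_sq_to_K] at this
    simp only [inner_self_eq_norm_sq_to_K] at this
    have h3 : ((‖f‖ ^ 2 : ℝ) : ℂ) = ((∫ x, ‖f x‖ ^ 2 ∂torusMeasure : ℝ) : ℂ) := by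
      refine (by push_cast; exact this : ((‖f‖ ^ 2 : ℝ) : ℂ)
        = ∫ x, ((‖f x‖ ^ 2 : ℝ) : ℂ) ∂torusMeasure).trans integral_ofReal
    exact_mod_cast h3.symm
  rw [← ENNReal.ofReal_tsum_of_nonneg (fun n => by positivity) h1.summable, h1.tsum_eq, h2,
    ← ofReal_norm, ENNReal.ofReal_rpow_of_nonneg (by positivity) (by norm_num)]
  congr 1
  rw [← Real.sqrt_eq_rpow, Real.sqrt_sq (norm_nonneg f)]

theorem eLpNorm_two_eq (f : L2) : eLpNorm f 2 torusMeasure = eH 0 (coeffs f) := by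
  rw [eH_zero_coeffs, Lp.enorm_def]

theorem eq_of_coeffs_eq {f g : L2} (h : coeffs f = coeffs g) : f = g := by
  have : ‖f - g‖ₑ = 0 := by rw [← eH_zero_coeffs, coeffs_sub, h, sub_self, eH_zero]
  rwa [enorm_eq_zero, sub_eq_zero] at this

theorem memℓp_of_eH {a : Dist} (h : eH 0 a < ∞) : Memℓp a 2 := by
  rw [memℓp_gen_iff (by norm_num)]
  have := memSobolev_iff.2 h
  simpa [MemSobolev] using this

open Classical in
/-- The square integrable function with given square summable Fourier coefficients; it is zero
when the coefficients are not square summable. -/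
def toL2 (a : Dist) : L2 :=
  if h : eH 0 a < ∞ then (UnitAddTorus.mFourierBasis (d := Fin 2)).repr.symm ⟨a, memℓp_of_eH h⟩
  else 0

theorem coeffs_toL2 {a : Dist} (h : eH 0 a < ∞) : coeffs (toL2 a) = a := by
  funext n
  rw [toL2, dif_pos h, ← torus_repr]
  simp

theorem toL2_coeffs (f : L2) : toL2 (coeffs f) = f :=
  eq_of_coeffs_eq (coeffs_toL2 (by rw [eH_zero_coeffs]; exact enorm_lt_top))

theorem toL2_sub {a b : Dist} (ha : eH 0 a < ∞) (hb : eH 0 b < ∞) :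
    toL2 (a - b) = toL2 a - toL2 b :=
  eq_of_coeffs_eq (by
    rw [coeffs_sub, coeffs_toL2 ha, coeffs_toL2 hb, coeffs_toL2]
    exact (eH_sub_le 0 a b).trans_lt (ENNReal.add_lt_top.2 ⟨ha, hb⟩))

/-! ### Sums over the frequency lattice -/

/-- `max 1 |m|` for an integer `m`; products of it over the two coordinates bound powers of
`⟨n⟩` and factor lattice sums into sums over `ℤ`. -/
def intBracket (m : ℤ) : ℝ := max 1 |(m : ℝ)|

theorem one_le_intBracket (m : ℤ) : 1 ≤ intBracket m := le_max_left _ _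

theorem intBracket_pos (m : ℤ) : 0 < intBracket m := lt_of_lt_of_le one_pos (one_le_intBracket m)

theorem abs_apply_le_freqNorm (n : Freq) (i : Fin 2) : |(n i : ℝ)| ≤ freqNorm n := by
  rw [freqNorm]
  refine Real.abs_le_sqrt ?_
  exact Finset.single_le_sum (f := fun i => (n i : ℝ) ^ 2) (fun _ _ => sq_nonneg _)
    (Finset.mem_univ i)

theorem intBracket_le_bracket (n : Freq) (i : Fin 2) : intBracket (n i) ≤ bracket n :=
  max_le (one_le_bracket n) ((abs_apply_le_freqNorm n i).trans (freqNorm_le_bracket n))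

theorem prod_intBracket_rpow_ge (n : Freq) {c : ℝ} (hc : 0 ≤ c) :
    bracket n ^ (-(2 * c)) ≤ ∏ i, intBracket (n i) ^ (-c) := by
  have hb := bracket_pos n
  have h0 := intBracket_pos (n 0)
  have h1 := intBracket_pos (n 1)
  rw [Fin.prod_univ_two, ← Real.mul_rpow h0.le h1.le, show -(2 * c) = 2 * (-c) by ring,
    Real.rpow_mul hb.le]
  refine Real.rpow_le_rpow_of_nonpos (by positivity) ?_ (by linarith)
  have e0 := intBracket_le_bracket n 0
  have e1 := intBracket_le_bracket n 1
  calc intBracket (n 0) * intBracket (n 1) ≤ bracket n * bracket n := by gcongr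
    _ = bracket n ^ (2 : ℝ) := by norm_num; ring

theorem sum_range_rpow_neg_le {b : ℝ} (hb0 : 0 < b) (hb1 : b < 1) (N : ℕ) :
    ∑ m ∈ Finset.range N, ((m : ℝ) + 1) ^ (-b) ≤ (N : ℝ) ^ (1 - b) / (1 - b) := by
  induction N with
  | zero => simp [Real.zero_rpow (by linarith : 1 - b ≠ 0)]
  | succ N ih =>
    rw [Finset.sum_range_succ]
    have hN : (0 : ℝ) < (N : ℝ) + 1 := by positivity
    have h := rpow_one_add_le_one_add_mul_self (s := -(1 / ((N : ℝ) + 1)))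
      (by rw [neg_le_neg_iff, div_le_one hN]; linarith [(Nat.cast_nonneg N : (0 : ℝ) ≤ N)])
      (p := 1 - b) (by linarith) (by linarith)
    have e : (1 : ℝ) + -(1 / ((N : ℝ) + 1)) = N / (N + 1) := by field_simp; ring
    rw [e, Real.div_rpow (by positivity) hN.le, div_le_iff₀ (by positivity)] at h
    have e2 : ((N : ℝ) + 1) ^ (-b) = ((N : ℝ) + 1) ^ (1 - b) / (N + 1) := by
      rw [show -b = (1 - b) - 1 by ring, Real.rpow_sub_one hN.ne']
    have h3 : (1 - b) * ((N : ℝ) + 1) ^ (-b) ≤ ((N : ℝ) + 1) ^ (1 - b) - (N : ℝ) ^ (1 - b) := by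
      rw [e2]
      have : (1 + (1 - b) * -(1 / ((N : ℝ) + 1))) * ((N : ℝ) + 1) ^ (1 - b)
        = ((N : ℝ) + 1) ^ (1 - b) - (1 - b) * (((N : ℝ) + 1) ^ (1 - b) / (N + 1)) := by
        field_simp; ring
      linarith
    push_cast
    have h4 : ((N : ℝ) + 1) ^ (-b)
        ≤ (((N : ℝ) + 1) ^ (1 - b) - (N : ℝ) ^ (1 - b)) / (1 - b) := by
      rw [le_div_iff₀ (by linarith)]; linarith
    have : (((N : ℝ) + 1) ^ (1 - b) - (N : ℝ) ^ (1 - b)) / (1 - b)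
        = ((N : ℝ) + 1) ^ (1 - b) / (1 - b) - (N : ℝ) ^ (1 - b) / (1 - b) := by ring
    linarith

theorem sum_intBracket_rpow_neg_le {b : ℝ} (hb0 : 0 < b) (hb1 : b < 1) {N : ℕ} (hN : 1 ≤ N) :
    ∑ m ∈ Finset.Icc (-N : ℤ) N, intBracket m ^ (-b) ≤ (1 + 2 / (1 - b)) * (N : ℝ) ^ (1 - b) := by
  rw [Finset.sum_Icc_of_even_eq_range (f := fun m => intBracket m ^ (-b))
    (fun m => by simp [intBracket]), Finset.sum_range_succ']
  have h := sum_range_rpow_neg_le hb0 hb1 N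
  have e : ∑ k ∈ Finset.range N, intBracket ((k + 1 : ℕ) : ℤ) ^ (-b)
      = ∑ m ∈ Finset.range N, ((m : ℝ) + 1) ^ (-b) := by
    refine Finset.sum_congr rfl fun k _ => ?_
    congr 1
    rw [intBracket]
    push_cast
    rw [abs_of_nonneg (by positivity)]
    exact max_eq_right (by linarith [(Nat.cast_nonneg k : (0 : ℝ) ≤ k)])
  have e0 : intBracket ((0 : ℕ) : ℤ) ^ (-b) = 1 := by simp [intBracket]
  have e0' : intBracket (0 : ℤ) ^ (-b) = 1 := by simp [intBracket]
  rw [e, e0, e0']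
  have h1 : (1 : ℝ) ≤ (N : ℝ) ^ (1 - b) :=
    Real.one_le_rpow (by exact_mod_cast hN) (by linarith)
  have : (1 + 2 / (1 - b)) * (N : ℝ) ^ (1 - b)
      = (N : ℝ) ^ (1 - b) + 2 * ((N : ℝ) ^ (1 - b) / (1 - b)) := by ring
  rw [this, two_nsmul]
  linarith

/-- The low frequency sum `∑_{⟨n⟩ ≤ K} ⟨n⟩^{-2b}` is of order `K^{2(1-b)}` for `0 < b < 1`. -/
theorem freq_sum_le {b : ℝ} (hb0 : 0 < b) (hb1 : b < 1) :
    ∃ C : ℝ, 0 < C ∧ ∀ K : ℝ, 0 < K → ∀ S : Finset Freq, (∀ n ∈ S, bracket n ≤ K) →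
      ∑ n ∈ S, bracket n ^ (-(2 * b)) ≤ C * K ^ (2 * (1 - b)) := by
  have h1b : 0 < 1 - b := by linarith
  refine ⟨(1 + 2 / (1 - b)) ^ 2, by positivity, fun K hK S hS => ?_⟩
  rcases S.eq_empty_or_nonempty with rfl | ⟨n₀, hn₀⟩
  · simp only [Finset.sum_empty]; positivity
  have hK1 : 1 ≤ K := (one_le_bracket n₀).trans (hS n₀ hn₀)
  set N := ⌊K⌋₊ with hN
  have hN1 : 1 ≤ N := Nat.le_floor (by exact_mod_cast hK1)
  have hsub : S ⊆ Fintype.piFinset fun _ : Fin 2 => Finset.Icc (-N : ℤ) N := by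
    intro n hn
    rw [Fintype.mem_piFinset]
    intro i
    have h1 : |(n i : ℝ)| ≤ K :=
      ((abs_apply_le_freqNorm n i).trans (freqNorm_le_bracket n)).trans (hS n hn)
    have h2 : (n i).natAbs ≤ N := Nat.le_floor (by rw [Nat.cast_natAbs]; exact_mod_cast h1)
    rw [Finset.mem_Icc]; omega
  calc ∑ n ∈ S, bracket n ^ (-(2 * b))
      ≤ ∑ n ∈ S, ∏ i, intBracket (n i) ^ (-b) :=
        Finset.sum_le_sum fun n _ => prod_intBracket_rpow_ge n hb0.le
    _ ≤ ∑ n ∈ Fintype.piFinset fun _ : Fin 2 => Finset.Icc (-N : ℤ) N,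
          ∏ i, intBracket (n i) ^ (-b) :=
        Finset.sum_le_sum_of_subset_of_nonneg hsub fun n _ _ =>
          Finset.prod_nonneg fun i _ => (Real.rpow_pos_of_pos (intBracket_pos _) _).le
    _ = ∏ _i : Fin 2, ∑ m ∈ Finset.Icc (-N : ℤ) N, intBracket m ^ (-b) :=
        (Finset.prod_univ_sum (fun _ : Fin 2 => Finset.Icc (-N : ℤ) N)
          (fun _ m => intBracket m ^ (-b))).symm
    _ = (∑ m ∈ Finset.Icc (-N : ℤ) N, intBracket m ^ (-b)) ^ 2 := by simp
    _ ≤ ((1 + 2 / (1 - b)) * (N : ℝ) ^ (1 - b)) ^ 2 := by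
        refine pow_le_pow_left₀ (Finset.sum_nonneg fun m _ =>
          (Real.rpow_pos_of_pos (intBracket_pos _) _).le) (sum_intBracket_rpow_neg_le hb0 hb1 hN1) 2
    _ ≤ ((1 + 2 / (1 - b)) * K ^ (1 - b)) ^ 2 := by
        have : (N : ℝ) ≤ K := Nat.floor_le hK.le
        gcongr
    _ = (1 + 2 / (1 - b)) ^ 2 * K ^ (2 * (1 - b)) := by
        rw [mul_pow, mul_comm 2 (1 - b), Real.rpow_mul hK.le]; norm_num

theorem finite_bracket_le (K : ℝ) : {n : Freq | bracket n ≤ K}.Finite := by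
  refine (Finset.finite_toSet (Fintype.piFinset fun _ : Fin 2 =>
    Finset.Icc (-(⌊K⌋₊ : ℤ)) ⌊K⌋₊)).subset fun n hn => ?_
  rw [Finset.mem_coe, Fintype.mem_piFinset]
  intro i
  have h1 : |(n i : ℝ)| ≤ K := ((abs_apply_le_freqNorm n i).trans (freqNorm_le_bracket n)).trans hn
  have h2 : (n i).natAbs ≤ ⌊K⌋₊ := Nat.le_floor (by rw [Nat.cast_natAbs]; exact_mod_cast h1)
  rw [Finset.mem_Icc]; omega

theorem summable_intBracket {c : ℝ} (hc : 1 < c) : Summable fun m : ℤ => intBracket m ^ (-c) := by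
  have h := (Real.summable_nat_rpow (p := -c)).2 (by linarith)
  have h1 : Summable fun k : ℕ => intBracket (k : ℤ) ^ (-c) := by
    refine (summable_nat_add_iff 1).1 (((summable_nat_add_iff 1).2 h).congr fun k => ?_)
    congr 1
    rw [intBracket]
    push_cast
    rw [abs_of_nonneg (by positivity)]
    exact (max_eq_right (by linarith [(Nat.cast_nonneg k : (0 : ℝ) ≤ k)])).symm
  refine Summable.of_nat_of_neg h1 (h1.congr fun k => ?_)
  simp [intBracket]

theorem summable_bracket {c : ℝ} (hc : 1 < c) : Summable fun n : Freq => bracket n ^ (-(2 * c)) := by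
  have h := (summable_intBracket hc).mul_of_nonneg (summable_intBracket hc)
    (fun m => (Real.rpow_pos_of_pos (intBracket_pos m) _).le)
    (fun m => (Real.rpow_pos_of_pos (intBracket_pos m) _).le)
  have h2 : Summable fun n : Freq => ∏ i, intBracket (n i) ^ (-c) := by
    refine ((finTwoArrowEquiv ℤ).summable_iff.2 h).congr fun n => ?_
    simp [Fin.prod_univ_two]
  exact h2.of_nonneg_of_le (fun n => (Real.rpow_pos_of_pos (bracket_pos n) _).le)
    fun n => prod_intBracket_rpow_ge n (by linarith)

/-! ### Trigonometric polynomials -/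

/-- The trigonometric polynomial with Fourier coefficients `a n`, `n ∈ S`. -/
def trigPoly (S : Finset Freq) (a : Dist) : C(Torus, ℂ) :=
  ∑ n ∈ S, a n • UnitAddTorus.mFourier n

theorem trigPoly_apply (S : Finset Freq) (a : Dist) (x : Torus) :
    trigPoly S a x = ∑ n ∈ S, a n * UnitAddTorus.mFourier n x := by
  simp [trigPoly]

theorem norm_trigPoly_le (S : Finset Freq) (a : Dist) (x : Torus) :
    ‖trigPoly S a x‖ ≤ ∑ n ∈ S, ‖a n‖ := by
  rw [trigPoly_apply]
  refine (norm_sum_le _ _).trans (Finset.sum_le_sum fun n _ => ?_)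
  rw [norm_mul, mFourier_norm_apply, mul_one]

theorem coeffs_trigPoly (S : Finset Freq) (a : Dist) (n : Freq) [Decidable (n ∈ S)] :
    coeffs (trigPoly S a) n = if n ∈ S then a n else 0 := by
  classical
  have h1 : coeffs (trigPoly S a) n = (UnitAddTorus.mFourierBasis (d := Fin 2)).repr
      (ContinuousMap.toLp (E := ℂ) 2 torusMeasure ℂ (trigPoly S a)) n := by
    rw [torus_repr]
    exact (UnitAddTorus.mFourierCoeff_toLp (trigPoly S a) n).symm
  have h2 : ContinuousMap.toLp (E := ℂ) 2 torusMeasure ℂ (trigPoly S a)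
      = ∑ m ∈ S, a m • UnitAddTorus.mFourierBasis (d := Fin 2) m := by
    rw [trigPoly, map_sum]
    refine Finset.sum_congr rfl fun m _ => ?_
    rw [map_smul, UnitAddTorus.coe_mFourierBasis]
    rfl
  rw [h1, h2]
  simp only [map_sum, map_smul, HilbertBasis.repr_self]
  simp only [lp.coeFn_sum, lp.coeFn_smul, Finset.sum_apply, Pi.smul_apply, lp.coeFn_single,
    Pi.single_apply, smul_eq_mul, mul_ite, mul_one, mul_zero, Finset.sum_ite_eq]
  split_ifs <;> rfl

/-- The element of `L²` with the Fourier coefficients of a trigonometric polynomial is represented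
by that polynomial. -/
theorem coeFn_toL2_indicator (S : Finset Freq) (a : Dist) :
    (toL2 (coeffs (trigPoly S a)) : Torus → ℂ) =ᵐ[torusMeasure] trigPoly S a := by
  have h1 : coeffs (ContinuousMap.toLp (E := ℂ) 2 torusMeasure ℂ (trigPoly S a))
      = coeffs (trigPoly S a) :=
    funext fun n => UnitAddTorus.mFourierCoeff_toLp (trigPoly S a) n
  rw [← h1, toL2_coeffs]
  exact ContinuousMap.coeFn_toLp _ _

/-! ### The Sobolev embedding and its dual -/

theorem lintegral_Ioo_rpow {L r : ℝ} (hL : 0 ≤ L) (hr : 2 < r) :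
    ∫⁻ t in Ioo 0 L, ENNReal.ofReal (t ^ (r - 3)) = ENNReal.ofReal (L ^ (r - 2) / (r - 2)) := by
  have hi := intervalIntegral.intervalIntegrable_rpow' (a := 0) (b := L) (r := r - 3) (by linarith)
  rw [intervalIntegrable_iff_integrableOn_Ioo_of_le hL] at hi
  rw [← ofReal_integral_eq_lintegral_ofReal hi, ← integral_Ioc_eq_integral_Ioo,
    ← intervalIntegral.integral_of_le hL, integral_rpow (Or.inl (by linarith))]
  · rw [Real.zero_rpow (by linarith)]
    congr 1
    rw [sub_zero, show r - 3 + 1 = r - 2 by ring]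
  · filter_upwards [ae_restrict_mem measurableSet_Ioo] with t ht
    exact Real.rpow_nonneg ht.1.le _

/-- The Cauchy–Schwarz bound for the `ℓ¹` norm of the frequencies in `S` by the `H^b` norm. -/
theorem sum_enorm_le_of_bracket_le {b : ℝ} {A C K : ℝ} (hA : 0 ≤ A) (hC : 0 ≤ C)
    (hK : 0 < K) {a : Dist} (ha : eH b a = ENNReal.ofReal A) {S : Finset Freq}
    (hS : ∑ n ∈ S, bracket n ^ (-(2 * b)) ≤ C ^ 2 * K ^ (2 * (1 - b))) :
    ∑ n ∈ S, ‖a n‖ ≤ C * K ^ (1 - b) * A := by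
  have h1 : ∑ n ∈ S, (bracket n ^ b * ‖a n‖) ^ 2 ≤ A ^ 2 := by
    have h2 : ∑ n ∈ S, (ENNReal.ofReal (bracket n ^ b) * ‖a n‖ₑ) ^ (2 : ℝ)
        ≤ ENNReal.ofReal (A ^ 2) := by
      have h3 := (ENNReal.sum_le_tsum (f := fun n =>
        (ENNReal.ofReal (bracket n ^ b) * ‖a n‖ₑ) ^ (2 : ℝ)) S).trans_eq (eH_sq b a).symm
      rw [ha, ENNReal.ofReal_rpow_of_nonneg hA (by norm_num)] at h3
      simpa using h3
    have hnn : ∀ n, 0 ≤ bracket n ^ (2 * b) * ‖a n‖ ^ 2 := fun n => by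
      have := bracket_pos n; positivity
    simp only [weight_sq] at h2
    rw [← ENNReal.ofReal_sum_of_nonneg (fun n _ => hnn n),
      ENNReal.ofReal_le_ofReal_iff (by positivity)] at h2
    refine le_trans (le_of_eq (Finset.sum_congr rfl fun n _ => ?_)) h2
    rw [mul_pow, mul_comm 2 b, Real.rpow_mul (bracket_pos n).le]
    norm_num
  have h4 : (∑ n ∈ S, ‖a n‖) ^ 2 ≤ (C * K ^ (1 - b) * A) ^ 2 := by
    calc (∑ n ∈ S, ‖a n‖) ^ 2
        = (∑ n ∈ S, bracket n ^ (-b) * (bracket n ^ b * ‖a n‖)) ^ 2 := by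
          congr 1
          refine Finset.sum_congr rfl fun n _ => ?_
          rw [← mul_assoc, ← Real.rpow_add (bracket_pos n)]; simp
      _ ≤ (∑ n ∈ S, (bracket n ^ (-b)) ^ 2) * ∑ n ∈ S, (bracket n ^ b * ‖a n‖) ^ 2 :=
          Finset.sum_mul_sq_le_sq_mul_sq _ _ _
      _ ≤ (C ^ 2 * K ^ (2 * (1 - b))) * A ^ 2 := by
          refine mul_le_mul ?_ h1 (Finset.sum_nonneg fun _ _ => sq_nonneg _) (by positivity)
          refine le_trans (le_of_eq (Finset.sum_congr rfl fun n _ => ?_)) hS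
          rw [show -(2 * b) = -b * 2 by ring, Real.rpow_mul (bracket_pos n).le]; norm_num
      _ = (C * K ^ (1 - b) * A) ^ 2 := by
          rw [mul_pow, mul_pow, mul_comm 2 (1 - b), Real.rpow_mul hK.le]; norm_num
  exact (pow_le_pow_iff_left₀ (Finset.sum_nonneg fun _ _ => norm_nonneg _) (by positivity)
    (by norm_num)).1 h4

/-- Chebyshev's inequality after removing the frequencies in `S`, whose total contribution is
at most half of the level. -/
theorem measure_level_le (f : L2) {S : Finset Freq} {t : ℝ} (ht : 0 < t)
    (hS : ∑ n ∈ S, ‖coeffs f n‖ ≤ t / 2) :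
    torusMeasure {x | t < ‖f x‖} ≤ ENNReal.ofReal (4 * t ^ (-2 : ℝ)) *
      ∑' n, (if n ∈ S then 0 else ‖coeffs f n‖ₑ ^ (2 : ℝ)) := by
  classical
  set a := coeffs f
  set g : L2 := toL2 (coeffs (trigPoly S a))
  have hg : (g : Torus → ℂ) =ᵐ[torusMeasure] trigPoly S a := coeFn_toL2_indicator S a
  have hfin : eH 0 (coeffs (trigPoly S a)) < ∞ := by
    have : eH 0 (coeffs (trigPoly S a)) ≤ eH 0 a := eH_mono le_rfl fun n => by
      rw [coeffs_trigPoly]; split_ifs <;> simp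
    refine this.trans_lt ?_
    rw [eH_zero_coeffs]; exact enorm_lt_top
  have hco : coeffs (f - g : L2) = fun n => if n ∈ S then 0 else a n := by
    rw [coeffs_sub, coeffs_toL2 hfin]
    funext n
    rw [Pi.sub_apply, coeffs_trigPoly]
    split_ifs <;> simp [a]
  have hsub : torusMeasure {x | t < ‖f x‖}
      ≤ torusMeasure {x | ENNReal.ofReal (t / 2) ≤ ‖(f - g : L2) x‖ₑ} := by
    refine measure_mono_ae ?_
    filter_upwards [hg, Lp.coeFn_sub f g] with x hx hx2 hlt
    have h1 : ‖g x‖ ≤ t / 2 := by rw [hx]; exact (norm_trigPoly_le S a x).trans hS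
    have h0 : t < ‖f x‖ := hlt
    show ENNReal.ofReal (t / 2) ≤ ‖(f - g : L2) x‖ₑ
    rw [hx2, ← ofReal_norm]
    refine ENNReal.ofReal_le_ofReal ?_
    have := norm_sub_norm_le (f x) (g x)
    simp only [Pi.sub_apply]
    linarith
  have hch := mul_meas_ge_le_pow_eLpNorm' torusMeasure (p := 2) (by norm_num) (by norm_num)
    (Lp.aestronglyMeasurable (f - g : L2)) (ENNReal.ofReal (t / 2))
  rw [eLpNorm_two_eq, hco] at hch
  simp only [ENNReal.toReal_ofNat] at hch
  rw [eH_sq, ENNReal.ofReal_rpow_of_nonneg (by positivity) (by norm_num)] at hch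
  have e : ∑' n, (ENNReal.ofReal (bracket n ^ (0 : ℝ)) * ‖if n ∈ S then 0 else a n‖ₑ) ^ (2 : ℝ)
      = ∑' n, (if n ∈ S then 0 else ‖a n‖ₑ ^ (2 : ℝ)) := by
    refine tsum_congr fun n => ?_
    split_ifs <;> simp
  rw [e] at hch
  refine hsub.trans ?_
  have h3 : ENNReal.ofReal (4 * t ^ (-2 : ℝ)) * ENNReal.ofReal ((t / 2) ^ (2 : ℝ)) = 1 := by
    rw [← ENNReal.ofReal_mul (by positivity), Real.div_rpow ht.le (by norm_num)]
    have : 4 * t ^ (-2 : ℝ) * (t ^ (2 : ℝ) / 2 ^ (2 : ℝ)) = 1 := by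
      rw [Real.rpow_neg ht.le]
      have : t ^ (2 : ℝ) ≠ 0 := (Real.rpow_pos_of_pos ht _).ne'
      field_simp; norm_num
    rw [this, ENNReal.ofReal_one]
  calc _ = ENNReal.ofReal (4 * t ^ (-2 : ℝ)) * (ENNReal.ofReal ((t / 2) ^ (2 : ℝ)) *
        torusMeasure {x | ENNReal.ofReal (t / 2) ≤ ‖(f - g : L2) x‖ₑ}) := by
        rw [← mul_assoc, h3, one_mul]
    _ ≤ _ := mul_le_mul_right hch _

/-- The sharp Sobolev embedding `H^{1-2/r} ⊂ L^r` on the two-dimensional torus, `2 < r < ∞`.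
The level sets of `f` are estimated by splitting `f` into low and high frequencies at a threshold
depending on the level. -/
theorem sobolev_embedding_of_two_lt {r : ℝ} (hr : 2 < r) : ∃ C : NNReal, ∀ f : L2,
    eLpNorm f (ENNReal.ofReal r) torusMeasure ≤ C * eH (1 - 2 / r) (coeffs f) := by
  classical
  have hr0 : 0 < r := by linarith
  set b := 1 - 2 / r with hbdef
  have hb0 : 0 < b := by rw [hbdef, sub_pos, div_lt_one hr0]; exact hr
  have hb1 : b < 1 := by rw [hbdef]; linarith [div_pos two_pos hr0]
  obtain ⟨C₀, hC₀, hsum⟩ := freq_sum_le hb0 hb1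
  set C₁ := Real.sqrt C₀
  have hC₁ : 0 < C₁ := Real.sqrt_pos.2 hC₀
  have hC₁2 : C₁ ^ 2 = C₀ := Real.sq_sqrt hC₀.le
  set M : ℝ := r * (4 / (r - 2)) * (2 * C₁) ^ (r - 2)
  have hM : 0 < M := by have : 0 < r - 2 := by linarith
                        positivity
  refine ⟨(M ^ (1 / r)).toNNReal, fun f => ?_⟩
  change _ ≤ ENNReal.ofReal (M ^ (1 / r)) * _
  have hMr : 0 < M ^ (1 / r) := Real.rpow_pos_of_pos hM _
  set a := coeffs f
  by_cases htop : eH b a = ∞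
  · rw [htop, ENNReal.mul_top (by simpa using hMr)]; exact le_top
  obtain ⟨A, hAnn, hA⟩ : ∃ A : ℝ, 0 ≤ A ∧ eH b a = ENNReal.ofReal A :=
    ⟨(eH b a).toReal, ENNReal.toReal_nonneg, (ENNReal.ofReal_toReal htop).symm⟩
  rcases hAnn.eq_or_lt with hA0 | hA0
  · have h0 : eH b a = 0 := by rw [hA, ← hA0, ENNReal.ofReal_zero]
    have h1 : f = 0 := by
      have := eH_mono_exp hb0.le a
      rw [h0, nonpos_iff_eq_zero, eH_zero_coeffs, enorm_eq_zero] at this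
      exact this
    have h2 : eLpNorm f (ENNReal.ofReal r) torusMeasure = 0 := by
      rw [h1, eLpNorm_congr_ae (Lp.coeFn_zero ℂ 2 torusMeasure), eLpNorm_zero]
    rw [h2]; exact zero_le
  -- the frequency `n` counts as high for the levels `t < L n`
  set L : Freq → ℝ := fun n => 2 * C₁ * A * bracket n ^ (1 - b) with hL
  have hLpos : ∀ n, 0 < L n := fun n => by have := bracket_pos n; positivity
  have hlevel : ∀ t : ℝ, 0 < t → torusMeasure {x | t < ‖f x‖} * ENNReal.ofReal (t ^ (r - 1))
      ≤ ∑' n, 4 * ‖a n‖ₑ ^ (2 : ℝ) *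
        (Ioo 0 (L n)).indicator (fun t => ENNReal.ofReal (t ^ (r - 3))) t := by
    intro t ht
    -- the threshold at which the low frequencies are bounded by half of the level
    set K := (t / (2 * C₁ * A)) ^ (1 / (1 - b)) with hK
    have h1b : 0 < 1 - b := by linarith
    have hKpos : 0 < K := by positivity
    have hKb : K ^ (1 - b) = t / (2 * C₁ * A) := by
      rw [hK, ← Real.rpow_mul (by positivity), one_div_mul_cancel h1b.ne', Real.rpow_one]
    set S := (finite_bracket_le K).toFinset
    have hSm : ∀ n, n ∈ S ↔ bracket n ≤ K := fun n => by simp [S]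
    have hlow : ∑ n ∈ S, ‖a n‖ ≤ t / 2 := by
      refine (sum_enorm_le_of_bracket_le hA0.le hC₁.le hKpos hA (K := K) (by
        rw [hC₁2]; exact hsum K hKpos S fun n hn => (hSm n).1 hn)).trans (le_of_eq ?_)
      rw [hKb]; field_simp
    refine (mul_le_mul_left (measure_level_le f ht hlow) _).trans ?_
    rw [mul_right_comm, ← ENNReal.tsum_mul_left]
    refine ENNReal.tsum_le_tsum fun n => ?_
    split_ifs with hn
    · rw [mul_zero]; exact zero_le
    · have hnt : t ∈ Ioo 0 (L n) := by
        refine ⟨ht, ?_⟩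
        rw [hSm, not_le] at hn
        have := Real.rpow_lt_rpow hKpos.le hn h1b
        rw [hKb, div_lt_iff₀ (by positivity)] at this
        rw [hL]; linarith
      rw [indicator_of_mem hnt, ← ENNReal.ofReal_mul (by positivity),
        show 4 * t ^ (-2 : ℝ) * t ^ (r - 1) = 4 * t ^ (r - 3) by
          rw [mul_assoc, ← Real.rpow_add ht]; congr 2; ring,
        ENNReal.ofReal_mul (by norm_num)]
      norm_num
      exact le_of_eq (by ring)
  -- the layer cake formula, integrated level by level
  have hlc := lintegral_rpow_eq_lintegral_meas_lt_mul torusMeasure (f := fun x => ‖f x‖)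
    (Eventually.of_forall fun x => norm_nonneg _) (Lp.aestronglyMeasurable f).norm.aemeasurable hr0
  have hmain : ∫⁻ x, ENNReal.ofReal (‖f x‖ ^ r) ∂torusMeasure
      ≤ ENNReal.ofReal (M * A ^ r) := by
    rw [hlc]
    calc _ ≤ ENNReal.ofReal r * ∫⁻ t in Ioi 0, ∑' n, 4 * ‖a n‖ₑ ^ (2 : ℝ) *
          (Ioo 0 (L n)).indicator (fun t => ENNReal.ofReal (t ^ (r - 3))) t :=
          mul_le_mul_right (setLIntegral_mono' measurableSet_Ioi fun t ht => hlevel t ht) _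
      _ = ENNReal.ofReal r * ∑' n, 4 * ‖a n‖ₑ ^ (2 : ℝ) *
            ENNReal.ofReal (L n ^ (r - 2) / (r - 2)) := by
          have hmeas : ∀ n, Measurable
              ((Ioo 0 (L n)).indicator (fun t : ℝ => ENNReal.ofReal (t ^ (r - 3)))) := fun n =>
            (by fun_prop : Measurable fun t : ℝ => ENNReal.ofReal (t ^ (r - 3))).indicator
              measurableSet_Ioo
          rw [lintegral_tsum fun n => ((hmeas n).const_mul _).aemeasurable]
          congr 1
          refine tsum_congr fun n => ?_
          rw [lintegral_const_mul _ (hmeas n), lintegral_indicator measurableSet_Ioo,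
            Measure.restrict_restrict measurableSet_Ioo,
            inter_eq_left.2 (show Ioo 0 (L n) ⊆ Ioi 0 from fun t ht => ht.1),
            lintegral_Ioo_rpow (hLpos n).le hr]
      _ = ENNReal.ofReal r * ∑' n, ENNReal.ofReal (4 / (r - 2) * (2 * C₁) ^ (r - 2) * A ^ (r - 2))
            * (ENNReal.ofReal (bracket n ^ b) * ‖a n‖ₑ) ^ (2 : ℝ) := by
          congr 1
          refine tsum_congr fun n => ?_
          have hbn := bracket_pos n
          have h2r : 0 < r - 2 := by linarith
          have e1 : L n ^ (r - 2) / (r - 2)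
              = ((2 * C₁) ^ (r - 2) * A ^ (r - 2) / (r - 2)) * bracket n ^ (2 * b) := by
            rw [hL]
            simp only
            rw [Real.mul_rpow (by positivity) (by positivity),
              Real.mul_rpow (by positivity) (by positivity), ← Real.rpow_mul hbn.le]
            have : (1 - b) * (r - 2) = 2 * b := by rw [hbdef]; field_simp; ring
            rw [this]; ring
          rw [e1, ENNReal.mul_rpow_of_nonneg _ _ (by norm_num),
            ENNReal.ofReal_rpow_of_nonneg (by positivity) (by norm_num), ← Real.rpow_mul hbn.le,
            mul_comm b 2, ENNReal.ofReal_mul (by positivity),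
            show 4 / (r - 2) * (2 * C₁) ^ (r - 2) * A ^ (r - 2)
              = 4 * ((2 * C₁) ^ (r - 2) * A ^ (r - 2) / (r - 2)) by ring,
            ENNReal.ofReal_mul (by norm_num : (0 : ℝ) ≤ 4)]
          norm_num
          ring
      _ = ENNReal.ofReal (M * A ^ r) := by
          rw [ENNReal.tsum_mul_left, ← eH_sq, hA, ENNReal.ofReal_rpow_of_nonneg hA0.le (by norm_num),
            ← ENNReal.ofReal_mul, ← ENNReal.ofReal_mul hr0.le]
          · congr 1
            have : A ^ r = A ^ (r - 2) * A ^ (2 : ℝ) := by rw [← Real.rpow_add hA0]; congr 1; ring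
            rw [this]; ring
          · have h2r : 0 < r - 2 := by linarith
            positivity
  rw [eLpNorm_eq_lintegral_rpow_enorm_toReal (by simpa using hr0) ENNReal.ofReal_ne_top,
    ENNReal.toReal_ofReal hr0.le]
  have e : ∫⁻ x, ‖f x‖ₑ ^ r ∂torusMeasure = ∫⁻ x, ENNReal.ofReal (‖f x‖ ^ r) ∂torusMeasure :=
    lintegral_congr fun x => by
      rw [← ofReal_norm, ENNReal.ofReal_rpow_of_nonneg (norm_nonneg _) hr0.le]
  rw [e]
  calc _ ≤ ENNReal.ofReal (M * A ^ r) ^ (1 / r) := ENNReal.rpow_le_rpow hmain (by positivity)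
    _ = ENNReal.ofReal (M ^ (1 / r)) * eH b a := by
      rw [ENNReal.ofReal_rpow_of_nonneg (by positivity) (by positivity),
        Real.mul_rpow hM.le (by positivity), ← Real.rpow_mul hA0.le, mul_one_div_cancel hr0.ne',
        Real.rpow_one, ENNReal.ofReal_mul (by positivity), hA]

theorem sobolev_embedding {r : ℝ} (hr : 2 ≤ r) : ∃ C : NNReal, ∀ f : L2,
    eLpNorm f (ENNReal.ofReal r) torusMeasure ≤ C * eH (1 - 2 / r) (coeffs f) := by
  rcases hr.eq_or_lt with rfl | hr
  · refine ⟨1, fun f => ?_⟩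
    have := eLpNorm_two_eq f
    norm_num [this]
  · exact sobolev_embedding_of_two_lt hr

/-- The dual Sobolev embedding `L^ρ ⊂ H^{-(2/ρ-1)}`, `1 < ρ ≤ 2`. -/
theorem sobolev_embedding_dual {ρ : ℝ} (hρ1 : 1 < ρ) (hρ2 : ρ ≤ 2) : ∃ C : NNReal,
    ∀ g : Torus → ℂ, MemLp g (ENNReal.ofReal ρ) torusMeasure →
      eH (-(2 / ρ - 1)) (coeffs g) ≤ C * eLpNorm g (ENNReal.ofReal ρ) torusMeasure := by
  classical
  have hρ0 : 0 < ρ := by linarith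
  have hpq : ρ.HolderConjugate ρ.conjExponent := .conjExponent hρ1
  set r := ρ.conjExponent
  have hinv := hpq.inv_add_inv_eq_one
  have hr0 : 0 < r := hpq.symm.pos
  have hr2 : 2 ≤ r := by
    have h1 : (2 : ℝ)⁻¹ ≤ ρ⁻¹ := inv_anti₀ hρ0 hρ2
    have h2 : r⁻¹ ≤ 2⁻¹ := by norm_num at h1 ⊢; linarith
    exact (inv_le_inv₀ hr0 two_pos).1 h2
  set b := 2 / ρ - 1 with hb
  have hbr : 1 - 2 / r = b := by
    rw [hb, div_eq_mul_inv, div_eq_mul_inv]; linarith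
  obtain ⟨C, hC⟩ := sobolev_embedding hr2
  rw [hbr] at hC
  refine ⟨C, fun g hg => ?_⟩
  have hgi : Integrable g torusMeasure :=
    hg.integrable (by rw [← ENNReal.ofReal_one]; exact ENNReal.ofReal_le_ofReal hρ1.le)
  rw [eH_eq_tsum, one_div, ENNReal.rpow_inv_le_iff (by norm_num)]
  refine ENNReal.summable.tsum_le_of_sum_le fun S => ?_
  set w : Freq → ℝ := fun n => bracket n ^ (-(2 * b)) with hw
  have hwpos : ∀ n, 0 < w n := fun n => Real.rpow_pos_of_pos (bracket_pos n) _
  set Q : ℝ := ∑ n ∈ S, w n * ‖coeffs g n‖ ^ 2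
  have hQ0 : 0 ≤ Q := Finset.sum_nonneg fun n _ => mul_nonneg (hwpos n).le (sq_nonneg _)
  have hQ : ∑ n ∈ S, (ENNReal.ofReal (bracket n ^ (-b)) * ‖coeffs g n‖ₑ) ^ (2 : ℝ)
      = ENNReal.ofReal Q := by
    rw [ENNReal.ofReal_sum_of_nonneg fun n _ => mul_nonneg (hwpos n).le (sq_nonneg _)]
    refine Finset.sum_congr rfl fun n _ => ?_
    rw [weight_sq, hw]
    simp only [mul_neg]
  -- the extremal test function of negative order
  set c : Dist := fun n => (w n : ℂ) * coeffs g n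
  set h := trigPoly S c
  -- pairing `g` with `h` gives back the truncated negative order norm of `g`
  have hpair : (Q : ℂ) = ∫ x, g x * star (h x) ∂torusMeasure := by
    have e1 : ∀ x, g x * star (h x) = ∑ n ∈ S, star (c n) * (UnitAddTorus.mFourier (-n) x * g x) := by
      intro x
      rw [show h x = _ from trigPoly_apply S c x, star_sum, Finset.mul_sum]
      refine Finset.sum_congr rfl fun n _ => ?_
      rw [star_mul', UnitAddTorus.mFourier_neg]
      simp only [starRingEnd_apply]
      ring
    simp only [e1]
    rw [integral_finsetSum]
    · rw [show (Q : ℂ) = ∑ n ∈ S, ((w n * ‖coeffs g n‖ ^ 2 : ℝ) : ℂ) by push_cast [Q]; rfl]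
      refine Finset.sum_congr rfl fun n _ => ?_
      rw [integral_const_mul, ← coeffs_eq]
      simp only [c, star_mul', Complex.star_def, Complex.conj_ofReal]
      rw [mul_assoc, Complex.conj_mul']
      push_cast; ring
    · intro n _
      refine Integrable.const_mul ?_ _
      refine hgi.bdd_mul (c := 1) (UnitAddTorus.mFourier (-n)).continuous.aestronglyMeasurable ?_
      exact Eventually.of_forall fun x => (mFourier_norm_apply _ _).le
  have hh : (toL2 (coeffs h) : Torus → ℂ) =ᵐ[torusMeasure] h := coeFn_toL2_indicator S c
  have hhfin : eH 0 (coeffs h) < ∞ := by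
    have h1 : coeffs h = coeffs (ContinuousMap.toLp (E := ℂ) 2 torusMeasure ℂ h) :=
      (funext fun n => UnitAddTorus.mFourierCoeff_toLp h n).symm
    rw [h1, eH_zero_coeffs]; exact enorm_lt_top
  have hhn : eLpNorm h (ENNReal.ofReal r) torusMeasure ≤ C * ENNReal.ofReal Q ^ (1 / 2 : ℝ) := by
    have h1 := hC (toL2 (coeffs h))
    rw [eLpNorm_congr_ae hh, coeffs_toL2 hhfin] at h1
    refine h1.trans (mul_le_mul_right ?_ _)
    rw [eH_eq_tsum, ← hQ]
    refine ENNReal.rpow_le_rpow ?_ (by norm_num)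
    rw [tsum_eq_sum (s := S)]
    · refine Finset.sum_le_sum fun n hn => ENNReal.rpow_le_rpow (le_of_eq ?_) (by norm_num)
      rw [coeffs_trigPoly, if_pos hn, enorm_mul, ← mul_assoc]
      congr 1
      rw [← ofReal_norm, Complex.norm_real, Real.norm_of_nonneg (hwpos n).le,
        ← ENNReal.ofReal_mul (Real.rpow_nonneg (bracket_pos n).le _), hw,
        ← Real.rpow_add (bracket_pos n)]
      congr 2; ring
    · intro n hn
      rw [coeffs_trigPoly, if_neg hn]; simp
  have hle : ENNReal.ofReal Q ≤ eLpNorm g (ENNReal.ofReal ρ) torusMeasure *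
      eLpNorm h (ENNReal.ofReal r) torusMeasure := by
    have h1 : ENNReal.ofReal Q = ‖(Q : ℂ)‖ₑ := by
      rw [← ofReal_norm, Complex.norm_real, Real.norm_of_nonneg hQ0]
    rw [h1, hpair]
    refine (enorm_integral_le_lintegral_enorm _).trans ?_
    have h2 := ENNReal.lintegral_mul_le_Lp_mul_Lq torusMeasure hpq
      hg.aestronglyMeasurable.enorm h.continuous.enorm.measurable.aemeasurable
    rw [eLpNorm_eq_lintegral_rpow_enorm_toReal (by simpa using hρ0) ENNReal.ofReal_ne_top,
      eLpNorm_eq_lintegral_rpow_enorm_toReal (by simpa using hr0) ENNReal.ofReal_ne_top,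
      ENNReal.toReal_ofReal hρ0.le, ENNReal.toReal_ofReal hr0.le]
    refine le_trans (lintegral_mono fun x => ?_) h2
    rw [enorm_mul, ← ofReal_norm (star (h x)), norm_star, ofReal_norm]
    exact le_rfl
  rw [hQ]
  set G := eLpNorm g (ENNReal.ofReal ρ) torusMeasure
  have h3 : ENNReal.ofReal Q ≤ (C * G) * ENNReal.ofReal Q ^ (1 / 2 : ℝ) :=
    hle.trans ((mul_le_mul_right hhn _).trans (le_of_eq (by ring)))
  by_cases hQz : ENNReal.ofReal Q = 0
  · rw [hQz]; exact zero_le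
  -- divide by the square root of `Q`
  have hsq : ENNReal.ofReal Q = ENNReal.ofReal Q ^ (1 / 2 : ℝ) * ENNReal.ofReal Q ^ (1 / 2 : ℝ) := by
    rw [← ENNReal.rpow_add _ _ hQz ENNReal.ofReal_ne_top]; norm_num
  have hne0 : ENNReal.ofReal Q ^ (1 / 2 : ℝ) ≠ 0 := by
    intro h0; rw [h0] at hsq; simp only [mul_zero] at hsq; exact hQz hsq
  have hnet : ENNReal.ofReal Q ^ (1 / 2 : ℝ) ≠ ∞ :=
    ENNReal.rpow_ne_top_of_nonneg (by norm_num) ENNReal.ofReal_ne_top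
  have h4 : ENNReal.ofReal Q ^ (1 / 2 : ℝ) ≤ C * G :=
    (ENNReal.mul_le_mul_iff_left hne0 hnet).1 (hsq.symm.le.trans h3)
  calc ENNReal.ofReal Q = (ENNReal.ofReal Q ^ (1 / 2 : ℝ)) ^ (2 : ℝ) := by
        rw [← ENNReal.rpow_mul]; norm_num
    _ ≤ (C * G) ^ (2 : ℝ) := ENNReal.rpow_le_rpow h4 (by norm_num)

/-! ### Symbols of the propagators -/

/-- The symbol of `∂ₜ S(t)`. -/
def symbolD (t : ℝ) (n : Freq) : ℝ :=
  Real.exp (-(freqNorm n / 2) * t) *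
    (Real.cos (t * dispersion n) - freqNorm n / (2 * dispersion n) * Real.sin (t * dispersion n))

theorem dispersion_sq (n : Freq) : dispersion n ^ 2 = 1 + 3 / 4 * freqNorm n ^ 2 :=
  Real.sq_sqrt (by positivity)

theorem bracket_le_two_mul_dispersion (n : Freq) : bracket n ≤ 2 * dispersion n := by
  refine abs_le_of_sq_le_sq' ?_ (by have : 0 ≤ dispersion n := Real.sqrt_nonneg _
                                    positivity) |>.2
  have := bracket_sq n
  have := dispersion_sq n
  nlinarith [sq_nonneg (freqNorm n)]

theorem dispersion_pos (n : Freq) : 0 < dispersion n := by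
  have := bracket_le_two_mul_dispersion n
  have := bracket_pos n
  linarith

theorem hasDerivAt_symbolS (t : ℝ) (n : Freq) :
    HasDerivAt (fun x => symbolS x n) (symbolD t n) t := by
  have hd := (dispersion_pos n).ne'
  have h1 : HasDerivAt (fun x => Real.exp (-(freqNorm n / 2) * x))
      (Real.exp (-(freqNorm n / 2) * t) * -(freqNorm n / 2)) t := by
    simpa using ((hasDerivAt_id t).const_mul (-(freqNorm n / 2))).exp
  have h2 : HasDerivAt (fun x => Real.sin (x * dispersion n) / dispersion n)
      (Real.cos (t * dispersion n) * dispersion n / dispersion n) t := by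
    simpa using (((hasDerivAt_id t).mul_const (dispersion n)).sin.div_const (dispersion n))
  refine (h1.mul h2).congr_deriv ?_
  rw [symbolD]
  field_simp
  ring

theorem hasDerivAt_symbolC (t : ℝ) (n : Freq) :
    HasDerivAt (fun x => symbolC x n) (-(bracket n ^ 2 * symbolS t n)) t := by
  have hd := (dispersion_pos n).ne'
  have h1 : HasDerivAt (fun x => Real.exp (-(freqNorm n / 2) * x))
      (Real.exp (-(freqNorm n / 2) * t) * -(freqNorm n / 2)) t := by
    simpa using ((hasDerivAt_id t).const_mul (-(freqNorm n / 2))).exp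
  have h2 : HasDerivAt (fun x => Real.cos (x * dispersion n) +
      freqNorm n / (2 * dispersion n) * Real.sin (x * dispersion n))
      (-Real.sin (t * dispersion n) * dispersion n +
        freqNorm n / (2 * dispersion n) * (Real.cos (t * dispersion n) * dispersion n)) t := by
    have h3 := (hasDerivAt_id t).mul_const (dispersion n)
    simpa using h3.cos.fun_add (h3.sin.const_mul (freqNorm n / (2 * dispersion n)))
  refine (h1.mul h2).congr_deriv ?_
  have e := dispersion_sq n
  have e2 : bracket n ^ 2 = freqNorm n ^ 2 / 4 + dispersion n ^ 2 := by
    rw [bracket_sq, e]; ring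
  rw [e2, symbolS]
  field_simp
  ring

/-- The decay `e^{-⟨n⟩x/2}`, which the propagators share for times at most one. -/
def decay (n : Freq) (x : ℝ) : ℝ := Real.exp (-(bracket n / 2) * x)

theorem decay_pos (n : Freq) (x : ℝ) : 0 < decay n x := Real.exp_pos _

theorem decay_le_one (n : Freq) {x : ℝ} (hx : 0 ≤ x) : decay n x ≤ 1 := by
  rw [decay, Real.exp_le_one_iff]
  have := bracket_pos n
  nlinarith

/-- For times in `[0,1]` the factor `e^{-|n|x/2}` is comparable to `e^{-⟨n⟩x/2}`, since
`⟨n⟩ ≤ 1 + |n|`. -/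
theorem exp_le_two_mul_decay (n : Freq) {x : ℝ} (hx : 0 ≤ x) (hx1 : x ≤ 1) :
    Real.exp (-(freqNorm n / 2) * x) ≤ 2 * decay n x := by
  have h1 : Real.exp (-(freqNorm n / 2) * x) ≤ Real.exp (1 / 2 + -(bracket n / 2) * x) := by
    rw [Real.exp_le_exp]
    have := bracket_le n
    nlinarith
  have h2 : Real.exp (1 / 2 : ℝ) ≤ 2 := by
    have h3 : Real.exp (1 / 2 : ℝ) ^ 2 = Real.exp 1 := by rw [← Real.exp_nat_mul]; norm_num
    have h4 := Real.exp_one_lt_d9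
    nlinarith [Real.exp_pos (1 / 2 : ℝ)]
  rw [Real.exp_add] at h1
  refine h1.trans ?_
  rw [decay]
  gcongr

theorem freqNorm_div_le_one (n : Freq) : freqNorm n / (2 * dispersion n) ≤ 1 := by
  have := dispersion_pos n
  rw [div_le_one (by positivity)]
  exact (freqNorm_le_bracket n).trans (bracket_le_two_mul_dispersion n)

theorem abs_ratio_mul_sin_le (n : Freq) (y : ℝ) :
    |freqNorm n / (2 * dispersion n) * Real.sin y| ≤ 1 := by
  have h0 : 0 ≤ freqNorm n / (2 * dispersion n) :=
    div_nonneg (freqNorm_nonneg n) (by have := dispersion_pos n; positivity)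
  rw [abs_mul, abs_of_nonneg h0]
  exact mul_le_one₀ (freqNorm_div_le_one n) (abs_nonneg _) (Real.abs_sin_le_one _)

theorem abs_symbolD_le_exp (x : ℝ) (n : Freq) :
    |symbolD x n| ≤ 2 * Real.exp (-(freqNorm n / 2) * x) := by
  rw [symbolD, abs_mul, abs_of_pos (Real.exp_pos _), mul_comm]
  gcongr
  have h1 := Real.abs_cos_le_one (x * dispersion n)
  have h2 := abs_ratio_mul_sin_le n (x * dispersion n)
  exact (abs_sub _ _).trans (by linarith)

theorem abs_symbolD_le (n : Freq) {x : ℝ} (hx : 0 ≤ x) (hx1 : x ≤ 1) :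
    |symbolD x n| ≤ 4 * decay n x :=
  (abs_symbolD_le_exp x n).trans (by linarith [exp_le_two_mul_decay n hx hx1])

theorem abs_symbolC_le (n : Freq) {x : ℝ} (hx : 0 ≤ x) (hx1 : x ≤ 1) :
    |symbolC x n| ≤ 4 * decay n x := by
  rw [symbolC, abs_mul, abs_of_pos (Real.exp_pos _)]
  have h1 := Real.abs_cos_le_one (x * dispersion n)
  have h2 := abs_ratio_mul_sin_le n (x * dispersion n)
  have h3 := exp_le_two_mul_decay n hx hx1
  calc _ ≤ (2 * decay n x) * 2 := by
        refine mul_le_mul h3 ((abs_add_le _ _).trans (by linarith)) (abs_nonneg _) ?_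
        have := decay_pos n x; positivity
    _ = _ := by ring

theorem abs_symbolS_le (n : Freq) {x : ℝ} (hx : 0 ≤ x) (hx1 : x ≤ 1) :
    |symbolS x n| ≤ 4 * bracket n ^ (-1 : ℝ) * decay n x := by
  rw [symbolS, abs_mul, abs_of_pos (Real.exp_pos _), abs_div, abs_of_pos (dispersion_pos n)]
  have h3 := exp_le_two_mul_decay n hx hx1
  have hb := bracket_pos n
  have h4 : |Real.sin (x * dispersion n)| / dispersion n ≤ 2 * bracket n ^ (-1 : ℝ) := by
    rw [Real.rpow_neg_one, div_le_iff₀ (dispersion_pos n)]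
    have h5 : 1 ≤ 2 * (bracket n)⁻¹ * dispersion n := by
      rw [mul_right_comm, ← div_eq_mul_inv, le_div_iff₀ hb]
      linarith [bracket_le_two_mul_dispersion n]
    exact (Real.abs_sin_le_one _).trans h5
  calc _ ≤ (2 * decay n x) * (2 * bracket n ^ (-1 : ℝ)) := by
        refine mul_le_mul h3 h4 (by have := dispersion_pos n; positivity) ?_
        have := decay_pos n x; positivity
    _ = _ := by ring

theorem symbolS_zero (n : Freq) : symbolS 0 n = 0 := by simp [symbolS]

/-! ### Causal kernels -/

/-- The kernel of `S`, extended by zero to negative times. -/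
def kerS (n : Freq) (x : ℝ) : ℝ := if 0 ≤ x then symbolS x n else 0

/-- The kernel of `∂ₜS`, extended by zero to negative times. -/
def kerD (n : Freq) (x : ℝ) : ℝ := if 0 ≤ x then symbolD x n else 0

/-- Kernels supported on nonnegative times with the decay of a smoothing operator of order `m`.
A jump at time zero is allowed; it occurs for `∂ₜS`. -/
structure IsCausal (k : Freq → ℝ → ℝ) (m : ℝ) : Prop where
  measurable : ∀ n, Measurable (k n)
  eq_zero : ∀ n x, x < 0 → k n x = 0
  continuousAt : ∀ n x, x ≠ 0 → ContinuousAt (k n) x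
  abs_le : ∀ n x, 0 ≤ x → x ≤ 1 → |k n x| ≤ 4 * bracket n ^ (-m) * decay n x

theorem isCausal_kerS : IsCausal kerS 1 where
  measurable n := by
    have h : Continuous fun x => symbolS x n := by unfold symbolS; fun_prop
    exact Measurable.ite measurableSet_Ici h.measurable measurable_const
  eq_zero n x hx := if_neg hx.not_ge
  continuousAt n x hx := by
    have h : Continuous fun x => symbolS x n := by unfold symbolS; fun_prop
    rcases lt_or_gt_of_ne hx with hx | hx
    · refine (continuousAt_const (y := (0 : ℝ))).congr ?_
      filter_upwards [Iio_mem_nhds hx] with y hy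
      exact (if_neg (not_le.2 hy)).symm
    · refine h.continuousAt.congr ?_
      filter_upwards [Ioi_mem_nhds hx] with y hy
      exact (if_pos (le_of_lt hy)).symm
  abs_le n x hx hx1 := by rw [kerS, if_pos hx]; exact abs_symbolS_le n hx hx1

theorem isCausal_kerD : IsCausal kerD 0 where
  measurable n := by
    have h : Continuous fun x => symbolD x n := by unfold symbolD; fun_prop
    exact Measurable.ite measurableSet_Ici h.measurable measurable_const
  eq_zero n x hx := if_neg hx.not_ge
  continuousAt n x hx := by
    have h : Continuous fun x => symbolD x n := by unfold symbolD; fun_prop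
    rcases lt_or_gt_of_ne hx with hx | hx
    · refine (continuousAt_const (y := (0 : ℝ))).congr ?_
      filter_upwards [Iio_mem_nhds hx] with y hy
      exact (if_neg (not_le.2 hy)).symm
    · refine h.continuousAt.congr ?_
      filter_upwards [Ioi_mem_nhds hx] with y hy
      exact (if_pos (le_of_lt hy)).symm
  abs_le n x hx hx1 := by rw [kerD, if_pos hx]; simpa using abs_symbolD_le n hx hx1

theorem IsCausal.abs_le' {k : Freq → ℝ → ℝ} {m : ℝ} (hk : IsCausal k m) (n : Freq) {x : ℝ}
    (hx1 : x ≤ 1) : |k n x| ≤ 4 * bracket n ^ (-m) := by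
  have hb := Real.rpow_pos_of_pos (bracket_pos n) (-m)
  rcases lt_or_ge x 0 with hx | hx
  · rw [hk.eq_zero n x hx, abs_zero]; positivity
  · refine (hk.abs_le n x hx hx1).trans ?_
    have := decay_le_one n hx
    have h2 : 4 * bracket n ^ (-m) * decay n x ≤ 4 * bracket n ^ (-m) * 1 := by gcongr
    linarith

/-- The convolution on `[0,T]` of the source `F` with the kernel `k`. For causal kernels only the
source before the time `t` matters, so that the domain of integration can be fixed. -/
def causalConv (k : Freq → ℝ → ℝ) (T : ℝ) (F : ℝ → Dist) (t : ℝ) : Dist :=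
  fun n => ∫ τ in Icc 0 T, (k n (t - τ) : ℂ) * F τ n

theorem enorm_causalConv_le (k : Freq → ℝ → ℝ) (T : ℝ) (F : ℝ → Dist) (t : ℝ) (n : Freq) :
    ‖causalConv k T F t n‖ₑ ≤ ∫⁻ τ in Icc 0 T, ‖k n (t - τ)‖ₑ * ‖F τ n‖ₑ := by
  refine (enorm_integral_le_lintegral_enorm _).trans (le_of_eq (lintegral_congr fun τ => ?_))
  rw [enorm_mul, ← ofReal_norm, Complex.norm_real, ofReal_norm]

theorem causalConv_kerS_eq {T t : ℝ} (ht : t ∈ Icc 0 T) (F : ℝ → Dist) (n : Freq) :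
    causalConv kerS T F t n = ∫ τ in (0 : ℝ)..t, propS (t - τ) (F τ) n := by
  rw [intervalIntegral.integral_of_le ht.1, ← integral_Icc_eq_integral_Ioc, causalConv]
  have h : ∀ τ ∈ Icc 0 T, (kerS n (t - τ) : ℂ) * F τ n
      = (Icc 0 t).indicator (fun τ => propS (t - τ) (F τ) n) τ := by
    intro τ hτ
    by_cases h : τ ≤ t
    · rw [indicator_of_mem (show τ ∈ Icc 0 t from ⟨hτ.1, h⟩), kerS, if_pos (by linarith)]; rfl
    · rw [indicator_of_notMem (fun h' => h h'.2), kerS, if_neg (by linarith)]; simp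
  rw [setIntegral_congr_fun measurableSet_Icc h, setIntegral_indicator measurableSet_Icc,
    inter_eq_right.2 (Icc_subset_Icc_right ht.2)]

/-- A source on `[0,T]`, integrable in time with values in `H^σ`. -/
structure IsSource (σ T : ℝ) (F : ℝ → Dist) : Prop where
  aemeasurable : ∀ n, AEMeasurable (fun τ => F τ n) (volume.restrict (Icc 0 T))
  lintegral_lt_top : ∫⁻ τ in Icc 0 T, eH σ (F τ) < ∞

theorem IsSource.integrable {σ T : ℝ} {F : ℝ → Dist} (hF : IsSource σ T F) (n : Freq) :
    Integrable (fun τ => F τ n) (volume.restrict (Icc 0 T)) := by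
  refine ⟨(hF.aemeasurable n).aestronglyMeasurable, ?_⟩
  have hw : 0 < bracket n ^ σ := Real.rpow_pos_of_pos (bracket_pos n) _
  have h1 : ∫⁻ τ in Icc 0 T, ENNReal.ofReal (bracket n ^ σ) * ‖F τ n‖ₑ < ∞ :=
    (lintegral_mono fun τ => weight_le_eH σ (F τ) n).trans_lt hF.lintegral_lt_top
  rw [lintegral_const_mul' _ _ ENNReal.ofReal_ne_top] at h1
  exact ENNReal.lt_top_of_mul_ne_top_right h1.ne (by simpa using hw)

theorem integrable_kernel_mul {k : Freq → ℝ → ℝ} {m T t : ℝ} (hk : IsCausal k m)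
    {F : ℝ → Dist} {n : Freq} (hF : Integrable (fun τ => F τ n) (volume.restrict (Icc 0 T)))
    (ht : t ≤ 1) :
    Integrable (fun τ => (k n (t - τ) : ℂ) * F τ n) (volume.restrict (Icc 0 T)) := by
  refine hF.bdd_mul (c := 4 * bracket n ^ (-m)) ?_ ?_
  · exact (Complex.measurable_ofReal.comp
      ((hk.measurable n).comp (measurable_const.sub measurable_id))).aestronglyMeasurable
  · filter_upwards [ae_restrict_mem measurableSet_Icc] with τ hτ
    rw [Complex.norm_real]
    exact hk.abs_le' n (by linarith [hτ.1])

theorem causalConv_sub {k : Freq → ℝ → ℝ} {m T t : ℝ} (hk : IsCausal k m) {F G : ℝ → Dist}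
    (hF : ∀ n, Integrable (fun τ => F τ n) (volume.restrict (Icc 0 T)))
    (hG : ∀ n, Integrable (fun τ => G τ n) (volume.restrict (Icc 0 T))) (ht : t ≤ 1) :
    causalConv k T (fun τ => F τ - G τ) t = causalConv k T F t - causalConv k T G t := by
  funext n
  simp only [causalConv, Pi.sub_apply, mul_sub]
  exact integral_sub (integrable_kernel_mul hk (hF n) ht) (integrable_kernel_mul hk (hG n) ht)

theorem kernel_weight_le {k : Freq → ℝ → ℝ} {m : ℝ} (hk : IsCausal k m) (σ : ℝ) (n : Freq) {x : ℝ}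
    (hx1 : x ≤ 1) (y : ℝ≥0∞) :
    ENNReal.ofReal (bracket n ^ (σ + m)) * (‖k n x‖ₑ * y)
      ≤ 4 * (ENNReal.ofReal (bracket n ^ σ) * y) := by
  have hb := bracket_pos n
  have h := hk.abs_le' n hx1
  rw [← mul_assoc, ← mul_assoc]
  refine mul_le_mul_left ?_ _
  rw [← ofReal_norm, Real.norm_eq_abs, ← ENNReal.ofReal_mul (by positivity)]
  calc _ ≤ ENNReal.ofReal (bracket n ^ (σ + m) * (4 * bracket n ^ (-m))) :=
        ENNReal.ofReal_le_ofReal (by gcongr)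
    _ = ENNReal.ofReal (4 * bracket n ^ σ) := by
        congr 1
        rw [mul_left_comm, ← Real.rpow_add hb]; congr 2; ring
    _ = _ := by rw [ENNReal.ofReal_mul (by norm_num)]; norm_num

theorem aemeasurable_kernel_mul {k : Freq → ℝ → ℝ} {m T t : ℝ} (hk : IsCausal k m)
    {F : ℝ → Dist} {n : Freq} (hF : AEMeasurable (fun τ => F τ n) (volume.restrict (Icc 0 T))) :
    AEMeasurable (fun τ => ‖k n (t - τ)‖ₑ * ‖F τ n‖ₑ) (volume.restrict (Icc 0 T)) :=
  ((hk.measurable n).comp (measurable_const.sub measurable_id)).enorm.aemeasurable.mul hF.enorm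

theorem eH_causalConv_le {k : Freq → ℝ → ℝ} {m : ℝ} (hk : IsCausal k m) {σ T t : ℝ}
    {F : ℝ → Dist}
    (hF : ∀ n, AEMeasurable (fun τ => F τ n) (volume.restrict (Icc 0 T))) (ht : t ≤ 1) :
    eH (σ + m) (causalConv k T F t) ≤ 4 * ∫⁻ τ in Icc 0 T, eH σ (F τ) := by
  have h := eH_lintegral_le (μ := volume.restrict (Icc 0 T)) (s := σ + m) (s' := σ) (F := F)
    (f := fun τ n => ‖k n (t - τ)‖ₑ * ‖F τ n‖ₑ) (b := causalConv k T F t) (g := fun _ => 4)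
    (fun n => aemeasurable_kernel_mul hk (hF n)) (enorm_causalConv_le k T F t) ?_
  · refine h.trans (le_of_eq ?_)
    rw [lintegral_const_mul' _ _ (by norm_num)]
  · filter_upwards [ae_restrict_mem measurableSet_Icc] with τ hτ n
    exact kernel_weight_le hk σ n (by linarith [hτ.1]) _

theorem lintegral_Ioc_rpow_neg_lt_top {γ : ℝ} (hγ : γ < 1) :
    ∫⁻ x, (Ioc (0 : ℝ) 1).indicator (fun x => ENNReal.ofReal (x ^ (-γ))) x < ∞ := by
  rw [lintegral_indicator measurableSet_Ioc]
  have hi := intervalIntegral.intervalIntegrable_rpow' (a := 0) (b := 1) (r := -γ) (by linarith)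
  rw [intervalIntegrable_iff_integrableOn_Ioc_of_le zero_le_one] at hi
  refine lt_of_le_of_lt (lintegral_mono fun x => ?_) hi.2
  rw [← ofReal_norm]
  exact ENNReal.ofReal_le_ofReal (le_abs_self _)

/-- Each derivative costs `1 / x` under the smoothing factor, because `z^γ e^{-z/2} ≤ 2` for
`0 ≤ γ ≤ 1`. -/
theorem rpow_mul_decay_le {γ : ℝ} (hγ0 : 0 ≤ γ) (hγ1 : γ ≤ 1) (n : Freq) {x : ℝ} (hx : 0 < x) :
    bracket n ^ γ * decay n x ≤ 2 * x ^ (-γ) := by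
  have hb := bracket_pos n
  set z := bracket n * x
  have hz : 0 < z := by positivity
  have h1 : z ^ γ ≤ 1 + z := by
    rcases le_total z 1 with h | h
    · linarith [Real.rpow_le_one hz.le h hγ0]
    · have := Real.rpow_le_rpow_of_exponent_le h hγ1
      rw [Real.rpow_one] at this; linarith
  have h2 : 1 + z ≤ 2 * Real.exp (z / 2) := by linarith [Real.add_one_le_exp (z / 2)]
  have h3 : z ^ γ * decay n x ≤ 2 := by
    have e : decay n x = (Real.exp (z / 2))⁻¹ := by rw [decay, ← Real.exp_neg]; congr 1; ring
    rw [e, mul_inv_le_iff₀ (Real.exp_pos _)]; linarith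
  rw [Real.rpow_neg hx.le, ← div_eq_mul_inv, le_div_iff₀ (by positivity)]
  rw [Real.mul_rpow hb.le hx.le] at h3
  linarith

/-- The smoothing of the Duhamel operator: a source bounded in `H^σ` gains `m + γ` derivatives,
for every `γ < 1`. -/
theorem eH_causalConv_smoothing {k : Freq → ℝ → ℝ} {m : ℝ} (hk : IsCausal k m) {γ : ℝ}
    (hγ0 : 0 ≤ γ) (hγ1 : γ < 1) : ∃ C : NNReal, ∀ (σ T t : ℝ) (F : ℝ → Dist) (A : ℝ≥0∞),
    t ≤ 1 → (∀ n, AEMeasurable (fun τ => F τ n) (volume.restrict (Icc 0 T))) →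
    (∀ τ ∈ Icc 0 T, eH σ (F τ) ≤ A) → eH (σ + m + γ) (causalConv k T F t) ≤ C * A := by
  set G : ℝ → ℝ≥0∞ := (Ioc (0 : ℝ) 1).indicator (fun x => ENNReal.ofReal (x ^ (-γ)))
  have hG := lintegral_Ioc_rpow_neg_lt_top hγ1
  refine ⟨8 * (∫⁻ x, G x).toNNReal, fun σ T t F A ht hF hA => ?_⟩
  rw [ENNReal.coe_mul, ENNReal.coe_toNNReal hG.ne]
  have h := eH_lintegral_le (μ := volume.restrict (Icc 0 T)) (s := σ + m + γ) (s' := σ) (F := F)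
    (f := fun τ n => ‖k n (t - τ)‖ₑ * ‖F τ n‖ₑ) (b := causalConv k T F t)
    (g := fun τ => 8 * G (t - τ))
    (fun n => aemeasurable_kernel_mul hk (hF n)) (enorm_causalConv_le k T F t) ?_
  · refine h.trans ?_
    calc ∫⁻ τ in Icc 0 T, 8 * G (t - τ) * eH σ (F τ)
        ≤ ∫⁻ τ in Icc 0 T, 8 * G (t - τ) * A :=
          setLIntegral_mono' measurableSet_Icc fun τ hτ => mul_le_mul_right (hA τ hτ) _
      _ ≤ ∫⁻ τ, 8 * G (t - τ) * A := setLIntegral_le_lintegral _ _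
      _ = 8 * (∫⁻ x, G x) * A := by
          have hGm : Measurable G :=
            (by fun_prop : Measurable fun x : ℝ => ENNReal.ofReal (x ^ (-γ))).indicator
              measurableSet_Ioc
          have hGm' : Measurable fun τ => G (t - τ) :=
            hGm.comp (measurable_const.sub measurable_id)
          rw [lintegral_mul_const _ (hGm'.const_mul _), lintegral_const_mul _ hGm',
            lintegral_sub_left_eq_self G t]
  · have hne : ∀ᵐ τ ∂(volume.restrict (Icc 0 T)), τ ≠ t :=
      ae_restrict_of_ae (Measure.ae_ne volume t)
    filter_upwards [ae_restrict_mem measurableSet_Icc, hne] with τ hτ hτt n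
    have hb := bracket_pos n
    rcases lt_or_gt_of_ne hτt with hlt | hgt
    · have hx : 0 < t - τ := by linarith
      have hx1 : t - τ ≤ 1 := by linarith [hτ.1]
      rw [show G (t - τ) = ENNReal.ofReal ((t - τ) ^ (-γ)) from
          indicator_of_mem (show t - τ ∈ Ioc (0 : ℝ) 1 from ⟨hx, hx1⟩) _,
        ← mul_assoc, ← mul_assoc]
      refine mul_le_mul_left ?_ _
      rw [← ofReal_norm, Real.norm_eq_abs, ← ENNReal.ofReal_mul (by positivity),
        show (8 : ℝ≥0∞) = ENNReal.ofReal 8 by norm_num, ← ENNReal.ofReal_mul (by norm_num),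
        ← ENNReal.ofReal_mul (by positivity)]
      refine ENNReal.ofReal_le_ofReal ?_
      have h1 := hk.abs_le n _ hx.le hx1
      have h2 := rpow_mul_decay_le hγ0 hγ1.le n hx
      calc bracket n ^ (σ + m + γ) * |k n (t - τ)|
          ≤ bracket n ^ (σ + m + γ) * (4 * bracket n ^ (-m) * decay n (t - τ)) := by gcongr
        _ = 4 * bracket n ^ σ * (bracket n ^ γ * decay n (t - τ)) := by
            rw [Real.rpow_add hb, Real.rpow_add hb, Real.rpow_neg hb.le]
            have := (Real.rpow_pos_of_pos hb m).ne'
            field_simp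
        _ ≤ 4 * bracket n ^ σ * (2 * (t - τ) ^ (-γ)) := by gcongr
        _ = 8 * (t - τ) ^ (-γ) * bracket n ^ σ := by ring
    · rw [hk.eq_zero n _ (by linarith)]; simp

/-! ### Strichartz estimates -/

theorem lintegral_decay_rpow_le {q : ℝ} (hq : 2 ≤ q) (n : Freq) :
    ∫⁻ x in Ici 0, ENNReal.ofReal (decay n x) ^ q ≤ ENNReal.ofReal (bracket n ^ (-1 : ℝ)) := by
  have hb := bracket_pos n
  have hneg : -(q * bracket n / 2) < 0 := by
    have : 0 < q * bracket n / 2 := by positivity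
    linarith
  have e : ∀ x, ENNReal.ofReal (decay n x) ^ q
      = ENNReal.ofReal (Real.exp (-(q * bracket n / 2) * x)) := fun x => by
    rw [ENNReal.ofReal_rpow_of_pos (decay_pos n x), decay, ← Real.exp_mul]
    congr 2; ring
  simp only [e]
  rw [← setLIntegral_congr Ioi_ae_eq_Ici, ← ofReal_integral_eq_lintegral_ofReal
    (integrableOn_exp_mul_Ioi hneg 0) (Eventually.of_forall fun x => (Real.exp_pos _).le),
    integral_exp_mul_Ioi hneg]
  refine ENNReal.ofReal_le_ofReal ?_
  rw [mul_zero, Real.exp_zero, neg_div_neg_eq, Real.rpow_neg_one, inv_eq_one_div]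
  refine one_div_le_one_div_of_le hb ?_
  nlinarith

/-- The homogeneous Strichartz estimate for the semigroup `e^{-⟨D⟩t/2}`. -/
theorem strichartz_decay {q : ℝ} (hq : 2 ≤ q) (b : ℝ) (a : Dist) :
    (∫⁻ x in Ici 0, eH b (fun n => (decay n x : ℂ) * a n) ^ q) ^ (1 / q) ≤ eH (b - 1 / q) a := by
  have hq0 : 0 < q := by linarith
  set f : Freq → ℝ → ℝ≥0∞ := fun n x =>
    (ENNReal.ofReal (bracket n ^ b) * (ENNReal.ofReal (decay n x) * ‖a n‖ₑ)) ^ (2 : ℝ)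
  have hdm : ∀ n, Measurable fun x => ENNReal.ofReal (decay n x) := fun n => by
    unfold decay; fun_prop
  have hfm : ∀ n, Measurable (f n) := fun n =>
    (((hdm n).mul_const _).const_mul _).pow_const _
  have hf : Measurable (Function.uncurry f) := measurable_from_prod_countable_right hfm
  -- Minkowski in `L^{q/2}` for the squares, which needs `q ≥ 2`
  have hmink := lintegral_minkowski_of_measurable (μ := (Measure.count : Measure Freq))
    (ν := volume.restrict (Ici (0 : ℝ))) hf (p := q / 2) (by linarith)
  have e1 : ∀ x, (∫⁻ n, f n x ∂Measure.count) ^ (q / 2)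
      = eH b (fun n => (decay n x : ℂ) * a n) ^ q := fun x => by
    rw [eH, ← ENNReal.rpow_mul, one_div_mul_eq_div]
    congr 1
    refine lintegral_congr fun n => ?_
    simp only [f, enorm_mul]
    rw [← ofReal_norm (decay n x : ℂ), Complex.norm_real, Real.norm_of_nonneg (decay_pos n x).le]
  simp only [e1] at hmink
  have e2 : ∀ n, (∫⁻ x in Ici 0, f n x ^ (q / 2)) ^ (1 / (q / 2))
      ≤ (ENNReal.ofReal (bracket n ^ (b - 1 / q)) * ‖a n‖ₑ) ^ (2 : ℝ) := fun n => by
    have hb := bracket_pos n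
    have e3 : ∀ x, f n x ^ (q / 2) = (ENNReal.ofReal (bracket n ^ b) * ‖a n‖ₑ) ^ q *
        ENNReal.ofReal (decay n x) ^ q := fun x => by
      simp only [f]
      rw [← ENNReal.rpow_mul, mul_div_cancel₀ _ two_ne_zero, ← ENNReal.mul_rpow_of_nonneg _ _ hq0.le]
      congr 1; ring
    simp only [e3]
    rw [lintegral_const_mul _ ((hdm n).pow_const q)]
    calc _ ≤ ((ENNReal.ofReal (bracket n ^ b) * ‖a n‖ₑ) ^ q *
          ENNReal.ofReal (bracket n ^ (-1 : ℝ))) ^ (1 / (q / 2)) :=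
          ENNReal.rpow_le_rpow (mul_le_mul_right (lintegral_decay_rpow_le hq n) _) (by positivity)
      _ = _ := by
          rw [ENNReal.mul_rpow_of_nonneg _ _ (by positivity), ← ENNReal.rpow_mul,
            ENNReal.ofReal_rpow_of_pos (by positivity), ← Real.rpow_mul hb.le,
            show q * (1 / (q / 2)) = 2 by field_simp,
            ENNReal.mul_rpow_of_nonneg _ _ (by norm_num), ENNReal.mul_rpow_of_nonneg _ _ (by norm_num),
            ENNReal.ofReal_rpow_of_pos (by positivity), ENNReal.ofReal_rpow_of_pos (by positivity),
            mul_right_comm, ← ENNReal.ofReal_mul (by positivity), ← Real.rpow_mul hb.le,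
            ← Real.rpow_mul hb.le, ← Real.rpow_add hb]
          congr 4
          field_simp
          ring
  have h3 := hmink.trans (lintegral_mono e2)
  rw [eH, one_div, ENNReal.rpow_inv_le_iff hq0, ← ENNReal.rpow_mul]
  rw [one_div, ENNReal.rpow_inv_le_iff (by positivity)] at h3
  refine h3.trans (le_of_eq ?_)
  rw [one_div_mul_eq_div]
  simp only [one_div]

/-- The inhomogeneous Strichartz estimate: by Minkowski's inequality it follows from the
homogeneous one when the source is integrable in time. -/
theorem strichartz_causalConv {k : Freq → ℝ → ℝ} {m : ℝ} (hk : IsCausal k m) {q : ℝ} (hq : 2 ≤ q)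
    (b : ℝ) {T : ℝ} (hT : T ≤ 1) {F : ℝ → Dist}
    (hF : ∀ n, AEMeasurable (fun τ => F τ n) (volume.restrict (Icc 0 T))) :
    (∫⁻ t in Icc 0 T, eH b (causalConv k T F t) ^ q) ^ (1 / q)
      ≤ 4 * ∫⁻ τ in Icc 0 T, eH (b - m - 1 / q) (F τ) := by
  have hq0 : 0 < q := by linarith
  set d : Freq → ℝ → ℝ := fun n x => (Ici (0 : ℝ)).indicator (decay n) x
  have hdm : ∀ n, Measurable (d n) := fun n =>
    (by unfold decay; fun_prop : Measurable (decay n)).indicator measurableSet_Ici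
  set G : ℝ → ℝ → ℝ≥0∞ := fun τ t => 4 * eH (b - m) (fun n => (d n (t - τ) : ℂ) * F τ n)
  have hG : AEMeasurable (Function.uncurry G)
      ((volume.restrict (Icc 0 T)).prod (volume.restrict (Icc 0 T))) := by
    refine AEMeasurable.const_mul ?_ _
    simp only [eH_eq_tsum]
    refine (AEMeasurable.tsum fun n => ?_).pow_const _
    refine (AEMeasurable.const_mul (AEMeasurable.enorm ?_) _).pow_const _
    refine AEMeasurable.mul ?_ (hF n).comp_fst
    exact (Complex.measurable_ofReal.comp
      ((hdm n).comp (measurable_snd.sub measurable_fst))).aemeasurable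
  have hpt : ∀ t ∈ Icc 0 T, eH b (causalConv k T F t) ≤ ∫⁻ τ in Icc 0 T, G τ t := by
    intro t ht
    have ht1 : t ≤ 1 := ht.2.trans hT
    refine eH_lintegral_le (μ := volume.restrict (Icc 0 T)) (s := b) (s' := b - m)
      (F := fun τ n => (d n (t - τ) : ℂ) * F τ n)
      (f := fun τ n => ‖k n (t - τ)‖ₑ * ‖F τ n‖ₑ) (g := fun _ => 4)
      (fun n => aemeasurable_kernel_mul hk (hF n)) (enorm_causalConv_le k T F t) ?_
    filter_upwards [ae_restrict_mem measurableSet_Icc] with τ hτ n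
    have hb := bracket_pos n
    rcases lt_or_ge (t - τ) 0 with hx | hx
    · rw [hk.eq_zero n _ hx]; simp
    · rw [enorm_mul, show d n (t - τ) = decay n (t - τ) from indicator_of_mem hx _,
        ← mul_assoc, ← mul_assoc, ← mul_assoc]
      refine mul_le_mul_left ?_ _
      have h1 := hk.abs_le n _ hx (by linarith [hτ.1])
      rw [← ofReal_norm, Real.norm_eq_abs, ← ofReal_norm (decay n (t - τ) : ℂ), Complex.norm_real,
        Real.norm_of_nonneg (decay_pos n _).le, ← ENNReal.ofReal_mul (by positivity),
        show (4 : ℝ≥0∞) = ENNReal.ofReal 4 by norm_num, ← ENNReal.ofReal_mul (by norm_num),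
        ← ENNReal.ofReal_mul (by positivity)]
      refine ENNReal.ofReal_le_ofReal ?_
      calc _ ≤ bracket n ^ b * (4 * bracket n ^ (-m) * decay n (t - τ)) := by gcongr
        _ = _ := by rw [sub_eq_add_neg b m, Real.rpow_add hb]; ring
  calc (∫⁻ t in Icc 0 T, eH b (causalConv k T F t) ^ q) ^ (1 / q)
      ≤ (∫⁻ t in Icc 0 T, (∫⁻ τ in Icc 0 T, G τ t) ^ q) ^ (1 / q) :=
        ENNReal.rpow_le_rpow (setLIntegral_mono' measurableSet_Icc fun t ht =>
          ENNReal.rpow_le_rpow (hpt t ht) hq0.le) (by positivity)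
    _ ≤ ∫⁻ τ in Icc 0 T, (∫⁻ t in Icc 0 T, G τ t ^ q) ^ (1 / q) :=
        lintegral_minkowski hG (by linarith)
    _ ≤ ∫⁻ τ in Icc 0 T, 4 * eH (b - m - 1 / q) (F τ) := by
        refine lintegral_mono fun τ => ?_
        have h1 : ∫⁻ t in Icc 0 T, G τ t ^ q
            ≤ 4 ^ q * ∫⁻ x in Ici 0, eH (b - m) (fun n => (decay n x : ℂ) * F τ n) ^ q := by
          set Φ : ℝ → ℝ≥0∞ := (Ici (0 : ℝ)).indicator fun x =>
            eH (b - m) (fun n => (decay n x : ℂ) * F τ n) ^ q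
          have e : ∀ t, G τ t ^ q = 4 ^ q * Φ (t - τ) := fun t => by
            simp only [G]
            rw [ENNReal.mul_rpow_of_nonneg _ _ hq0.le]
            congr 1
            by_cases hx : t - τ ∈ Ici (0 : ℝ)
            · simp only [Φ, d, indicator_of_mem hx]
            · simp only [Φ, d, indicator_of_notMem hx]
              rw [show (fun n => ((0 : ℝ) : ℂ) * F τ n) = 0 by funext n; simp, eH_zero,
                ENNReal.zero_rpow_of_pos hq0]
          simp only [e]
          refine (setLIntegral_le_lintegral _ _).trans ?_
          rw [lintegral_const_mul' _ _ (ENNReal.rpow_ne_top_of_nonneg hq0.le (by norm_num)),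
            lintegral_sub_right_eq_self Φ τ, lintegral_indicator measurableSet_Ici]
        refine (ENNReal.rpow_le_rpow h1 (by positivity)).trans ?_
        rw [ENNReal.mul_rpow_of_nonneg _ _ (by positivity), ← ENNReal.rpow_mul,
          mul_one_div_cancel hq0.ne', ENNReal.rpow_one]
        exact mul_le_mul_right (strichartz_decay hq _ _) _
    _ = _ := lintegral_const_mul' _ _ (by norm_num)

/-! ### Continuity in time -/

theorem continuousInSobolev_iff {s T : ℝ} {a : ℝ → Dist} :
    ContinuousInSobolev s T a ↔ (∀ t ∈ Icc 0 T, eH s (a t) < ∞) ∧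
      ∀ t ∈ Icc 0 T, Tendsto (fun τ => eH s (a τ - a t)) (𝓝[Icc 0 T] t) (𝓝 0) := by
  simp only [ContinuousInSobolev, memSobolev_iff]
  refine and_congr_right fun h => forall₂_congr fun t ht => ?_
  simp only [sobolevNorm_eq]
  have hfin : ∀ᶠ τ in 𝓝[Icc 0 T] t, eH s (a τ - a t) ≠ ∞ := by
    filter_upwards [self_mem_nhdsWithin] with τ hτ
    exact ((eH_sub_le s _ _).trans_lt (ENNReal.add_lt_top.2 ⟨h τ hτ, h t ht⟩)).ne
  constructor
  · intro h1
    have h2 := ENNReal.tendsto_ofReal h1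
    rw [ENNReal.ofReal_zero] at h2
    refine h2.congr' ?_
    filter_upwards [hfin] with τ hτ using ENNReal.ofReal_toReal hτ
  · intro h1
    have := (ENNReal.tendsto_toReal ENNReal.zero_ne_top).comp h1
    simpa [Function.comp_def] using this

theorem ContinuousInSobolev.add {s T : ℝ} {a b : ℝ → Dist} (ha : ContinuousInSobolev s T a)
    (hb : ContinuousInSobolev s T b) : ContinuousInSobolev s T fun t => a t + b t := by
  rw [continuousInSobolev_iff] at *
  refine ⟨fun t ht => (eH_add_le s _ _).trans_lt (ENNReal.add_lt_top.2 ⟨ha.1 t ht, hb.1 t ht⟩),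
    fun t ht => ?_⟩
  have h := (ha.2 t ht).add (hb.2 t ht)
  rw [add_zero] at h
  refine tendsto_of_tendsto_of_tendsto_of_le_of_le tendsto_const_nhds h (fun _ => zero_le)
    fun τ => ?_
  rw [add_sub_add_comm]
  exact eH_add_le s _ _

theorem ContinuousInSobolev.smul {s T : ℝ} {a : ℝ → Dist} (ha : ContinuousInSobolev s T a)
    (c : ℂ) : ContinuousInSobolev s T fun t => c • a t := by
  rw [continuousInSobolev_iff] at *
  refine ⟨fun t ht => (eH_smul_le s _ _).trans_lt (ENNReal.mul_lt_top enorm_lt_top (ha.1 t ht)),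
    fun t ht => ?_⟩
  have h := ENNReal.Tendsto.const_mul (a := ‖c‖ₑ) (ha.2 t ht) (Or.inr enorm_ne_top)
  rw [mul_zero] at h
  refine tendsto_of_tendsto_of_tendsto_of_le_of_le tendsto_const_nhds h (fun _ => zero_le)
    fun τ => ?_
  rw [← smul_sub]
  exact eH_smul_le s _ _

theorem ContinuousInSobolev.mono {s s' T : ℝ} (h : s ≤ s') {a : ℝ → Dist}
    (ha : ContinuousInSobolev s' T a) : ContinuousInSobolev s T a := by
  rw [continuousInSobolev_iff] at *
  refine ⟨fun t ht => (eH_mono_exp h _).trans_lt (ha.1 t ht), fun t ht => ?_⟩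
  exact tendsto_of_tendsto_of_tendsto_of_le_of_le tendsto_const_nhds (ha.2 t ht)
    (fun _ => zero_le) fun τ => eH_mono_exp h _

/-- Continuity in `H^s` from continuity of each coefficient and a square summable majorant. -/
theorem continuousInSobolev_of_dominated {s T : ℝ} {a : ℝ → Dist} {g : Freq → ℝ}
    (hc : ∀ n, ContinuousOn (fun t => a t n) (Icc 0 T)) (hg : eH s (fun n => (g n : ℂ)) < ∞)
    (hag : ∀ t ∈ Icc 0 T, ∀ n, ‖a t n‖ ≤ g n) : ContinuousInSobolev s T a := by
  have hgs := memSobolev_iff.2 hg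
  have hen : ∀ t ∈ Icc 0 T, ∀ n, ‖a t n‖ₑ ≤ ‖(g n : ℂ)‖ₑ := fun t ht n => by
    rw [← ofReal_norm, ← ofReal_norm, Complex.norm_real]
    exact ENNReal.ofReal_le_ofReal ((hag t ht n).trans (le_abs_self _))
  refine ⟨fun t ht => memSobolev_iff.2 ((eH_mono le_rfl (hen t ht)).trans_lt hg), fun t ht => ?_⟩
  have h1 : Tendsto (fun τ => ∑' n, bracket n ^ (2 * s) * ‖(a τ - a t) n‖ ^ 2) (𝓝[Icc 0 T] t)
      (𝓝 (∑' _n : Freq, 0)) := by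
    refine tendsto_tsum_of_dominated_convergence
      (bound := fun n => 4 * (bracket n ^ (2 * s) * ‖(g n : ℂ)‖ ^ 2)) (hgs.mul_left 4) ?_ ?_
    · intro n
      have h2 : Tendsto (fun τ => (a τ - a t) n) (𝓝[Icc 0 T] t) (𝓝 0) := by
        have := ((hc n) t ht).tendsto.sub_const (a t n)
        simpa using this
      have := (h2.norm.pow 2).const_mul (bracket n ^ (2 * s))
      simpa using this
    · filter_upwards [self_mem_nhdsWithin] with τ hτ n
      have hb : 0 ≤ bracket n ^ (2 * s) := Real.rpow_nonneg (bracket_pos n).le _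
      rw [Real.norm_of_nonneg (by positivity), mul_left_comm]
      refine mul_le_mul_of_nonneg_left ?_ hb
      have h3 : ‖(a τ - a t) n‖ ≤ 2 * ‖(g n : ℂ)‖ := by
        have e1 := hag τ hτ n
        have e2 := hag t ht n
        have e3 : g n ≤ ‖(g n : ℂ)‖ := by rw [Complex.norm_real]; exact le_abs_self _
        exact (norm_sub_le _ _).trans (by linarith)
      calc ‖(a τ - a t) n‖ ^ 2 ≤ (2 * ‖(g n : ℂ)‖) ^ 2 := by gcongr
        _ = _ := by ring
  rw [tsum_zero] at h1
  have h4 := (Real.continuous_sqrt.tendsto 0).comp h1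
  rw [Real.sqrt_zero] at h4
  exact h4

/-- Continuity in `H^s` from continuity of each coefficient and a bound in a stronger norm. -/
theorem continuousInSobolev_of_bounded {s δ T : ℝ} (hδ : 0 < δ) {a : ℝ → Dist} {A : ℝ≥0∞}
    (hc : ∀ n, ContinuousOn (fun t => a t n) (Icc 0 T)) (hA : A ≠ ∞)
    (ha : ∀ t ∈ Icc 0 T, eH (s + δ) (a t) ≤ A) : ContinuousInSobolev s T a := by
  classical
  rw [continuousInSobolev_iff]
  refine ⟨fun t ht => ((eH_mono_exp (by linarith) _).trans (ha t ht)).trans_lt hA.lt_top,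
    fun t ht => ?_⟩
  rw [ENNReal.tendsto_nhds_zero]
  intro ε hε
  have hlim : Tendsto (fun K : ℝ => ENNReal.ofReal (K ^ (-δ)) * (A + A)) atTop (𝓝 0) := by
    have := ENNReal.Tendsto.mul_const (b := A + A) (ENNReal.tendsto_ofReal (tendsto_rpow_neg_atTop hδ))
      (Or.inr (by finiteness))
    simpa using this
  obtain ⟨K, hK, hK0⟩ := ((ENNReal.tendsto_nhds_zero.1 hlim (ε / 2) (ENNReal.half_pos hε.ne')).and
    (eventually_gt_atTop (0 : ℝ))).exists
  set S := (finite_bracket_le K).toFinset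
  have hSm : ∀ n, n ∈ S ↔ bracket n ≤ K := fun n => by simp [S]
  -- low frequencies converge one by one, high frequencies are uniformly small
  have hlow : Tendsto (fun τ => eH s (fun n => if n ∈ S then (a τ - a t) n else 0))
      (𝓝[Icc 0 T] t) (𝓝 0) := by
    have e : ∀ τ, eH s (fun n => if n ∈ S then (a τ - a t) n else 0)
        = (∑ n ∈ S, (ENNReal.ofReal (bracket n ^ s) * ‖(a τ - a t) n‖ₑ) ^ (2 : ℝ)) ^ (1 / 2 : ℝ) := by
      intro τ
      rw [eH_eq_tsum, tsum_eq_sum (s := S)]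
      · congr 1
        exact Finset.sum_congr rfl fun n hn => by rw [if_pos hn]
      · intro n hn; rw [if_neg hn]; simp
    simp only [e]
    have h1 : Tendsto (fun τ => ∑ n ∈ S,
        (ENNReal.ofReal (bracket n ^ s) * ‖(a τ - a t) n‖ₑ) ^ (2 : ℝ)) (𝓝[Icc 0 T] t)
        (𝓝 (∑ n ∈ S, (ENNReal.ofReal (bracket n ^ s) * ‖(0 : ℂ)‖ₑ) ^ (2 : ℝ))) := by
      refine tendsto_finsetSum S fun n _ => ?_
      have h2 : Tendsto (fun τ => (a τ - a t) n) (𝓝[Icc 0 T] t) (𝓝 0) := by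
        have := ((hc n) t ht).tendsto.sub_const (a t n)
        simpa using this
      exact (ENNReal.continuous_rpow_const.tendsto _).comp (ENNReal.Tendsto.const_mul
        ((continuous_enorm.tendsto _).comp h2) (Or.inr ENNReal.ofReal_ne_top))
    have h3 := (ENNReal.continuous_rpow_const (y := (1 / 2 : ℝ)).tendsto _).comp h1
    simpa [Function.comp_def] using h3
  filter_upwards [self_mem_nhdsWithin,
    ENNReal.tendsto_nhds_zero.1 hlow (ε / 2) (ENNReal.half_pos hε.ne')] with τ hτ hτ2
  have hsplit : a τ - a t = (fun n => if n ∈ S then (a τ - a t) n else 0)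
      + fun n => if n ∈ S then 0 else (a τ - a t) n := by
    funext n; simp only [Pi.add_apply]; split_ifs <;> simp
  have hhigh : eH s (fun n => if n ∈ S then 0 else (a τ - a t) n)
      ≤ ENNReal.ofReal (K ^ (-δ)) * eH (s + δ) (a τ - a t) := by
    refine eH_le_mul fun n => ?_
    split_ifs with hn
    · simp
    · rw [hSm, not_le] at hn
      have hb := bracket_pos n
      rw [← mul_assoc, ← ENNReal.ofReal_mul (by positivity)]
      refine mul_le_mul_left (ENNReal.ofReal_le_ofReal ?_) _
      rw [Real.rpow_add hb, mul_left_comm]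
      refine le_mul_of_one_le_right (by positivity) ?_
      rw [Real.rpow_neg hK0.le, ← div_eq_inv_mul, one_le_div (by positivity)]
      exact Real.rpow_le_rpow hK0.le hn.le hδ.le
  calc eH s (a τ - a t)
      ≤ _ + _ := by rw [hsplit]; exact eH_add_le s _ _
    _ ≤ ε / 2 + ENNReal.ofReal (K ^ (-δ)) * (A + A) := by
        refine add_le_add hτ2 (hhigh.trans (mul_le_mul_right ?_ _))
        exact (eH_sub_le _ _ _).trans (add_le_add (ha τ hτ) (ha t ht))
    _ ≤ ε / 2 + ε / 2 := by gcongr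
    _ = ε := ENNReal.add_halves ε

theorem continuousOn_causalConv {k : Freq → ℝ → ℝ} {m T : ℝ} (hk : IsCausal k m) (hT : T ≤ 1)
    {F : ℝ → Dist} {n : Freq} (hF : Integrable (fun τ => F τ n) (volume.restrict (Icc 0 T))) :
    ContinuousOn (fun t => causalConv k T F t n) (Icc 0 T) := by
  intro t ht
  refine continuousWithinAt_of_dominated
    (bound := fun τ => 4 * bracket n ^ (-m) * ‖F τ n‖) ?_ ?_ (hF.norm.const_mul _) ?_
  · filter_upwards [self_mem_nhdsWithin] with y hy
    exact (integrable_kernel_mul hk hF (hy.2.trans hT)).aestronglyMeasurable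
  · filter_upwards [self_mem_nhdsWithin] with y hy
    filter_upwards [ae_restrict_mem measurableSet_Icc] with τ hτ
    rw [norm_mul, Complex.norm_real]
    gcongr
    exact hk.abs_le' n (by linarith [hτ.1, hy.2])
  · filter_upwards [ae_restrict_of_ae (Measure.ae_ne volume t)] with τ hτ
    have h1 : ContinuousAt (fun y => k n (y - τ)) t :=
      ContinuousAt.comp (f := fun y => y - τ) (hk.continuousAt n (t - τ) (sub_ne_zero.2 hτ.symm))
        (by fun_prop)
    exact ((Complex.continuous_ofReal.continuousAt.comp h1).mul continuousAt_const).continuousWithinAt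

theorem continuousInSobolev_causalConv {k : Freq → ℝ → ℝ} {m σ T : ℝ} (hk : IsCausal k m)
    (hT : T ≤ 1) {F : ℝ → Dist} (hF : IsSource σ T F) :
    ContinuousInSobolev (σ + m) T (causalConv k T F) := by
  set g : Freq → ℝ := fun n => 4 * bracket n ^ (-m) * ∫ τ in Icc 0 T, ‖F τ n‖
  have hg0 : ∀ n, 0 ≤ g n := fun n => by
    have := bracket_pos n
    have : 0 ≤ ∫ τ in Icc 0 T, ‖F τ n‖ := integral_nonneg fun _ => norm_nonneg _
    positivity
  refine continuousInSobolev_of_dominated (g := g)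
    (fun n => continuousOn_causalConv hk hT (hF.integrable n)) ?_ ?_
  · have h := eH_lintegral_le (μ := volume.restrict (Icc 0 T)) (s := σ + m) (s' := σ) (F := F)
      (f := fun τ n => ENNReal.ofReal (4 * bracket n ^ (-m)) * ‖F τ n‖ₑ)
      (b := fun n => (g n : ℂ)) (g := fun _ => 4)
      (fun n => (hF.aemeasurable n).enorm.const_mul _) ?_ ?_
    · refine h.trans_lt ?_
      rw [lintegral_const_mul' _ _ (by norm_num)]
      exact ENNReal.mul_lt_top (by norm_num) hF.lintegral_lt_top
    · intro n
      have hb := bracket_pos n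
      rw [lintegral_const_mul' _ _ ENNReal.ofReal_ne_top, ← ofReal_norm, Complex.norm_real,
        Real.norm_of_nonneg (hg0 n), ENNReal.ofReal_mul (by positivity),
        ofReal_integral_norm_eq_lintegral_enorm (hF.integrable n)]
    · refine Eventually.of_forall fun τ n => le_of_eq ?_
      have hb := bracket_pos n
      rw [← mul_assoc, ← mul_assoc, ← ENNReal.ofReal_mul (by positivity)]
      congr 1
      rw [mul_left_comm, ← Real.rpow_add hb, add_neg_cancel_right,
        ENNReal.ofReal_mul (by norm_num)]
      norm_num
  · intro t ht n
    refine (norm_integral_le_integral_norm _).trans ?_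
    simp only [g]
    rw [← integral_const_mul]
    refine setIntegral_mono_on (integrable_kernel_mul hk (hF.integrable n)
      (ht.2.trans hT)).norm ((hF.integrable n).norm.const_mul _) measurableSet_Icc fun τ hτ => ?_
    rw [norm_mul, Complex.norm_real]
    gcongr
    exact hk.abs_le' n (by linarith [hτ.1, ht.2])

theorem lipschitzWith_kerS (n : Freq) : LipschitzWith 2 (kerS n) := by
  have h1 : LipschitzOnWith 2 (fun x => symbolS x n) (Ici 0) := by
    refine (convex_Ici 0).lipschitzOnWith_of_nnnorm_hasDerivWithin_le
      (fun x _ => (hasDerivAt_symbolS x n).hasDerivWithinAt) fun x hx => ?_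
    rw [← NNReal.coe_le_coe, coe_nnnorm, Real.norm_eq_abs]
    refine (abs_symbolD_le_exp x n).trans ?_
    have : Real.exp (-(freqNorm n / 2) * x) ≤ 1 := by
      rw [Real.exp_le_one_iff]
      have := freqNorm_nonneg n
      have hx' : 0 ≤ x := hx
      nlinarith
    push_cast; linarith
  have h2 : kerS n = fun x => symbolS (max x 0) n := by
    funext x
    rw [kerS]
    split_ifs with h
    · rw [max_eq_left h]
    · rw [max_eq_right (not_le.1 h).le, symbolS_zero]
  rw [h2]
  refine LipschitzWith.of_dist_le_mul fun x y => ?_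
  refine (h1.dist_le_mul _ (le_max_right x 0) _ (le_max_right y 0)).trans ?_
  gcongr
  exact abs_max_sub_max_le_abs x y 0

/-- The Duhamel integral is differentiable in time, mode by mode, even though the source is
merely integrable: the kernel is Lipschitz, being continuous at time zero. -/
theorem hasDerivAt_causalConv_kerS {T t : ℝ} (ht : t ≤ 1) {F : ℝ → Dist} {n : Freq}
    (hF : Integrable (fun τ => F τ n) (volume.restrict (Icc 0 T))) :
    HasDerivAt (fun x => causalConv kerS T F x n) (causalConv kerD T F t n) t := by
  refine (hasDerivAt_integral_of_dominated_loc_of_lip (𝕜 := ℝ) (s := univ)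
    (bound := fun τ => 2 * ‖F τ n‖) (F := fun x τ => (kerS n (x - τ) : ℂ) * F τ n)
    (F' := fun τ => (kerD n (t - τ) : ℂ) * F τ n) univ_mem ?_
    (integrable_kernel_mul isCausal_kerS hF ht)
    (integrable_kernel_mul isCausal_kerD hF ht).aestronglyMeasurable ?_
    (hF.norm.const_mul 2) ?_).2
  · refine Eventually.of_forall fun x => AEStronglyMeasurable.mul ?_ hF.aestronglyMeasurable
    exact (Complex.measurable_ofReal.comp ((isCausal_kerS.measurable n).comp
      (measurable_const.sub measurable_id))).aestronglyMeasurable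
  · refine Eventually.of_forall fun τ => LipschitzOnWith.of_dist_le_mul fun x _ y _ => ?_
    rw [dist_eq_norm, ← sub_mul, norm_mul, ← Complex.ofReal_sub, Complex.norm_real]
    have h := (lipschitzWith_kerS n).dist_le_mul (x - τ) (y - τ)
    rw [dist_sub_right, dist_eq_norm] at h
    simp only [Real.coe_nnabs, abs_mul, abs_norm, Nat.abs_ofNat]
    calc _ ≤ (2 * dist x y) * ‖F τ n‖ := by gcongr; exact h
      _ = _ := by ring
  · filter_upwards [ae_restrict_of_ae (Measure.ae_ne volume t)] with τ hτ
    have hd : HasDerivAt (kerS n) (kerD n (t - τ)) (t - τ) := by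
      rcases lt_or_gt_of_ne (sub_ne_zero.2 hτ.symm) with hx | hx
      · rw [isCausal_kerD.eq_zero n _ hx]
        refine (hasDerivAt_const _ (0 : ℝ)).congr_of_eventuallyEq ?_
        filter_upwards [Iio_mem_nhds hx] with y hy
        exact isCausal_kerS.eq_zero n y hy
      · rw [kerD, if_pos hx.le]
        refine (hasDerivAt_symbolS _ n).congr_of_eventuallyEq ?_
        filter_upwards [Ioi_mem_nhds hx] with y hy
        exact if_pos (le_of_lt hy)
    exact ((hd.comp_sub_const t τ).ofReal_comp).mul_const _

/-! ### The free evolution -/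

/-- The time derivative of `V(t)(φ₀, φ₁)`. -/
def propVderiv (t : ℝ) (φ₀ φ₁ : Dist) : Dist :=
  fun n => ((-(bracket n ^ 2 * symbolS t n) : ℝ) : ℂ) * φ₀ n + (symbolD t n : ℂ) * φ₁ n

theorem hasDerivAt_propV (t : ℝ) (φ₀ φ₁ : Dist) (n : Freq) :
    HasDerivAt (fun x => propV x φ₀ φ₁ n) (propVderiv t φ₀ φ₁ n) t :=
  ((hasDerivAt_symbolC t n).ofReal_comp.mul_const _).add
    ((hasDerivAt_symbolS t n).ofReal_comp.mul_const _)

/-- A majorant of the coefficients of `V(t)(φ₀, φ₁)`, up to the decay factor. -/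
def majorantV (φ₀ φ₁ : Dist) (n : Freq) : ℝ := 4 * ‖φ₀ n‖ + 4 * bracket n ^ (-1 : ℝ) * ‖φ₁ n‖

theorem majorantV_nonneg (φ₀ φ₁ : Dist) (n : Freq) : 0 ≤ majorantV φ₀ φ₁ n := by
  have := bracket_pos n
  unfold majorantV; positivity

theorem eH_majorantV_lt_top {s : ℝ} {φ₀ φ₁ : Dist} (h₀ : eH s φ₀ < ∞) (h₁ : eH (s - 1) φ₁ < ∞) :
    eH s (fun n => (majorantV φ₀ φ₁ n : ℂ)) < ∞ := by
  have e : (fun n => (majorantV φ₀ φ₁ n : ℂ))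
      = (fun n => ((4 * ‖φ₀ n‖ : ℝ) : ℂ)) + fun n => ((4 * bracket n ^ (-1 : ℝ) * ‖φ₁ n‖ : ℝ) : ℂ) := by
    funext n; simp [majorantV]
  rw [e]
  refine (eH_add_le s _ _).trans_lt (ENNReal.add_lt_top.2 ⟨?_, ?_⟩)
  · refine (eH_le_mul (C := 4) (b := φ₀) (s' := s) fun n => le_of_eq ?_).trans_lt
      (ENNReal.mul_lt_top (by norm_num) h₀)
    rw [← ofReal_norm, Complex.norm_real, Real.norm_of_nonneg (by positivity),
      ENNReal.ofReal_mul (by norm_num), ofReal_norm]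
    norm_num; ring
  · refine (eH_le_mul (C := 4) (b := φ₁) (s' := s - 1) fun n => le_of_eq ?_).trans_lt
      (ENNReal.mul_lt_top (by norm_num) h₁)
    have hb := bracket_pos n
    rw [← ofReal_norm, Complex.norm_real, Real.norm_of_nonneg (by positivity),
      ENNReal.ofReal_mul (by positivity), ofReal_norm, ENNReal.ofReal_mul (by norm_num),
      sub_eq_add_neg, Real.rpow_add hb, ENNReal.ofReal_mul (by positivity)]
    norm_num; ring

theorem norm_propV_le {t : ℝ} (ht : 0 ≤ t) (ht1 : t ≤ 1) (φ₀ φ₁ : Dist) (n : Freq) :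
    ‖propV t φ₀ φ₁ n‖ ≤ decay n t * majorantV φ₀ φ₁ n := by
  refine (norm_add_le _ _).trans ?_
  rw [propS, norm_mul, norm_mul, Complex.norm_real, Complex.norm_real, majorantV, mul_add]
  refine add_le_add ?_ ?_
  · calc _ ≤ (4 * decay n t) * ‖φ₀ n‖ := by gcongr; exact abs_symbolC_le n ht ht1
      _ = _ := by ring
  · calc _ ≤ (4 * bracket n ^ (-1 : ℝ) * decay n t) * ‖φ₁ n‖ := by
          gcongr; exact abs_symbolS_le n ht ht1
      _ = _ := by ring

theorem norm_propVderiv_le {t : ℝ} (ht : 0 ≤ t) (ht1 : t ≤ 1) (φ₀ φ₁ : Dist) (n : Freq) :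
    ‖propVderiv t φ₀ φ₁ n‖ ≤ bracket n * majorantV φ₀ φ₁ n := by
  have hb := bracket_pos n
  have hd := decay_le_one n ht
  have hd0 := decay_pos n t
  refine (norm_add_le _ _).trans ?_
  rw [norm_mul, norm_mul, Complex.norm_real, Complex.norm_real, majorantV, mul_add, norm_neg,
    norm_mul, Real.norm_of_nonneg (by positivity : 0 ≤ bracket n ^ 2)]
  refine add_le_add ?_ ?_
  · calc _ ≤ bracket n ^ 2 * (4 * bracket n ^ (-1 : ℝ) * 1) * ‖φ₀ n‖ := by
          gcongr
          exact (abs_symbolS_le n ht ht1).trans (by gcongr)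
      _ = _ := by rw [Real.rpow_neg_one]; field_simp
  · calc _ ≤ (4 * 1) * ‖φ₁ n‖ := by
          gcongr
          exact (abs_symbolD_le n ht ht1).trans (by gcongr)
      _ = _ := by rw [Real.rpow_neg_one]; field_simp

theorem continuousInSobolev_propV {s T : ℝ} (hT : T ≤ 1) {φ₀ φ₁ : Dist} (h₀ : eH s φ₀ < ∞)
    (h₁ : eH (s - 1) φ₁ < ∞) : ContinuousInSobolev s T fun t => propV t φ₀ φ₁ := by
  refine continuousInSobolev_of_dominated (g := majorantV φ₀ φ₁)
    (fun n => fun t _ => (hasDerivAt_propV t φ₀ φ₁ n).continuousAt.continuousWithinAt)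
    (eH_majorantV_lt_top h₀ h₁) fun t ht n => ?_
  exact (norm_propV_le ht.1 (ht.2.trans hT) φ₀ φ₁ n).trans
    (mul_le_of_le_one_left (majorantV_nonneg _ _ _) (decay_le_one n ht.1))

theorem continuousInSobolev_propVderiv {s T : ℝ} (hT : T ≤ 1) {φ₀ φ₁ : Dist} (h₀ : eH s φ₀ < ∞)
    (h₁ : eH (s - 1) φ₁ < ∞) : ContinuousInSobolev (s - 1) T fun t => propVderiv t φ₀ φ₁ := by
  refine continuousInSobolev_of_dominated (g := fun n => bracket n * majorantV φ₀ φ₁ n)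
    (fun n => ?_) ?_ fun t ht n => norm_propVderiv_le ht.1 (ht.2.trans hT) φ₀ φ₁ n
  · have h1 : Continuous fun x => symbolS x n := by unfold symbolS; fun_prop
    have h2 : Continuous fun x => symbolD x n := by unfold symbolD; fun_prop
    unfold propVderiv
    fun_prop
  · refine (eH_le_mul (C := 1) (s' := s) (b := fun n => (majorantV φ₀ φ₁ n : ℂ))
      fun n => le_of_eq ?_).trans_lt (by rw [one_mul]; exact eH_majorantV_lt_top h₀ h₁)
    have hb := bracket_pos n
    have hm := majorantV_nonneg φ₀ φ₁ n
    rw [← ofReal_norm, ← ofReal_norm, Complex.norm_real, Complex.norm_real,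
      Real.norm_of_nonneg (by positivity), Real.norm_of_nonneg hm, one_mul,
      ← ENNReal.ofReal_mul (by positivity), ← ENNReal.ofReal_mul (by positivity), ← mul_assoc]
    congr 2
    rw [Real.rpow_sub_one hb.ne']; field_simp

theorem strichartz_propV {q : ℝ} (hq : 2 ≤ q) (b : ℝ) {T : ℝ} (hT : T ≤ 1) (φ₀ φ₁ : Dist) :
    (∫⁻ t in Icc 0 T, eH b (propV t φ₀ φ₁) ^ q) ^ (1 / q)
      ≤ eH (b - 1 / q) (fun n => (majorantV φ₀ φ₁ n : ℂ)) := by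
  refine le_trans (ENNReal.rpow_le_rpow ?_ (by positivity)) (strichartz_decay hq b _)
  calc _ ≤ ∫⁻ t in Icc 0 T, eH b (fun n => (decay n t : ℂ) * (majorantV φ₀ φ₁ n : ℂ)) ^ q := by
        refine setLIntegral_mono' measurableSet_Icc fun t ht => ENNReal.rpow_le_rpow
          (eH_mono le_rfl fun n => ?_) (by linarith)
        rw [← ofReal_norm, ← ofReal_norm, ← Complex.ofReal_mul, Complex.norm_real,
          Real.norm_of_nonneg (mul_nonneg (decay_pos n t).le (majorantV_nonneg _ _ _))]
        exact ENNReal.ofReal_le_ofReal (norm_propV_le ht.1 (ht.2.trans hT) φ₀ φ₁ n)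
    _ ≤ _ := lintegral_mono_set fun t ht => ht.1

/-! ### The power nonlinearity -/

theorem powerNonlin_zero (p : ℝ) : powerNonlin p 0 = 0 := by simp [powerNonlin]

theorem continuous_powerNonlin {p : ℝ} (hp : 1 < p) : Continuous (powerNonlin p) := by
  unfold powerNonlin
  exact (Complex.continuous_ofReal.comp
    (continuous_norm.rpow_const fun _ => Or.inr (by linarith))).mul continuous_id

theorem norm_powerNonlin {p : ℝ} (hp : 1 < p) (z : ℂ) : ‖powerNonlin p z‖ = ‖z‖ ^ p := by
  rw [powerNonlin, norm_mul, Complex.norm_real, Real.norm_of_nonneg (by positivity)]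
  rcases eq_or_ne z 0 with rfl | hz
  · simp [Real.zero_rpow (by linarith : p ≠ 0)]
  · have := norm_pos_iff.2 hz
    rw [Real.rpow_sub_one this.ne']; field_simp

theorem rpow_sub_rpow_mul_le {m x y : ℝ} (hm : 0 < m) (hx : 0 < x) (hy : 0 ≤ y) (hyx : y ≤ x) :
    (x ^ m - y ^ m) * y ≤ (m + 1) * (x ^ m * (x - y)) := by
  set θ := y / x
  have hθ0 : 0 ≤ θ := by positivity
  have hθ1 : θ ≤ 1 := div_le_one_of_le₀ hyx hx.le
  have hy' : y = x * θ := by simp only [θ]; field_simp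
  have h : 1 - θ ^ m ≤ (m + 1) * (1 - θ) := by
    rcases le_total 1 m with h1 | h1
    · have := one_add_mul_self_le_rpow_one_add (s := θ - 1) (by linarith) h1
      rw [add_sub_cancel] at this
      nlinarith
    · have := Real.rpow_le_rpow_of_exponent_ge' hθ0 hθ1 hm.le h1
      rw [Real.rpow_one] at this
      nlinarith
  have hpos : 0 < x ^ m := by positivity
  rw [hy', Real.mul_rpow hx.le hθ0]
  have e : (x ^ m - x ^ m * θ ^ m) * (x * θ) = x ^ m * x * ((1 - θ ^ m) * θ) := by ring
  have e2 : (m + 1) * (x ^ m * (x - x * θ)) = x ^ m * x * ((m + 1) * (1 - θ)) := by ring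
  rw [e, e2]
  have h2 : (1 - θ ^ m) * θ ≤ (m + 1) * (1 - θ) := by
    have h3 : 0 ≤ 1 - θ ^ m := sub_nonneg.2 (Real.rpow_le_one hθ0 hθ1 hm.le)
    exact (mul_le_of_le_one_right h3 hθ1).trans h
  gcongr

/-- The nonlinearity is locally Lipschitz, with constant of the order `(|a| + |b|)^{p-1}`; this needs
no smoothness at the origin. -/
theorem norm_powerNonlin_sub_le {p : ℝ} (hp : 1 < p) (a b : ℂ) :
    ‖powerNonlin p a - powerNonlin p b‖ ≤ (p + 1) * (‖a - b‖ * (‖a‖ + ‖b‖) ^ (p - 1)) := by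
  wlog h : ‖b‖ ≤ ‖a‖ generalizing a b
  · have := this b a (not_le.1 h).le
    rwa [norm_sub_rev, norm_sub_rev b a, add_comm ‖b‖] at this
  rcases eq_or_ne a 0 with rfl | ha
  · have hb : b = 0 := by simpa using h
    subst hb
    rw [sub_self, norm_zero]
    have : 0 ≤ p + 1 := by linarith
    positivity
  have ha' := norm_pos_iff.2 ha
  have e : powerNonlin p a - powerNonlin p b = ((‖a‖ ^ (p - 1) : ℝ) : ℂ) * (a - b)
      + ((‖a‖ ^ (p - 1) - ‖b‖ ^ (p - 1) : ℝ) : ℂ) * b := by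
    simp only [powerNonlin]; push_cast; ring
  have h1 := rpow_sub_rpow_mul_le (m := p - 1) (by linarith) ha' (norm_nonneg b) h
  have h2 : ‖b‖ ^ (p - 1) ≤ ‖a‖ ^ (p - 1) :=
    Real.rpow_le_rpow (norm_nonneg _) h (by linarith)
  have h3 : ‖a‖ - ‖b‖ ≤ ‖a - b‖ := norm_sub_norm_le a b
  rw [e]
  calc _ ≤ ‖a‖ ^ (p - 1) * ‖a - b‖ + (‖a‖ ^ (p - 1) - ‖b‖ ^ (p - 1)) * ‖b‖ := by
        refine (norm_add_le _ _).trans (le_of_eq ?_)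
        rw [norm_mul, norm_mul, Complex.norm_real, Complex.norm_real,
          Real.norm_of_nonneg (by positivity), Real.norm_of_nonneg (by linarith)]
    _ ≤ ‖a‖ ^ (p - 1) * ‖a - b‖ + (p - 1 + 1) * (‖a‖ ^ (p - 1) * ‖a - b‖) := by
        refine add_le_add le_rfl (h1.trans ?_)
        have : 0 < p - 1 + 1 := by linarith
        gcongr
    _ = (p + 1) * (‖a - b‖ * ‖a‖ ^ (p - 1)) := by ring
    _ ≤ _ := by
        have h4 : ‖a‖ ≤ ‖a‖ + ‖b‖ := by linarith [norm_nonneg b]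
        have : 0 < p + 1 := by linarith
        have : 0 ≤ p - 1 := by linarith
        gcongr

section Holder

variable {α : Type*} [MeasurableSpace α] {ν : Measure α}

/-- Hölder's inequality for a product of a function and the `p - 1`-st power of another one. -/
theorem lintegral_mul_rpow_le {p : ℝ} (hp : 1 < p) {f g : α → ℝ≥0∞} (hf : AEMeasurable f ν)
    (hg : AEMeasurable g ν) :
    ∫⁻ x, f x * g x ^ (p - 1) ∂ν
      ≤ (∫⁻ x, f x ^ p ∂ν) ^ (1 / p) * (∫⁻ x, g x ^ p ∂ν) ^ ((p - 1) / p) := by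
  have hpq : p.HolderConjugate p.conjExponent := .conjExponent hp
  have h := ENNReal.lintegral_mul_le_Lp_mul_Lq ν hpq hf (hg.pow_const (p - 1))
  have hp1 : 0 < p - 1 := by linarith
  simp only [Real.conjExponent, ← ENNReal.rpow_mul, mul_div_cancel₀ _ hp1.ne', one_div_div] at h
  exact h

theorem lintegral_rpow_mono_exp {p q : ℝ} (hp : 0 < p) (hpq : p ≤ q) (hν : ν univ ≤ 1)
    {f : α → ℝ≥0∞} (hf : AEMeasurable f ν) :
    (∫⁻ x, f x ^ p ∂ν) ^ (1 / p) ≤ (∫⁻ x, f x ^ q ∂ν) ^ (1 / q) := by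
  have h := eLpNorm'_le_eLpNorm'_mul_rpow_measure_univ (μ := ν) (f := f) hp hpq
    hf.aestronglyMeasurable
  simp only [eLpNorm', enorm_eq_self] at h
  refine h.trans (mul_le_of_le_one_right' ?_)
  exact ENNReal.rpow_le_one hν (by
    rw [sub_nonneg]; exact one_div_le_one_div_of_le hp hpq)

end Holder

/-- Hölder's inequality in the space variable for the nonlinearity. -/
theorem eLpNorm_powerNonlin_sub_le {p r : ℝ} (hp : 1 < p) (hr : 0 < r) {f g : Torus → ℂ}
    (hf : AEStronglyMeasurable f torusMeasure) (hg : AEStronglyMeasurable g torusMeasure)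
    (hr1 : 1 ≤ r) :
    eLpNorm (fun x => powerNonlin p (f x) - powerNonlin p (g x)) (ENNReal.ofReal (r / p))
        torusMeasure
      ≤ ENNReal.ofReal (p + 1) * (eLpNorm (f - g) (ENNReal.ofReal r) torusMeasure *
        (eLpNorm f (ENNReal.ofReal r) torusMeasure + eLpNorm g (ENNReal.ofReal r) torusMeasure)
          ^ (p - 1)) := by
  have hp0 : 0 < p := by linarith
  have hp1 : 0 < p - 1 := by linarith
  have hrp : 0 < r / p := by positivity
  have hform : ∀ h : Torus → ℂ, eLpNorm h (ENNReal.ofReal r) torusMeasure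
      = (∫⁻ x, ‖h x‖ₑ ^ r ∂torusMeasure) ^ (1 / r) := fun h => by
    rw [eLpNorm_eq_lintegral_rpow_enorm_toReal (by simpa using hr) ENNReal.ofReal_ne_top,
      ENNReal.toReal_ofReal hr.le]
  have hadd : (∫⁻ x, (‖f x‖ₑ + ‖g x‖ₑ) ^ r ∂torusMeasure) ^ (1 / r)
      ≤ eLpNorm f (ENNReal.ofReal r) torusMeasure + eLpNorm g (ENNReal.ofReal r) torusMeasure := by
    rw [hform, hform]
    exact ENNReal.lintegral_Lp_add_le hf.enorm hg.enorm hr1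
  have hpt : ∀ x, ‖powerNonlin p (f x) - powerNonlin p (g x)‖ₑ
      ≤ ENNReal.ofReal (p + 1) * (‖(f - g) x‖ₑ * (‖f x‖ₑ + ‖g x‖ₑ) ^ (p - 1)) := fun x => by
    have h := norm_powerNonlin_sub_le hp (f x) (g x)
    rw [← ofReal_norm, ← ofReal_norm, ← ofReal_norm (f x), ← ofReal_norm (g x),
      ← ENNReal.ofReal_add (norm_nonneg _) (norm_nonneg _),
      ENNReal.ofReal_rpow_of_nonneg (by positivity) hp1.le, ← ENNReal.ofReal_mul (norm_nonneg _),
      ← ENNReal.ofReal_mul (by positivity)]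
    exact ENNReal.ofReal_le_ofReal h
  set H : Torus → ℝ≥0∞ := fun x => ‖(f - g) x‖ₑ ^ (r / p) * ((‖f x‖ₑ + ‖g x‖ₑ) ^ (r / p)) ^ (p - 1)
  have hH := lintegral_mul_rpow_le (ν := torusMeasure) hp
    (f := fun x => ‖(f - g) x‖ₑ ^ (r / p)) (g := fun x => (‖f x‖ₑ + ‖g x‖ₑ) ^ (r / p))
    ((hf.sub hg).enorm.pow_const _) ((hf.enorm.add hg.enorm).pow_const _)
  simp only [← ENNReal.rpow_mul] at hH
  rw [div_mul_cancel₀ _ hp0.ne'] at hH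
  rw [eLpNorm_eq_lintegral_rpow_enorm_toReal (by simpa using hrp) ENNReal.ofReal_ne_top,
    ENNReal.toReal_ofReal hrp.le]
  calc _ ≤ (∫⁻ x, ENNReal.ofReal (p + 1) ^ (r / p) * (‖(f - g) x‖ₑ ^ (r / p) *
        (‖f x‖ₑ + ‖g x‖ₑ) ^ (r / p * (p - 1))) ∂torusMeasure) ^ (1 / (r / p)) := by
        refine ENNReal.rpow_le_rpow (lintegral_mono fun x => ?_) (by positivity)
        refine (ENNReal.rpow_le_rpow (hpt x) hrp.le).trans (le_of_eq ?_)
        rw [ENNReal.mul_rpow_of_nonneg _ _ hrp.le, ENNReal.mul_rpow_of_nonneg _ _ hrp.le,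
          ← ENNReal.rpow_mul, mul_comm (p - 1)]
    _ ≤ (ENNReal.ofReal (p + 1) ^ (r / p) * ((∫⁻ x, ‖(f - g) x‖ₑ ^ r ∂torusMeasure) ^ (1 / p) *
          (∫⁻ x, (‖f x‖ₑ + ‖g x‖ₑ) ^ r ∂torusMeasure) ^ ((p - 1) / p))) ^ (1 / (r / p)) := by
        refine ENNReal.rpow_le_rpow ?_ (by positivity)
        rw [lintegral_const_mul' _ _ (ENNReal.rpow_ne_top_of_nonneg hrp.le ENNReal.ofReal_ne_top)]
        exact mul_le_mul_right hH _
    _ = ENNReal.ofReal (p + 1) * ((∫⁻ x, ‖(f - g) x‖ₑ ^ r ∂torusMeasure) ^ (1 / r) *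
          ((∫⁻ x, (‖f x‖ₑ + ‖g x‖ₑ) ^ r ∂torusMeasure) ^ (1 / r)) ^ (p - 1)) := by
        rw [ENNReal.mul_rpow_of_nonneg _ _ (by positivity),
          ENNReal.mul_rpow_of_nonneg _ _ (by positivity), ← ENNReal.rpow_mul, ← ENNReal.rpow_mul,
          ← ENNReal.rpow_mul, ← ENNReal.rpow_mul, mul_one_div_cancel hrp.ne', ENNReal.rpow_one,
          show 1 / p * (1 / (r / p)) = 1 / r by field_simp,
          show (p - 1) / p * (1 / (r / p)) = 1 / r * (p - 1) by field_simp]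
    _ ≤ _ := by
        rw [hform (f - g)]
        gcongr

/-! ### Measurability in time along continuous paths in `L²` -/

/-- Bounded continuous functions of an `L²` function depend weakly continuously on it, which gives
measurability in time of unbounded ones by truncation. -/
theorem continuous_integral_comp {φ : ℂ → ℂ} (hφ : Continuous φ) {M : ℝ} (hM : ∀ z, ‖φ z‖ ≤ M)
    (e : C(Torus, ℂ)) : Continuous fun f : L2 => ∫ x, e x * φ (f x) ∂torusMeasure := by
  refine continuous_iff_seqContinuous.2 fun f f₀ hf => ?_
  refine tendsto_of_subseq_tendsto fun ns hns => ?_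
  have h1 : TendstoInMeasure torusMeasure (fun k => (f (ns k) : Torus → ℂ)) atTop f₀ :=
    tendstoInMeasure_of_tendsto_Lp (hf.comp hns)
  obtain ⟨ms, -, hms⟩ := h1.exists_seq_tendsto_ae
  refine ⟨ms, tendsto_integral_of_dominated_convergence (fun _ => ‖e‖ * M) ?_
    (integrable_const _) ?_ ?_⟩
  · intro k
    exact e.continuous.aestronglyMeasurable.mul
      (hφ.comp_aestronglyMeasurable (Lp.aestronglyMeasurable _))
  · intro k
    refine Eventually.of_forall fun x => ?_
    rw [norm_mul]
    exact mul_le_mul (e.norm_coe_le_norm x) (hM _) (norm_nonneg _) (norm_nonneg _)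
  · filter_upwards [hms] with x hx
    exact (((hφ.tendsto _).comp hx)).const_mul _

theorem aemeasurable_eLpNorm {T r : ℝ} (hr : 0 < r) {u : ℝ → L2} (hu : ContinuousOn u (Icc 0 T)) :
    AEMeasurable (fun t => eLpNorm (u t) (ENNReal.ofReal r) torusMeasure)
      (volume.restrict (Icc 0 T)) := by
  have e : ∀ t, eLpNorm (u t) (ENNReal.ofReal r) torusMeasure
      = (∫⁻ x, ENNReal.ofReal (‖u t x‖ ^ r) ∂torusMeasure) ^ (1 / r) := fun t => by
    rw [eLpNorm_eq_lintegral_rpow_enorm_toReal (by simpa using hr) ENNReal.ofReal_ne_top,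
      ENNReal.toReal_ofReal hr.le]
    congr 1
    refine lintegral_congr fun x => ?_
    rw [← ofReal_norm, ENNReal.ofReal_rpow_of_nonneg (norm_nonneg _) hr.le]
  simp only [e]
  refine AEMeasurable.pow_const ?_ _
  -- truncate `|z|^r` at the level `k`
  set φ : ℕ → ℂ → ℂ := fun k z => ((min (‖z‖ ^ r) k : ℝ) : ℂ)
  have hφ : ∀ k, Continuous (φ k) := fun k => Complex.continuous_ofReal.comp
    ((continuous_norm.rpow_const fun _ => Or.inr hr.le).min continuous_const)
  have hφn : ∀ k z, ‖φ k z‖ ≤ k := fun k z => by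
    simp only [φ]
    rw [Complex.norm_real, Real.norm_of_nonneg (le_min (by positivity) (Nat.cast_nonneg k))]
    exact min_le_right _ _
  have hcont : ∀ k, ContinuousOn (fun t => ∫ x, (1 : C(Torus, ℂ)) x * φ k (u t x) ∂torusMeasure)
      (Icc 0 T) := fun k => (continuous_integral_comp (hφ k) (hφn k) 1).comp_continuousOn hu
  refine aemeasurable_of_tendsto_metrizable_ae atTop
    (f := fun (k : ℕ) t => ENNReal.ofReal
      (∫ x, (1 : C(Torus, ℂ)) x * φ k (u t x) ∂torusMeasure).re) (fun k => ?_) ?_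
  · exact ENNReal.measurable_ofReal.comp_aemeasurable
      (Complex.measurable_re.comp_aemeasurable ((hcont k).aemeasurable measurableSet_Icc))
  · refine Eventually.of_forall fun t => ?_
    have e2 : ∀ k : ℕ, ENNReal.ofReal
        (∫ x, (1 : C(Torus, ℂ)) x * φ k (u t x) ∂torusMeasure).re
        = ∫⁻ x, ENNReal.ofReal (min (‖u t x‖ ^ r) k) ∂torusMeasure := fun k => by
      have h1 : ∫ x, (1 : C(Torus, ℂ)) x * φ k (u t x) ∂torusMeasure
          = ((∫ x, min (‖u t x‖ ^ r) k ∂torusMeasure : ℝ) : ℂ) := by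
        rw [← integral_complex_ofReal]
        simp [φ]
      rw [h1, Complex.ofReal_re, ofReal_integral_eq_lintegral_ofReal]
      · refine Integrable.of_bound (C := k) ?_ ?_
        · exact (((continuous_norm.rpow_const fun _ => Or.inr hr.le).min
            continuous_const).comp_aestronglyMeasurable (Lp.aestronglyMeasurable (u t)))
        · refine Eventually.of_forall fun x => ?_
          rw [Real.norm_of_nonneg (le_min (by positivity) (Nat.cast_nonneg k))]
          exact min_le_right _ _
      · exact Eventually.of_forall fun x => le_min (by positivity) (Nat.cast_nonneg k)
    simp only [e2]
    refine lintegral_tendsto_of_tendsto_of_monotone (fun k => ?_) ?_ ?_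
    · exact ENNReal.measurable_ofReal.comp_aemeasurable
        (((Lp.aestronglyMeasurable (u t)).norm.aemeasurable.pow_const r).min aemeasurable_const)
    · refine Eventually.of_forall fun x k l hkl => ENNReal.ofReal_le_ofReal ?_
      exact min_le_min_left _ (by exact_mod_cast hkl)
    · refine Eventually.of_forall fun x => ENNReal.tendsto_ofReal ?_
      refine tendsto_const_nhds.congr' ?_
      filter_upwards [eventually_ge_atTop ⌈‖u t x‖ ^ r⌉₊] with k hk
      exact (min_eq_left ((Nat.le_ceil _).trans (by exact_mod_cast hk))).symm

/-- The Fourier coefficients of the nonlinearity along a path. -/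
def source (p : ℝ) (u : ℝ → L2) (t : ℝ) : Dist := coeffs fun x => powerNonlin p (u t x)

theorem aemeasurable_source {p T : ℝ} (hp : 1 < p) {u : ℝ → L2} (hu : ContinuousOn u (Icc 0 T))
    (hint : ∀ᵐ t ∂volume.restrict (Icc 0 T),
      Integrable (fun x => powerNonlin p (u t x)) torusMeasure) (n : Freq) :
    AEMeasurable (fun t => source p u t n) (volume.restrict (Icc 0 T)) := by
  have hN := continuous_powerNonlin hp
  -- damp the nonlinearity where it exceeds the level `k`
  set φ : ℕ → ℂ → ℂ := fun k z =>
    (((k + 1 : ℝ) / (k + 1 + ‖powerNonlin p z‖) : ℝ) : ℂ) * powerNonlin p z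
  have hden : ∀ (k : ℕ) z, 0 < (k + 1 + ‖powerNonlin p z‖ : ℝ) := fun k z => by positivity
  have hφ : ∀ k, Continuous (φ k) := fun k => (Complex.continuous_ofReal.comp
    (continuous_const.div (continuous_const.add hN.norm) fun z => (hden k z).ne')).mul hN
  have hφn : ∀ k z, ‖φ k z‖ = (k + 1 : ℝ) / (k + 1 + ‖powerNonlin p z‖) * ‖powerNonlin p z‖ :=
    fun k z => by
      simp only [φ]
      rw [norm_mul, Complex.norm_real, Real.norm_of_nonneg (by positivity)]
  have hφ1 : ∀ k z, ‖φ k z‖ ≤ k + 1 := fun k z => by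
    rw [hφn, div_mul_eq_mul_div, div_le_iff₀ (hden k z)]
    have : (0 : ℝ) ≤ k + 1 := by positivity
    nlinarith
  have hφ2 : ∀ k z, ‖φ k z‖ ≤ ‖powerNonlin p z‖ := fun k z => by
    rw [hφn]
    refine mul_le_of_le_one_left (norm_nonneg _) ?_
    rw [div_le_one (hden k z)]
    linarith [norm_nonneg (powerNonlin p z)]
  have hcont : ∀ k, ContinuousOn (fun t => ∫ x, UnitAddTorus.mFourier (-n) x * φ k (u t x)
      ∂torusMeasure) (Icc 0 T) := fun k =>
    (continuous_integral_comp (hφ k) (hφ1 k) _).comp_continuousOn hu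
  refine aemeasurable_of_tendsto_metrizable_ae atTop
    (fun k => (hcont k).aemeasurable measurableSet_Icc) ?_
  filter_upwards [hint] with t ht
  rw [source, coeffs_eq]
  refine tendsto_integral_of_dominated_convergence (fun x => ‖powerNonlin p (u t x)‖) ?_ ht.norm
    ?_ ?_
  · exact fun k => (UnitAddTorus.mFourier (-n)).continuous.aestronglyMeasurable.mul
      ((hφ k).comp_aestronglyMeasurable (Lp.aestronglyMeasurable _))
  · refine fun k => Eventually.of_forall fun x => ?_
    rw [norm_mul, mFourier_norm_apply, one_mul]
    exact hφ2 k _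
  · refine Eventually.of_forall fun x => Tendsto.const_mul _ ?_
    have h1 : Tendsto (fun k : ℕ => (k + 1 : ℝ) / (k + 1 + ‖powerNonlin p (u t x)‖)) atTop
        (𝓝 1) := by
      have h2 := tendsto_natCast_div_add_atTop (𝕜 := ℝ) ‖powerNonlin p (u t x)‖
      have h3 := h2.comp (tendsto_add_atTop_nat 1)
      refine h3.congr fun k => ?_
      simp [Function.comp]
    have h4 := ((Complex.continuous_ofReal.tendsto _).comp h1).mul_const (powerNonlin p (u t x))
    simpa [φ] using h4

section

/-! ### Space-time norms and the estimate of the nonlinearity -/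

/-- The relations between the exponents under which the Duhamel map is a contraction in
`L^q_t L^r_x` for data in `H^s × H^{s-1}`: `strichartz` places the evolution of the data in
`L^q_t L^r_x`, and `dual` places `L^{r/p}`, hence the nonlinearity, in `H^{s-1}`. -/
structure Admissible (p s q r : ℝ) : Prop where
  one_lt_p : 1 < p
  s_nonneg : 0 ≤ s
  two_le_q : 2 ≤ q
  p_le_q : p ≤ q
  two_lt_r : 2 < r
  p_lt_r : p < r
  r_le : r ≤ 2 * p
  strichartz : 1 - 2 / r ≤ s + 1 / q
  dual : 2 * p / r - 1 ≤ 1 - s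

/-- The norm of `L^q(ν; L^r(𝕋²))`, for a measure `ν` on the time axis. -/
def timeNorm (q r : ℝ) (ν : Measure ℝ) (u : ℝ → L2) : ℝ≥0∞ :=
  (∫⁻ t, eLpNorm (u t) (ENNReal.ofReal r) torusMeasure ^ q ∂ν) ^ (1 / q)

theorem timeNorm_mono {q r : ℝ} (hq : 0 < q) {ν ν' : Measure ℝ} (h : ν ≤ ν') (u : ℝ → L2) :
    timeNorm q r ν u ≤ timeNorm q r ν' u :=
  ENNReal.rpow_le_rpow (lintegral_mono' h le_rfl) (by positivity)

theorem memLqLr_iff {q r T : ℝ} (hq : 0 < q) {u : ℝ → L2} :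
    MemLqLr q r T u ↔ timeNorm q r (volume.restrict (Icc 0 T)) u < ∞ := by
  rw [timeNorm, ENNReal.rpow_lt_top_iff_of_pos (by positivity)]; rfl

variable {p s q r : ℝ}

theorem timeNorm_toL2_le (h : Admissible p s q r) : ∃ C : NNReal, ∀ (T : ℝ) (a : ℝ → Dist),
    (∀ t ∈ Icc 0 T, eH 0 (a t) < ∞) → timeNorm q r (volume.restrict (Icc 0 T)) (fun t => toL2 (a t))
      ≤ C * (∫⁻ t in Icc 0 T, eH (1 - 2 / r) (a t) ^ q) ^ (1 / q) := by
  obtain ⟨C, hC⟩ := sobolev_embedding h.two_lt_r.le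
  have hq : 0 < q := by linarith [h.two_le_q]
  refine ⟨C, fun T a ha => ?_⟩
  calc _ ≤ (∫⁻ t in Icc 0 T, (C : ℝ≥0∞) ^ q * eH (1 - 2 / r) (a t) ^ q) ^ (1 / q) := by
        refine ENNReal.rpow_le_rpow (setLIntegral_mono' measurableSet_Icc fun t ht => ?_)
          (by positivity)
        rw [← ENNReal.mul_rpow_of_nonneg _ _ hq.le]
        refine ENNReal.rpow_le_rpow ?_ hq.le
        have := hC (toL2 (a t))
        rwa [coeffs_toL2 (ha t ht)] at this
    _ = _ := by
        rw [lintegral_const_mul' _ _ (ENNReal.rpow_ne_top_of_nonneg hq.le ENNReal.coe_ne_top),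
          ENNReal.mul_rpow_of_nonneg _ _ (by positivity), ← ENNReal.rpow_mul,
          mul_one_div_cancel hq.ne', ENNReal.rpow_one]

theorem eH_zero_causalConv_lt_top {T t : ℝ} (hs : 0 ≤ s) (ht : t ≤ 1) {F : ℝ → Dist}
    (hF : IsSource (s - 1) T F) : eH 0 (causalConv kerS T F t) < ∞ := by
  have h := eH_causalConv_le isCausal_kerS (σ := s - 1) hF.aemeasurable ht
  rw [sub_add_cancel] at h
  exact ((eH_mono_exp hs _).trans h).trans_lt
    (ENNReal.mul_lt_top (by norm_num) hF.lintegral_lt_top)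

/-- The Duhamel operator maps `L¹_t H^{s-1}` to `L^q_t L^r_x`. -/
theorem timeNorm_causalConv_le (h : Admissible p s q r) : ∃ C : NNReal, ∀ (T : ℝ) (F : ℝ → Dist),
    T ≤ 1 → IsSource (s - 1) T F →
      timeNorm q r (volume.restrict (Icc 0 T)) (fun t => toL2 (causalConv kerS T F t))
        ≤ C * ∫⁻ τ in Icc 0 T, eH (s - 1) (F τ) := by
  obtain ⟨C, hC⟩ := timeNorm_toL2_le h
  refine ⟨C * 4, fun T F hT hF => (hC T _ fun t ht =>
    eH_zero_causalConv_lt_top h.s_nonneg (ht.2.trans hT) hF).trans ?_⟩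
  rw [ENNReal.coe_mul, mul_assoc]
  refine mul_le_mul_right ((strichartz_causalConv isCausal_kerS h.two_le_q _ hT
    hF.aemeasurable).trans ?_) _
  refine mul_le_mul_right (lintegral_mono fun τ => eH_mono_exp ?_ _) _
  linarith [h.strichartz]

theorem timeNorm_propV_lt_top (h : Admissible p s q r) {φ₀ φ₁ : Dist} (h₀ : eH s φ₀ < ∞)
    (h₁ : eH (s - 1) φ₁ < ∞) :
    timeNorm q r (volume.restrict (Icc 0 1)) (fun t => toL2 (propV t φ₀ φ₁)) < ∞ := by
  obtain ⟨C, hC⟩ := timeNorm_toL2_le h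
  have hc := continuousInSobolev_iff.1 (continuousInSobolev_propV le_rfl h₀ h₁)
  refine (hC 1 _ fun t ht => (eH_mono_exp h.s_nonneg _).trans_lt (hc.1 t ht)).trans_lt
    (ENNReal.mul_lt_top ENNReal.coe_lt_top ?_)
  refine ((strichartz_propV h.two_le_q _ le_rfl φ₀ φ₁).trans
    (eH_mono_exp (s' := s) (by linarith [h.strichartz]) _)).trans_lt ?_
  exact eH_majorantV_lt_top h₀ h₁

theorem memLp_powerNonlin (h : Admissible p s q r) {f : L2}
    (hf : eLpNorm f (ENNReal.ofReal r) torusMeasure < ∞) :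
    MemLp (fun x => powerNonlin p (f x)) (ENNReal.ofReal (r / p)) torusMeasure := by
  have hp := h.one_lt_p
  refine ⟨(continuous_powerNonlin hp).comp_aestronglyMeasurable (Lp.aestronglyMeasurable f), ?_⟩
  have h1 := eLpNorm_powerNonlin_sub_le hp (by linarith [h.two_lt_r] : 0 < r)
    (Lp.aestronglyMeasurable f) (g := 0) aestronglyMeasurable_zero (by linarith [h.two_lt_r])
  simp only [Pi.zero_apply, powerNonlin_zero, sub_zero] at h1
  refine h1.trans_lt (ENNReal.mul_lt_top ENNReal.ofReal_lt_top (ENNReal.mul_lt_top hf ?_))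
  refine ENNReal.rpow_lt_top_of_nonneg (by linarith) ?_
  simpa using hf.ne

theorem integrable_powerNonlin (h : Admissible p s q r) {f : L2}
    (hf : eLpNorm f (ENNReal.ofReal r) torusMeasure < ∞) :
    Integrable (fun x => powerNonlin p (f x)) torusMeasure := by
  refine (memLp_powerNonlin h hf).integrable ?_
  rw [← ENNReal.ofReal_one]
  refine ENNReal.ofReal_le_ofReal ?_
  rw [le_div_iff₀ (by linarith [h.one_lt_p])]
  linarith [h.p_lt_r]

theorem coeffs_sub_fun {f g : Torus → ℂ} (hf : Integrable f torusMeasure)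
    (hg : Integrable g torusMeasure) : coeffs f - coeffs g = coeffs fun x => f x - g x := by
  funext n
  have hm : ∀ {h : Torus → ℂ}, Integrable h torusMeasure →
      Integrable (fun x => UnitAddTorus.mFourier (-n) x * h x) torusMeasure := fun hh =>
    hh.bdd_mul (c := 1) (UnitAddTorus.mFourier (-n)).continuous.aestronglyMeasurable
      (Eventually.of_forall fun x => (mFourier_norm_apply _ _).le)
  simp only [Pi.sub_apply, coeffs_eq, mul_sub]
  exact (integral_sub (hm hf) (hm hg)).symm

/-- The nonlinearity is locally Lipschitz from `L^r` to `H^{s-1}`. -/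
theorem eH_nonlin_sub_le (h : Admissible p s q r) : ∃ C : NNReal, ∀ f g : L2,
    eLpNorm f (ENNReal.ofReal r) torusMeasure < ∞ → eLpNorm g (ENNReal.ofReal r) torusMeasure < ∞ →
    eH (s - 1) (coeffs (fun x => powerNonlin p (f x)) - coeffs fun x => powerNonlin p (g x))
      ≤ C * (eLpNorm (f - g : L2) (ENNReal.ofReal r) torusMeasure *
        (eLpNorm f (ENNReal.ofReal r) torusMeasure + eLpNorm g (ENNReal.ofReal r) torusMeasure)
          ^ (p - 1)) := by
  have hp := h.one_lt_p
  have hp0 : 0 < p := by linarith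
  have hr0 : 0 < r := by linarith [h.two_lt_r]
  obtain ⟨C, hC⟩ := sobolev_embedding_dual (ρ := r / p)
    (by rw [one_lt_div hp0]; exact h.p_lt_r) (by rw [div_le_iff₀ hp0]; exact h.r_le)
  refine ⟨C * (p + 1).toNNReal, fun f g hf hg => ?_⟩
  rw [coeffs_sub_fun (integrable_powerNonlin h hf) (integrable_powerNonlin h hg)]
  have hexp : s - 1 ≤ -(2 / (r / p) - 1) := by
    have := h.dual
    rw [show 2 / (r / p) = 2 * p / r by field_simp]; linarith
  refine (eH_mono_exp hexp _).trans ((hC _ ((memLp_powerNonlin h hf).sub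
    (memLp_powerNonlin h hg))).trans ?_)
  rw [ENNReal.coe_mul, mul_assoc, eLpNorm_congr_ae (Lp.coeFn_sub f g)]
  refine mul_le_mul_right ?_ _
  exact eLpNorm_powerNonlin_sub_le hp hr0 (Lp.aestronglyMeasurable f) (Lp.aestronglyMeasurable g)
    (by linarith [h.two_lt_r])

theorem ae_eLpNorm_lt_top (hq : 0 < q) {ν : Measure ℝ} {u : ℝ → L2}
    (hu : AEMeasurable (fun t => eLpNorm (u t) (ENNReal.ofReal r) torusMeasure) ν)
    (hX : timeNorm q r ν u < ∞) :
    ∀ᵐ t ∂ν, eLpNorm (u t) (ENNReal.ofReal r) torusMeasure < ∞ := by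
  rw [timeNorm, ENNReal.rpow_lt_top_iff_of_pos (by positivity)] at hX
  filter_upwards [ae_lt_top' (hu.pow_const q) hX.ne] with t ht
  rwa [ENNReal.rpow_lt_top_iff_of_pos hq] at ht

/-- The multilinear estimate for the difference of the nonlinearities of two paths. -/
theorem lintegral_source_sub_le (h : Admissible p s q r) : ∃ C : NNReal,
    ∀ (T : ℝ) (J : Set ℝ) (u w : ℝ → L2), T ≤ 1 → J ⊆ Icc 0 T →
      ContinuousOn u (Icc 0 T) → ContinuousOn w (Icc 0 T) →
      timeNorm q r (volume.restrict J) u < ∞ → timeNorm q r (volume.restrict J) w < ∞ →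
      ∫⁻ t in J, eH (s - 1) (source p u t - source p w t)
        ≤ C * (timeNorm q r (volume.restrict J) (fun t => u t - w t) *
          (timeNorm q r (volume.restrict J) u + timeNorm q r (volume.restrict J) w) ^ (p - 1)) := by
  obtain ⟨C, hC⟩ := eH_nonlin_sub_le h
  have hp := h.one_lt_p
  have hp0 : 0 < p := by linarith
  have hq : 0 < q := by linarith [h.two_le_q]
  have hr0 : 0 < r := by linarith [h.two_lt_r]
  refine ⟨C, fun T J u w hT hJ hu hw hXu hXw => ?_⟩
  set ν := volume.restrict J
  have hle : ν ≤ volume.restrict (Icc 0 T) := Measure.restrict_mono hJ le_rfl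
  have hν : ν univ ≤ 1 := by
    refine (hle univ).trans ?_
    rw [Measure.restrict_apply_univ, Real.volume_Icc, sub_zero]
    exact ENNReal.ofReal_le_one.2 hT
  have mu := (aemeasurable_eLpNorm hr0 hu).mono_measure hle
  have mw := (aemeasurable_eLpNorm hr0 hw).mono_measure hle
  have md := (aemeasurable_eLpNorm hr0 (hu.sub hw)).mono_measure hle
  set α : ℝ → ℝ≥0∞ := fun t => eLpNorm (u t - w t : L2) (ENNReal.ofReal r) torusMeasure
  set β : ℝ → ℝ≥0∞ := fun t => eLpNorm (u t) (ENNReal.ofReal r) torusMeasure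
    + eLpNorm (w t) (ENNReal.ofReal r) torusMeasure
  have hβm : AEMeasurable β ν := mu.add mw
  calc _ ≤ ∫⁻ t in J, C * (α t * β t ^ (p - 1)) := by
        refine lintegral_mono_ae ?_
        filter_upwards [ae_eLpNorm_lt_top hq mu hXu, ae_eLpNorm_lt_top hq mw hXw] with t h1 h2
        exact hC _ _ h1 h2
    _ = C * ∫⁻ t in J, α t * β t ^ (p - 1) := lintegral_const_mul' _ _ ENNReal.coe_ne_top
    _ ≤ C * ((∫⁻ t in J, α t ^ p) ^ (1 / p) * ((∫⁻ t in J, β t ^ p) ^ (1 / p)) ^ (p - 1)) := by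
        refine mul_le_mul_right ((lintegral_mul_rpow_le hp md hβm).trans (le_of_eq ?_)) _
        rw [← ENNReal.rpow_mul (∫⁻ t in J, β t ^ p), one_div_mul_eq_div]
        rfl
    _ ≤ _ := by
        -- the time interval has length at most one and `p ≤ q`
        refine mul_le_mul_right (mul_le_mul' (lintegral_rpow_mono_exp hp0 h.p_le_q hν md)
          (ENNReal.rpow_le_rpow ?_ (by linarith))) _
        refine (lintegral_rpow_mono_exp hp0 h.p_le_q hν hβm).trans ?_
        exact ENNReal.lintegral_Lp_add_le mu mw (by linarith [h.two_le_q])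

theorem ae_integrable_powerNonlin (h : Admissible p s q r) {T : ℝ} {u : ℝ → L2}
    (hu : ContinuousOn u (Icc 0 T)) (hX : timeNorm q r (volume.restrict (Icc 0 T)) u < ∞) :
    ∀ᵐ t ∂volume.restrict (Icc 0 T), Integrable (fun x => powerNonlin p (u t x)) torusMeasure := by
  filter_upwards [ae_eLpNorm_lt_top (by linarith [h.two_le_q])
    (aemeasurable_eLpNorm (by linarith [h.two_lt_r]) hu) hX] with t ht
  exact integrable_powerNonlin h ht

theorem coeFn_zero_L2 : ((0 : L2) : Torus → ℂ) =ᵐ[torusMeasure] 0 := Lp.coeFn_zero ℂ 2 torusMeasure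

theorem source_zero : source p (fun _ => (0 : L2)) = 0 := by
  funext t n
  rw [source, coeffs_congr_ae (g := fun _ => 0)
    (coeFn_zero_L2.mono fun x hx => by simp only [hx, Pi.zero_apply, powerNonlin_zero])]
  simp [coeffs_eq]

theorem timeNorm_zero (hq : 0 < q) (ν : Measure ℝ) : timeNorm q r ν (fun _ => (0 : L2)) = 0 := by
  rw [timeNorm]
  simp only [eLpNorm_congr_ae coeFn_zero_L2, eLpNorm_zero, ENNReal.zero_rpow_of_pos hq,
    lintegral_zero]
  exact ENNReal.zero_rpow_of_pos (by positivity)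

theorem isSource_source (h : Admissible p s q r) {T : ℝ} (hT : T ≤ 1) {u : ℝ → L2}
    (hu : ContinuousOn u (Icc 0 T)) (hX : timeNorm q r (volume.restrict (Icc 0 T)) u < ∞) :
    IsSource (s - 1) T (source p u) := by
  have hq : 0 < q := by linarith [h.two_le_q]
  refine ⟨aemeasurable_source h.one_lt_p hu (ae_integrable_powerNonlin h hu hX), ?_⟩
  obtain ⟨C, hC⟩ := lintegral_source_sub_le h
  have h1 := hC T _ u (fun _ => 0) hT subset_rfl hu continuousOn_const hX
    (by rw [timeNorm_zero hq]; exact ENNReal.zero_lt_top)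
  simp only [source_zero, Pi.zero_apply, sub_zero, timeNorm_zero hq, add_zero] at h1
  refine h1.trans_lt (ENNReal.mul_lt_top ENNReal.coe_lt_top (ENNReal.mul_lt_top hX ?_))
  exact ENNReal.rpow_lt_top_of_nonneg (by linarith [h.one_lt_p]) hX.ne

theorem lintegral_nonlin_lt_top (h : Admissible p s q r) {T : ℝ} (hT : T ≤ 1) {u : ℝ → L2}
    (hu : ContinuousOn u (Icc 0 T)) (hX : timeNorm q r (volume.restrict (Icc 0 T)) u < ∞) :
    ∫⁻ t in Icc 0 T, ∫⁻ x, ‖powerNonlin p (u t x)‖ₑ ∂torusMeasure < ∞ := by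
  have hp := h.one_lt_p
  have hp0 : 0 < p := by linarith
  have hq : 0 < q := by linarith [h.two_le_q]
  have hr0 : 0 < r := by linarith [h.two_lt_r]
  have mu := aemeasurable_eLpNorm hr0 hu
  have hν : (volume.restrict (Icc 0 T)) univ ≤ 1 := by
    rw [Measure.restrict_apply_univ, Real.volume_Icc, sub_zero]
    exact ENNReal.ofReal_le_one.2 hT
  have hx : ∀ t, ∫⁻ x, ‖powerNonlin p (u t x)‖ₑ ∂torusMeasure
      ≤ eLpNorm (u t) (ENNReal.ofReal r) torusMeasure ^ p := fun t => by
    have h1 := lintegral_rpow_mono_exp hp0 h.p_lt_r.le (ν := torusMeasure)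
      (by rw [measure_univ]) (Lp.aestronglyMeasurable (u t)).enorm
    rw [one_div, ENNReal.rpow_inv_le_iff hp0] at h1
    rw [eLpNorm_eq_lintegral_rpow_enorm_toReal (by simpa using hr0) ENNReal.ofReal_ne_top,
      ENNReal.toReal_ofReal hr0.le]
    refine (lintegral_mono fun x => le_of_eq ?_).trans h1
    rw [← ofReal_norm, norm_powerNonlin hp, ← ofReal_norm,
      ENNReal.ofReal_rpow_of_nonneg (norm_nonneg _) hp0.le]
  refine (lintegral_mono hx).trans_lt ?_
  have h2 := lintegral_rpow_mono_exp hp0 h.p_le_q hν mu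
  have h3 := h2.trans_lt hX
  rwa [ENNReal.rpow_lt_top_iff_of_pos (by positivity)] at h3

end

section

variable {p s q r : ℝ}

/-! ### Differences of Duhamel terms -/

theorem eLpNorm_le_liminf_of_tendsto {r : ℝ} {f : ℕ → L2} {g : L2} (h : Tendsto f atTop (𝓝 g)) :
    eLpNorm g (ENNReal.ofReal r) torusMeasure
      ≤ liminf (fun k => eLpNorm (f k) (ENNReal.ofReal r) torusMeasure) atTop := by
  refine le_of_forall_gt fun c hc => ?_
  obtain ⟨c', hc', hcc⟩ := exists_between hc
  obtain ⟨ns, hns, hlt⟩ := extraction_of_frequently_atTop (frequently_lt_of_liminf_lt (by isBoundedDefault) hc')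
  have h1 : TendstoInMeasure torusMeasure (fun k => (f (ns k) : Torus → ℂ)) atTop g :=
    tendstoInMeasure_of_tendsto_Lp (h.comp hns.tendsto_atTop)
  obtain ⟨ms, -, hms⟩ := h1.exists_seq_tendsto_ae
  refine lt_of_le_of_lt ((Lp.eLpNorm_lim_le_liminf_eLpNorm
    (fun k => Lp.aestronglyMeasurable (f (ns (ms k)))) _ hms).trans ?_) hcc
  refine liminf_le_of_frequently_le' (Frequently.of_forall fun k => (hlt (ms k)).le)

/-- Paths that are continuous into `L²` and belong to `L^q([0,T]; L^r)`. -/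
structure IsPath (q r T : ℝ) (u : ℝ → L2) : Prop where
  continuousOn : ContinuousOn u (Icc 0 T)
  timeNorm_lt_top : timeNorm q r (volume.restrict (Icc 0 T)) u < ∞

theorem restrict_le {T t₀ t₁ : ℝ} (h₀ : 0 ≤ t₀) (h₁ : t₁ ≤ T) :
    (volume : Measure ℝ).restrict (Icc t₀ t₁) ≤ volume.restrict (Icc 0 T) :=
  Measure.restrict_mono (Icc_subset_Icc h₀ h₁) le_rfl

theorem timeNorm_add_le (hq : 1 ≤ q) (hr : 1 ≤ r) {ν : Measure ℝ} {u w : ℝ → L2}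
    (hu : AEMeasurable (fun t => eLpNorm (u t) (ENNReal.ofReal r) torusMeasure) ν)
    (hw : AEMeasurable (fun t => eLpNorm (w t) (ENNReal.ofReal r) torusMeasure) ν) :
    timeNorm q r ν (fun t => u t + w t) ≤ timeNorm q r ν u + timeNorm q r ν w := by
  refine le_trans (ENNReal.rpow_le_rpow (lintegral_mono fun t => ENNReal.rpow_le_rpow ?_
    (by positivity)) (by positivity)) (ENNReal.lintegral_Lp_add_le hu hw hq)
  rw [eLpNorm_congr_ae (Lp.coeFn_add (u t) (w t))]
  exact eLpNorm_add_le (Lp.aestronglyMeasurable _) (Lp.aestronglyMeasurable _)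
    (by rwa [← ENNReal.ofReal_one, ENNReal.ofReal_le_ofReal_iff (by linarith)])

theorem timeNorm_smul (hq : 0 < q) (c : ℂ) {ν : Measure ℝ} (u : ℝ → L2) :
    timeNorm q r ν (fun t => c • u t) = ‖c‖ₑ * timeNorm q r ν u := by
  have e : ∀ t, eLpNorm (c • u t : L2) (ENNReal.ofReal r) torusMeasure ^ q
      = ‖c‖ₑ ^ q * eLpNorm (u t) (ENNReal.ofReal r) torusMeasure ^ q := fun t => by
    rw [eLpNorm_congr_ae (Lp.coeFn_smul c (u t)), eLpNorm_const_smul,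
      ENNReal.mul_rpow_of_nonneg _ _ hq.le]
  simp only [timeNorm, e]
  rw [lintegral_const_mul' _ _ (ENNReal.rpow_ne_top_of_nonneg hq.le enorm_ne_top),
    ENNReal.mul_rpow_of_nonneg _ _ (by positivity), ← ENNReal.rpow_mul,
    mul_one_div_cancel hq.ne', ENNReal.rpow_one]

theorem timeNorm_congr {T₀ T₁ : ℝ} {u w : ℝ → L2} (h : ∀ t ∈ Icc T₀ T₁, u t = w t) :
    timeNorm q r (volume.restrict (Icc T₀ T₁)) u = timeNorm q r (volume.restrict (Icc T₀ T₁)) w := by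
  rw [timeNorm, timeNorm, setLIntegral_congr_fun measurableSet_Icc fun t ht => by rw [h t ht]]

theorem exists_timeNorm_le (hq : 0 < q) {T : ℝ} {u : ℝ → L2}
    (hX : timeNorm q r (volume.restrict (Icc 0 T)) u < ∞) {ε : ℝ≥0∞} (hε : ε ≠ 0) :
    ∃ δ : ℝ, 0 < δ ∧ ∀ t₀ t₁, 0 ≤ t₀ → t₁ ≤ T → t₁ - t₀ ≤ δ →
      timeNorm q r (volume.restrict (Icc t₀ t₁)) u ≤ ε := by
  rcases eq_or_ne ε ∞ with rfl | hε'
  · exact ⟨1, one_pos, fun _ _ _ _ _ => le_top⟩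
  rw [timeNorm, ENNReal.rpow_lt_top_iff_of_pos (by positivity)] at hX
  obtain ⟨δ, hδ, h⟩ := exists_pos_setLIntegral_lt_of_measure_lt hX.ne
    (ε := ε ^ q) (ENNReal.rpow_pos (pos_iff_ne_zero.2 hε) hε').ne'
  obtain ⟨δ', hδ', hlt⟩ : ∃ δ' : ℝ, 0 < δ' ∧ ENNReal.ofReal δ' < δ := by
    rcases eq_or_ne δ ∞ with rfl | hδt
    · exact ⟨1, one_pos, ENNReal.ofReal_lt_top⟩
    · refine ⟨δ.toReal / 2, by have := ENNReal.toReal_pos hδ.ne' hδt; linarith, ?_⟩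
      rw [ENNReal.ofReal_lt_iff_lt_toReal (by positivity) hδt]
      have := ENNReal.toReal_pos hδ.ne' hδt; linarith
  refine ⟨δ', hδ', fun t₀ t₁ h₀ h₁ h01 => ?_⟩
  have h2 := h (Icc t₀ t₁) (by
    rw [Measure.restrict_apply measurableSet_Icc, inter_eq_left.2 (Icc_subset_Icc h₀ h₁),
      Real.volume_Icc]
    exact (ENNReal.ofReal_le_ofReal h01).trans_lt hlt)
  rw [Measure.restrict_restrict measurableSet_Icc, inter_eq_left.2 (Icc_subset_Icc h₀ h₁)] at h2
  rw [timeNorm, one_div, ENNReal.rpow_inv_le_iff hq]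
  exact h2.le

theorem IsPath.isSource (h : Admissible p s q r) {T : ℝ} (hT : T ≤ 1) {u : ℝ → L2}
    (hu : IsPath q r T u) : IsSource (s - 1) T (source p u) :=
  isSource_source h hT hu.1 hu.2

/-- Two paths that agree before the time `t₀`: the difference of their Duhamel terms on
`[t₀, t₁]` is controlled by the paths on `[t₀, t₁]` alone. -/
theorem duhamel_sub_le (h : Admissible p s q r) : ∃ K : NNReal,
    ∀ (T t₀ t₁ : ℝ) (u w : ℝ → L2), T ≤ 1 → 0 ≤ t₀ → t₁ ≤ T → IsPath q r T u → IsPath q r T w →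
      (∀ t ∈ Ico 0 t₀, u t = w t) →
      timeNorm q r (volume.restrict (Icc t₀ t₁)) (fun t => toL2 (causalConv kerS T (source p u) t)
          - toL2 (causalConv kerS T (source p w) t))
        ≤ K * (timeNorm q r (volume.restrict (Icc t₀ t₁)) (fun t => u t - w t) *
          (timeNorm q r (volume.restrict (Icc t₀ t₁)) u
            + timeNorm q r (volume.restrict (Icc t₀ t₁)) w) ^ (p - 1)) ∧
      ∀ t ∈ Icc t₀ t₁, eH s (causalConv kerS T (source p u) t - causalConv kerS T (source p w) t)
        ≤ K * (timeNorm q r (volume.restrict (Icc t₀ t₁)) (fun t => u t - w t) *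
          (timeNorm q r (volume.restrict (Icc t₀ t₁)) u
            + timeNorm q r (volume.restrict (Icc t₀ t₁)) w) ^ (p - 1)) := by
  obtain ⟨C₁, hC₁⟩ := timeNorm_causalConv_le h
  obtain ⟨C₂, hC₂⟩ := lintegral_source_sub_le h
  have hq : 0 < q := by linarith [h.two_le_q]
  refine ⟨(C₁ + 4) * C₂, fun T t₀ t₁ u w hT h₀ h₁ hu hw heq => ?_⟩
  have hsu := hu.isSource h hT
  have hsw := hw.isSource h hT
  have hJ : Icc t₀ t₁ ⊆ Icc 0 T := Icc_subset_Icc h₀ h₁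
  set B := timeNorm q r (volume.restrict (Icc t₀ t₁)) (fun t => u t - w t) *
          (timeNorm q r (volume.restrict (Icc t₀ t₁)) u
            + timeNorm q r (volume.restrict (Icc t₀ t₁)) w) ^ (p - 1)
  set F : ℝ → Dist := fun τ => source p u τ - source p w τ
  -- the past is cut off since the paths agree there, the future by causality
  set G : ℝ → Dist := (Icc t₀ t₁).indicator F
  have hGn : ∀ n, (fun τ => G τ n) = (Icc t₀ t₁).indicator fun τ => F τ n := fun n => by
    funext τ
    by_cases hτ : τ ∈ Icc t₀ t₁ <;> simp [G, hτ]
  have hGint : ∫⁻ τ in Icc 0 T, eH (s - 1) (G τ) = ∫⁻ τ in Icc t₀ t₁, eH (s - 1) (F τ) := by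
    have e : ∀ τ, eH (s - 1) (G τ) = (Icc t₀ t₁).indicator (fun τ => eH (s - 1) (F τ)) τ :=
      fun τ => by by_cases hτ : τ ∈ Icc t₀ t₁ <;> simp [G, hτ, eH_zero]
    simp only [e]
    rw [lintegral_indicator measurableSet_Icc, Measure.restrict_restrict measurableSet_Icc,
      inter_eq_left.2 hJ]
  have hXu := (timeNorm_mono hq (restrict_le h₀ h₁) u).trans_lt hu.2
  have hXw := (timeNorm_mono hq (restrict_le h₀ h₁) w).trans_lt hw.2
  have hFB : ∫⁻ τ in Icc t₀ t₁, eH (s - 1) (F τ) ≤ C₂ * B :=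
    hC₂ T _ u w hT hJ hu.1 hw.1 hXu hXw
  have hGm : ∀ n, AEMeasurable (fun τ => G τ n) (volume.restrict (Icc 0 T)) := fun n => by
    rw [hGn]
    exact ((hsu.aemeasurable n).sub (hsw.aemeasurable n)).indicator measurableSet_Icc
  have hGs : IsSource (s - 1) T G := by
    refine ⟨hGm, ?_⟩
    rw [hGint]
    refine (lintegral_mono_set hJ).trans_lt ?_
    refine (lintegral_mono fun τ => eH_sub_le _ _ _).trans_lt ?_
    have hm : AEMeasurable (fun τ => eH (s - 1) (source p u τ)) (volume.restrict (Icc 0 T)) := by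
      simp only [eH_eq_tsum]
      refine AEMeasurable.pow_const ?_ _
      exact AEMeasurable.tsum fun n => ((hsu.aemeasurable n).enorm.const_mul _).pow_const _
    rw [lintegral_add_left' hm]
    exact ENNReal.add_lt_top.2 ⟨hsu.2, hsw.2⟩
  have hconv : ∀ t ∈ Icc t₀ t₁, causalConv kerS T (source p u) t - causalConv kerS T (source p w) t
      = causalConv kerS T G t := fun t ht => by
    rw [← causalConv_sub isCausal_kerS hsu.integrable hsw.integrable (ht.2.trans (h₁.trans hT))]
    funext n
    refine setIntegral_congr_fun measurableSet_Icc fun τ hτ => ?_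
    by_cases hτJ : τ ∈ Icc t₀ t₁
    · simp only [G, indicator_of_mem hτJ, F]
    · simp only [G, indicator_of_notMem hτJ]
      rcases lt_or_ge τ t₀ with hlt | hge
      · have : source p u τ = source p w τ := by
          unfold source; rw [heq τ ⟨hτ.1, hlt⟩]
        simp [this]
      · have : t₁ < τ := not_le.1 fun hh => hτJ ⟨hge, hh⟩
        rw [isCausal_kerS.eq_zero n _ (by linarith [ht.2])]
        simp
  constructor
  · have hcongr := timeNorm_congr (q := q) (r := r) (T₀ := t₀) (T₁ := t₁)
      (u := fun t => toL2 (causalConv kerS T (source p u) t)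
        - toL2 (causalConv kerS T (source p w) t))
      (w := fun t => toL2 (causalConv kerS T G t)) fun t ht => by
        rw [← hconv t ht, toL2_sub
          (eH_zero_causalConv_lt_top h.s_nonneg (ht.2.trans (h₁.trans hT)) hsu)
          (eH_zero_causalConv_lt_top h.s_nonneg (ht.2.trans (h₁.trans hT)) hsw)]
    rw [hcongr]
    calc _ ≤ timeNorm q r (volume.restrict (Icc 0 T)) (fun t => toL2 (causalConv kerS T G t)) :=
          timeNorm_mono hq (restrict_le h₀ h₁) _
      _ ≤ C₁ * ∫⁻ τ in Icc 0 T, eH (s - 1) (G τ) := hC₁ T G hT hGs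
      _ ≤ C₁ * (C₂ * B) := by rw [hGint]; exact mul_le_mul_right hFB _
      _ ≤ _ := by
        rw [ENNReal.coe_mul, ENNReal.coe_add, ← mul_assoc]
        exact mul_le_mul_left (mul_le_mul_left le_self_add _) _
  · intro t ht
    rw [hconv t ht]
    have h2 := eH_causalConv_le isCausal_kerS (σ := s - 1) hGm (ht.2.trans (h₁.trans hT))
    rw [sub_add_cancel] at h2
    calc _ ≤ 4 * ∫⁻ τ in Icc 0 T, eH (s - 1) (G τ) := h2
      _ ≤ 4 * (C₂ * B) := by rw [hGint]; exact mul_le_mul_right hFB _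
      _ ≤ _ := by
        rw [ENNReal.coe_mul, ENNReal.coe_add, ← mul_assoc]
        refine mul_le_mul_left (mul_le_mul_left ?_ _) _
        exact le_add_self

end

section

variable {p s q r : ℝ}

/-! ### Real-valued distributions -/

theorem freqNorm_neg (n : Freq) : freqNorm (-n) = freqNorm n := by simp [freqNorm]

theorem bracket_neg (n : Freq) : bracket (-n) = bracket n := by simp [bracket, freqNorm_neg]

theorem dispersion_neg (n : Freq) : dispersion (-n) = dispersion n := by
  simp [dispersion, freqNorm_neg]

theorem symbolS_neg (t : ℝ) (n : Freq) : symbolS t (-n) = symbolS t n := by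
  simp [symbolS, freqNorm_neg, dispersion_neg]

theorem symbolC_neg (t : ℝ) (n : Freq) : symbolC t (-n) = symbolC t n := by
  simp [symbolC, freqNorm_neg, dispersion_neg]

theorem symbolD_neg (t : ℝ) (n : Freq) : symbolD t (-n) = symbolD t n := by
  simp [symbolD, freqNorm_neg, dispersion_neg]

theorem kerS_neg (n : Freq) : kerS (-n) = kerS n := by
  funext x; simp [kerS, symbolS_neg]

theorem kerD_neg (n : Freq) : kerD (-n) = kerD n := by
  funext x; simp [kerD, symbolD_neg]

theorem isRealValued_zero : IsRealValued 0 := fun n => by simp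

theorem IsRealValued.sub {a b : Dist} (ha : IsRealValued a) (hb : IsRealValued b) :
    IsRealValued (a - b) := fun n => by simp [ha n, hb n]

theorem IsRealValued.smul {a : Dist} (ha : IsRealValued a) (c : ℝ) :
    IsRealValued ((c : ℂ) • a) := fun n => by simp [ha n]

theorem isRealValued_propV {t : ℝ} {φ₀ φ₁ : Dist} (h₀ : IsRealValued φ₀) (h₁ : IsRealValued φ₁) :
    IsRealValued (propV t φ₀ φ₁) := fun n => by
  simp [propV, propS, h₀ n, h₁ n, symbolC_neg, symbolS_neg]

theorem isRealValued_propVderiv {t : ℝ} {φ₀ φ₁ : Dist} (h₀ : IsRealValued φ₀)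
    (h₁ : IsRealValued φ₁) : IsRealValued (propVderiv t φ₀ φ₁) := fun n => by
  simp [propVderiv, h₀ n, h₁ n, symbolD_neg, symbolS_neg, bracket_neg]

theorem isRealValued_causalConv {k : Freq → ℝ → ℝ} (hk : ∀ n, k (-n) = k n) {T t : ℝ}
    {F : ℝ → Dist} (hF : ∀ τ ∈ Icc 0 T, IsRealValued (F τ)) :
    IsRealValued (causalConv k T F t) := fun n => by
  rw [causalConv, causalConv, Complex.star_def, ← integral_conj]
  refine setIntegral_congr_fun measurableSet_Icc fun τ hτ => ?_
  simp [hk, hF τ hτ n]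

theorem coeffs_conj (f : Torus → ℂ) (n : Freq) :
    coeffs (fun x => star (f x)) n = star (coeffs f (-n)) := by
  rw [coeffs_eq, coeffs_eq, Complex.star_def, ← integral_conj]
  refine integral_congr_ae (Eventually.of_forall fun x => ?_)
  simp only [map_mul, neg_neg, UnitAddTorus.mFourier_neg]

theorem isRealValued_coeffs_iff {f : L2} :
    IsRealValued (coeffs f) ↔ (fun x => star (f x)) =ᵐ[torusMeasure] f := by
  constructor
  · intro h
    have e : star f = f := by
      refine eq_of_coeffs_eq (funext fun n => ?_)
      rw [coeffs_congr_ae (Lp.coeFn_star f), show (star (f : Torus → ℂ)) = fun x => star (f x)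
        from rfl, coeffs_conj, ← star_star (coeffs f n), ← h n]
    have h1 := Lp.coeFn_star f
    rw [e] at h1
    exact h1.symm
  · intro h n
    rw [← congrFun (coeffs_congr_ae h) (-n), coeffs_conj, neg_neg]

theorem powerNonlin_star (p : ℝ) (z : ℂ) : powerNonlin p (star z) = star (powerNonlin p z) := by
  simp [powerNonlin]

theorem isRealValued_source {u : ℝ → L2} {t : ℝ} (h : IsRealValued (coeffs (u t))) :
    IsRealValued (source p u t) := fun n => by
  have h1 := isRealValued_coeffs_iff.1 h
  rw [source, ← neg_neg n, neg_neg (-n), ← congrFun (coeffs_congr_ae (f := fun x =>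
    star (powerNonlin p (u t x))) (h1.mono fun x hx => ?_)) (-n), coeffs_conj]
  dsimp only at hx ⊢
  rw [← powerNonlin_star, hx]

theorem tendsto_coeffs {ι : Type*} {l : Filter ι} {f : ι → L2} {g : L2} (h : Tendsto f l (𝓝 g))
    (n : Freq) : Tendsto (fun i => coeffs (f i) n) l (𝓝 (coeffs g n)) := by
  rw [tendsto_iff_edist_tendsto_0] at h ⊢
  refine tendsto_of_tendsto_of_tendsto_of_le_of_le tendsto_const_nhds h (fun _ => zero_le)
    fun i => ?_
  rw [edist_eq_enorm_sub, edist_eq_enorm_sub, ← eH_zero_coeffs, coeffs_sub]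
  have := weight_le_eH 0 (coeffs (f i) - coeffs g) n
  simpa using this

theorem isRealValued_of_tendsto {f : ℕ → L2} {g : L2} (h : Tendsto f atTop (𝓝 g))
    (hf : ∀ m, IsRealValued (coeffs (f m))) : IsRealValued (coeffs g) := fun n => by
  refine tendsto_nhds_unique (tendsto_coeffs h (-n)) ?_
  simp only [hf _ n]
  exact (continuous_star.tendsto _).comp (tendsto_coeffs h n)

end

section

variable {p s q r : ℝ}

/-! ### The contraction argument -/

theorem timeNorm_le_of_tendsto (hq : 0 < q) (hr : 0 < r) {T : ℝ} {W : ℕ → ℝ → L2} {u : ℝ → L2}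
    {B : ℝ≥0∞} (hW : ∀ k, ContinuousOn (W k) (Icc 0 T))
    (hlim : ∀ t ∈ Icc 0 T, Tendsto (fun k => W k t) atTop (𝓝 (u t)))
    (hB : ∀ k, timeNorm q r (volume.restrict (Icc 0 T)) (W k) ≤ B) :
    timeNorm q r (volume.restrict (Icc 0 T)) u ≤ B := by
  rw [timeNorm, one_div, ENNReal.rpow_inv_le_iff hq]
  calc ∫⁻ t in Icc 0 T, eLpNorm (u t) (ENNReal.ofReal r) torusMeasure ^ q
      ≤ ∫⁻ t in Icc 0 T, liminf (fun k => eLpNorm (W k t) (ENNReal.ofReal r) torusMeasure ^ q)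
          atTop := by
        refine setLIntegral_mono' measurableSet_Icc fun t ht => ?_
        refine (ENNReal.rpow_le_rpow (eLpNorm_le_liminf_of_tendsto (hlim t ht)) hq.le).trans
          (le_of_eq ?_)
        exact OrderIso.liminf_apply (ENNReal.orderIsoRpow q hq)
    _ ≤ liminf (fun k => ∫⁻ t in Icc 0 T, eLpNorm (W k t) (ENNReal.ofReal r) torusMeasure ^ q)
          atTop := lintegral_liminf_le' fun k => (aemeasurable_eLpNorm hr (hW k)).pow_const q
    _ ≤ B ^ q := by
        refine liminf_le_of_frequently_le' (Frequently.of_forall fun k => ?_)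
        have := hB k
        rwa [timeNorm, one_div, ENNReal.rpow_inv_le_iff hq] at this

theorem coeffs_smul (c : ℂ) (f : L2) : coeffs (c • f : L2) = c • coeffs f := by
  funext n
  simp only [Pi.smul_apply, ← torus_repr, map_smul]
  rfl

theorem continuousOn_of_continuousInSobolev {T : ℝ} (hs : 0 ≤ s) {u : ℝ → L2}
    (hu : ContinuousInSobolev s T fun t => coeffs (u t)) : ContinuousOn u (Icc 0 T) := by
  have h := continuousInSobolev_iff.1 (hu.mono hs)
  intro t ht
  rw [ContinuousWithinAt, tendsto_iff_edist_tendsto_0]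
  refine (h.2 t ht).congr fun τ => ?_
  rw [edist_eq_enorm_sub, ← eH_zero_coeffs, coeffs_sub]

theorem ContinuousInSobolev.congr {T : ℝ} {a b : ℝ → Dist} (ha : ContinuousInSobolev s T a)
    (h : ∀ t ∈ Icc 0 T, a t = b t) : ContinuousInSobolev s T b := by
  refine ⟨fun t ht => h t ht ▸ ha.1 t ht, fun t ht => (ha.2 t ht).congr' ?_⟩
  filter_upwards [self_mem_nhdsWithin] with τ hτ
  rw [h t ht, h τ hτ]

theorem continuousOn_toL2 {T : ℝ} (hs : 0 ≤ s) {a : ℝ → Dist} (ha : ContinuousInSobolev s T a) :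
    ContinuousOn (fun t => toL2 (a t)) (Icc 0 T) :=
  continuousOn_of_continuousInSobolev hs (ha.congr fun t ht =>
    (coeffs_toL2 ((eH_mono_exp hs _).trans_lt (memSobolev_iff.1 (ha.1 t ht)))).symm)

/-- The right-hand side of the Duhamel formula. -/
def duhamelMap (κ p T : ℝ) (u₀ u₁ : Dist) (w : ℝ → L2) (t : ℝ) : L2 :=
  toL2 (propV t u₀ u₁) - (κ : ℂ) • toL2 (causalConv kerS T (source p w) t)

theorem eH_zero_propV_lt_top (hs : 0 ≤ s) {t : ℝ} (ht : t ∈ Icc (0 : ℝ) 1) {u₀ u₁ : Dist}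
    (h₀ : eH s u₀ < ∞) (h₁ : eH (s - 1) u₁ < ∞) : eH 0 (propV t u₀ u₁) < ∞ :=
  (eH_mono_exp hs _).trans_lt ((continuousInSobolev_iff.1 (continuousInSobolev_propV le_rfl h₀ h₁)).1
    t ht)

theorem coeffs_duhamelMap (h : Admissible p s q r) {κ T t : ℝ} (hT : T ≤ 1) (ht : t ∈ Icc 0 T)
    {u₀ u₁ : Dist} (h₀ : eH s u₀ < ∞) (h₁ : eH (s - 1) u₁ < ∞) {w : ℝ → L2}
    (hw : IsPath q r T w) : coeffs (duhamelMap κ p T u₀ u₁ w t)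
      = propV t u₀ u₁ - (κ : ℂ) • causalConv kerS T (source p w) t := by
  rw [duhamelMap, coeffs_sub, coeffs_smul,
    coeffs_toL2 (eH_zero_propV_lt_top h.s_nonneg ⟨ht.1, ht.2.trans hT⟩ h₀ h₁),
    coeffs_toL2 (eH_zero_causalConv_lt_top h.s_nonneg (ht.2.trans hT) (hw.isSource h hT))]

theorem isPath_propV (h : Admissible p s q r) {T : ℝ} (hT : T ≤ 1) {u₀ u₁ : Dist}
    (h₀ : eH s u₀ < ∞) (h₁ : eH (s - 1) u₁ < ∞) : IsPath q r T fun t => toL2 (propV t u₀ u₁) :=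
  ⟨continuousOn_toL2 h.s_nonneg (continuousInSobolev_propV hT h₀ h₁),
    (timeNorm_mono (by linarith [h.two_le_q]) (restrict_le le_rfl hT) _).trans_lt
      (timeNorm_propV_lt_top h h₀ h₁)⟩

theorem isPath_causalConv (h : Admissible p s q r) {T : ℝ} (hT : T ≤ 1) {F : ℝ → Dist}
    (hF : IsSource (s - 1) T F) : IsPath q r T fun t => toL2 (causalConv kerS T F t) := by
  obtain ⟨C, hC⟩ := timeNorm_causalConv_le h
  refine ⟨continuousOn_toL2 h.s_nonneg ?_, (hC T F hT hF).trans_lt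
    (ENNReal.mul_lt_top ENNReal.coe_lt_top hF.2)⟩
  have := continuousInSobolev_causalConv isCausal_kerS hT hF
  rwa [sub_add_cancel] at this

theorem IsPath.add (hq : 1 ≤ q) (hr : 1 ≤ r) {T : ℝ} {u w : ℝ → L2} (hu : IsPath q r T u)
    (hw : IsPath q r T w) : IsPath q r T fun t => u t + w t :=
  ⟨hu.1.add hw.1, (timeNorm_add_le hq hr (aemeasurable_eLpNorm (by linarith) hu.1)
    (aemeasurable_eLpNorm (by linarith) hw.1)).trans_lt (ENNReal.add_lt_top.2 ⟨hu.2, hw.2⟩)⟩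

theorem IsPath.smul (hq : 0 < q) {T : ℝ} {u : ℝ → L2} (hu : IsPath q r T u) (c : ℂ) :
    IsPath q r T fun t => c • u t :=
  ⟨hu.1.const_smul c, by
    rw [timeNorm_smul hq]; exact ENNReal.mul_lt_top enorm_lt_top hu.2⟩

theorem IsPath.sub (hq : 1 ≤ q) (hr : 1 ≤ r) {T : ℝ} {u w : ℝ → L2} (hu : IsPath q r T u)
    (hw : IsPath q r T w) : IsPath q r T fun t => u t - w t := by
  have := hu.add hq hr (hw.smul (by linarith) (-1))
  simpa [sub_eq_add_neg] using this

theorem isPath_duhamelMap (h : Admissible p s q r) {κ T : ℝ} (hT : T ≤ 1)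
    {u₀ u₁ : Dist} (h₀ : eH s u₀ < ∞) (h₁ : eH (s - 1) u₁ < ∞) {w : ℝ → L2}
    (hw : IsPath q r T w) : IsPath q r T (duhamelMap κ p T u₀ u₁ w) :=
  (isPath_propV h hT h₀ h₁).sub (by linarith [h.two_le_q]) (by linarith [h.two_lt_r])
    ((isPath_causalConv h hT (hw.isSource h hT)).smul (by linarith [h.two_le_q]) _)

theorem exists_contraction_radius (K : NNReal) {e : ℝ} (he : 0 < e) :
    ∃ ε : ℝ≥0∞, ε ≠ 0 ∧ ε ≠ ∞ ∧ K * (4 * ε) ^ e ≤ 2⁻¹ := by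
  have h1 : (2 * ((K : ℝ≥0∞) + 1))⁻¹ ≠ 0 :=
    ENNReal.inv_ne_zero.2 (ENNReal.mul_ne_top (by norm_num) (by simp))
  have h2 : (2 * ((K : ℝ≥0∞) + 1))⁻¹ ≠ ∞ := ENNReal.inv_ne_top.2 (by simp)
  set η := (2 * ((K : ℝ≥0∞) + 1))⁻¹ ^ (1 / e) with hη
  have hη0 : η ≠ 0 := (ENNReal.rpow_pos (pos_iff_ne_zero.2 h1) h2).ne'
  have hηt : η ≠ ∞ := ENNReal.rpow_ne_top_of_nonneg (by positivity) h2
  refine ⟨η / 4, (ENNReal.div_pos hη0 (by norm_num)).ne', ENNReal.div_ne_top hηt (by norm_num), ?_⟩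
  rw [ENNReal.mul_div_cancel (by norm_num) (by norm_num), hη, ← ENNReal.rpow_mul,
    one_div_mul_cancel he.ne', ENNReal.rpow_one, ENNReal.mul_inv (by simp) (by simp), ← mul_assoc,
    mul_comm (K : ℝ≥0∞), mul_assoc]
  refine (mul_le_mul_right ?_ _).trans (mul_one _).le
  rw [← div_eq_mul_inv]
  exact ENNReal.div_le_of_le_mul (by rw [one_mul]; exact le_self_add)

/-- A map that contracts a ball of `L^q([0,T]; L^r)`, and controls differences uniformly in `L²`,
has a fixed point, the limit of the Picard iteration; it inherits the closed conditions that are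
preserved by the map. -/
theorem exists_fixedPoint_of_contraction (hq : 0 < q) (hr : 0 < r) {T : ℝ}
    {Φ : (ℝ → L2) → ℝ → L2} {ε : ℝ≥0∞} (hεt : ε ≠ ∞)
    (hpath : ∀ u, IsPath q r T u → IsPath q r T (Φ u))
    (hball : ∀ u, IsPath q r T u → timeNorm q r (volume.restrict (Icc 0 T)) u ≤ 2 * ε →
      timeNorm q r (volume.restrict (Icc 0 T)) (Φ u) ≤ 2 * ε)
    (hcontr : ∀ u w, IsPath q r T u → IsPath q r T w →
      timeNorm q r (volume.restrict (Icc 0 T)) u ≤ 2 * ε →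
      timeNorm q r (volume.restrict (Icc 0 T)) w ≤ 2 * ε →
      timeNorm q r (volume.restrict (Icc 0 T)) (fun t => Φ u t - Φ w t)
          ≤ 2⁻¹ * timeNorm q r (volume.restrict (Icc 0 T)) (fun t => u t - w t) ∧
      ∀ t ∈ Icc 0 T, ‖Φ u t - Φ w t‖ₑ
          ≤ 2⁻¹ * timeNorm q r (volume.restrict (Icc 0 T)) (fun t => u t - w t)) :
    ∃ u : ℝ → L2, IsPath q r T u ∧ (∀ t ∈ Icc 0 T, Φ u t = u t) ∧
      ∀ S : Set L2, IsClosed S → 0 ∈ S → (∀ w, IsPath q r T w → (∀ t ∈ Icc 0 T, w t ∈ S) →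
        ∀ t ∈ Icc 0 T, Φ w t ∈ S) → ∀ t ∈ Icc 0 T, u t ∈ S := by
  have hzero : IsPath q r T fun _ => (0 : L2) :=
    ⟨continuousOn_const, by rw [timeNorm_zero hq]; exact ENNReal.zero_lt_top⟩
  have hX0 : timeNorm q r (volume.restrict (Icc 0 T)) (fun _ => (0 : L2)) ≤ 2 * ε := by
    rw [timeNorm_zero hq]; exact zero_le
  set W : ℕ → ℝ → L2 := fun m => Φ^[m] fun _ => 0 
  have hWs : ∀ m, W (m + 1) = Φ (W m) := fun m => Function.iterate_succ_apply' _ _ _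
  have hW0 : W 0 = fun _ => 0 := rfl
  clear_value W
  have hWp : ∀ m, IsPath q r T (W m) ∧ timeNorm q r (volume.restrict (Icc 0 T)) (W m) ≤ 2 * ε := by
    intro m
    induction m with
    | zero => rw [hW0]; exact ⟨hzero, hX0⟩
    | succ m ih =>
      rw [hWs]
      exact ⟨hpath _ ih.1, hball _ ih.1 ih.2⟩
  -- the iterates are Cauchy in `L^q_t L^r_x` and, by the second bound, uniformly in `L²`
  have hgeo : ∀ m k, timeNorm q r (volume.restrict (Icc 0 T)) (fun t => W (m + k) t - W m t) ≤ 2 * ε / 2 ^ m := by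
    intro m
    induction m with
    | zero =>
      intro k
      have e : ∀ t, W 0 t = 0 := fun t => by rw [hW0]
      simp only [e, sub_zero, zero_add, _root_.pow_zero, div_one]
      exact (hWp k).2
    | succ m ih =>
      intro k
      rw [show m + 1 + k = (m + k) + 1 by ring, hWs, hWs]
      refine ((hcontr _ _ (hWp _).1 (hWp _).1 (hWp _).2 (hWp _).2).1.trans
        (mul_le_mul_right (ih k) _)).trans (le_of_eq ?_)
      rw [pow_succ, div_eq_mul_inv, div_eq_mul_inv,
        ENNReal.mul_inv (by simp) (by simp)]
      ring
  have hstep : ∀ t ∈ Icc 0 T, ∀ m, edist (W (m + 1) t) (W (m + 1 + 1) t) ≤ ε / 2 ^ m := by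
    intro t ht m
    have e1 := (hcontr (W (m + 1)) (W m) (hWp _).1 (hWp _).1 (hWp _).2 (hWp _).2).2 t ht
    rw [← hWs, ← hWs] at e1
    rw [edist_comm, edist_eq_enorm_sub]
    refine e1.trans ?_
    refine (mul_le_mul_right (hgeo m 1) _).trans (le_of_eq ?_)
    rw [mul_div_assoc, ← mul_assoc, ENNReal.inv_mul_cancel (by norm_num) (by norm_num), one_mul]
  have hlim : ∀ t ∈ Icc 0 T, ∃ y : L2, Tendsto (fun m => W (m + 1) t) atTop (𝓝 y) := fun t ht =>
    cauchySeq_tendsto_of_complete (cauchySeq_of_edist_le_geometric_two ε hεt (hstep t ht))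
  choose! u hu using hlim
  have hu' : ∀ t ∈ Icc 0 T, ∀ m, Tendsto (fun k => W (m + k) t) atTop (𝓝 (u t)) := fun t ht m => by
    have e1 := (tendsto_add_atTop_iff_nat (f := fun n => W n t) 1).1 (hu t ht)
    have e2 := (tendsto_add_atTop_iff_nat (f := fun n => W n t) m).2 e1
    simpa only [add_comm] using e2
  have htail : Tendsto (fun m : ℕ => 2 * ε / 2 ^ m) atTop (𝓝 0) := by
    have e1 : Tendsto (fun m : ℕ => (2⁻¹ : ℝ≥0∞) ^ m) atTop (𝓝 0) :=
      ENNReal.tendsto_pow_atTop_nhds_zero_of_lt_one (by norm_num)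
    have e2 := ENNReal.Tendsto.const_mul (a := 2 * ε) e1
      (Or.inr (ENNReal.mul_ne_top (by norm_num) hεt))
    rw [mul_zero] at e2
    refine e2.congr fun m => ?_
    rw [div_eq_mul_inv, ENNReal.inv_pow]
  have hucont : ContinuousOn u (Icc 0 T) := by
    refine TendstoUniformlyOn.continuousOn (F := fun m => W (m + 1)) (p := atTop) ?_
      (Frequently.of_forall fun m => (hWp _).1.1)
    rw [EMetric.tendstoUniformlyOn_iff]
    intro η hη
    filter_upwards [htail.eventually (gt_mem_nhds hη)] with m hm t ht
    rw [edist_comm]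
    exact (edist_le_of_edist_le_geometric_two_of_tendsto ε (hstep t ht) (hu t ht) m).trans_lt hm
  have hdist : ∀ m, timeNorm q r (volume.restrict (Icc 0 T)) (fun t => u t - W m t) ≤ 2 * ε / 2 ^ m := fun m =>
    timeNorm_le_of_tendsto hq hr (W := fun k t => W (m + k) t - W m t)
      (fun k => (hWp _).1.1.sub (hWp _).1.1) (fun t ht => (hu' t ht m).sub_const _) (hgeo m)
  have hXu : timeNorm q r (volume.restrict (Icc 0 T)) u ≤ 2 * ε := by
    have e1 := hdist 0
    have e : ∀ t, W 0 t = 0 := fun t => by rw [hW0]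
    simpa only [e, sub_zero, _root_.pow_zero, div_one] using e1
  have hupath : IsPath q r T u :=
    ⟨hucont, hXu.trans_lt (ENNReal.mul_lt_top (by norm_num) hεt.lt_top)⟩
  refine ⟨u, hupath, fun t ht => ?_, fun S hS hS0 hΦS t ht => ?_⟩
  · refine tendsto_nhds_unique ?_ (hu t ht)
    rw [tendsto_iff_edist_tendsto_0]
    refine tendsto_of_tendsto_of_tendsto_of_le_of_le tendsto_const_nhds htail (fun _ => zero_le)
      fun m => ?_
    rw [edist_comm, edist_eq_enorm_sub, hWs]
    refine ((hcontr _ _ hupath (hWp m).1 hXu (hWp m).2).2 t ht).trans ?_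
    refine (mul_le_mul_right (hdist m) _).trans ?_
    exact (mul_le_mul_left (by norm_num) _).trans (one_mul _).le
  · have hWr : ∀ m, ∀ t ∈ Icc 0 T, W m t ∈ S := by
      intro m
      induction m with
      | zero => rw [hW0]; exact fun t _ => hS0
      | succ m ih =>
        rw [hWs]
        exact hΦS _ (hWp m).1 ih
    exact hS.mem_of_tendsto (hu t ht) (Eventually.of_forall fun m => hWr (m + 1) t ht)

/-- Existence of a solution of the Duhamel formula on a short time interval, as the limit of the
Picard iteration. -/
theorem exists_fixedPoint (h : Admissible p s q r) {κ : ℝ} (hκ : ‖(κ : ℂ)‖ₑ = 1) {u₀ u₁ : Dist}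
    (h₀ : eH s u₀ < ∞) (h₁ : eH (s - 1) u₁ < ∞) :
    ∃ T : ℝ, 0 < T ∧ T ≤ 1 ∧ ∃ u : ℝ → L2, IsPath q r T u ∧
      (∀ t ∈ Icc 0 T, duhamelMap κ p T u₀ u₁ u t = u t) ∧
      (IsRealValued u₀ → IsRealValued u₁ → ∀ t ∈ Icc 0 T, IsRealValued (coeffs (u t))) := by
  have hq : 0 < q := by linarith [h.two_le_q]
  have hr : 0 < r := by linarith [h.two_lt_r]
  have hq1 : 1 ≤ q := by linarith [h.two_le_q]
  have hr1 : 1 ≤ r := by linarith [h.two_lt_r]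
  obtain ⟨K, hK⟩ := duhamel_sub_le h
  obtain ⟨ε, hε0, hεt, hKε⟩ := exists_contraction_radius K (e := p - 1) (by linarith [h.one_lt_p])
  -- the free evolution is small on a short interval, which fixes `T`
  obtain ⟨δ, hδ, hsmall⟩ := exists_timeNorm_le hq (timeNorm_propV_lt_top h h₀ h₁) hε0
  set T := min 1 δ
  have hT0 : 0 < T := lt_min one_pos hδ
  have hT : T ≤ 1 := min_le_left _ _
  have hV : timeNorm q r (volume.restrict (Icc 0 T)) (fun t => toL2 (propV t u₀ u₁)) ≤ ε :=
    hsmall 0 T le_rfl hT (by rw [sub_zero]; exact min_le_right _ _)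
  refine ⟨T, hT0, hT, ?_⟩
  set X : (ℝ → L2) → ℝ≥0∞ := timeNorm q r (volume.restrict (Icc 0 T)) with hX
  set Φ := duhamelMap κ p T u₀ u₁ with hΦ
  have hzero : IsPath q r T fun _ => (0 : L2) :=
    ⟨continuousOn_const, by rw [timeNorm_zero hq]; exact ENNReal.zero_lt_top⟩
  -- the Duhamel map contracts the ball of radius `2ε`
  have hfac : ∀ u w, X u ≤ 2 * ε → X w ≤ 2 * ε → ∀ y, K * (y * (X u + X w) ^ (p - 1)) ≤ 2⁻¹ * y := by
    intro u w hu hw y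
    calc _ ≤ K * (y * (4 * ε) ^ (p - 1)) := by
          refine mul_le_mul_right (mul_le_mul_right (ENNReal.rpow_le_rpow ?_
            (by linarith [h.one_lt_p])) _) _
          refine (add_le_add hu hw).trans (le_of_eq ?_)
          rw [← add_mul]; norm_num
      _ = (K * (4 * ε) ^ (p - 1)) * y := by ring
      _ ≤ _ := mul_le_mul_left hKε _
  have hdiff : ∀ u w t, Φ u t - Φ w t = (-κ : ℂ) • (toL2 (causalConv kerS T (source p u) t)
      - toL2 (causalConv kerS T (source p w) t)) := fun u w t => by
    simp only [hΦ, duhamelMap, neg_smul, smul_sub]; abel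
  have hκ' : ‖(-κ : ℂ)‖ₑ = 1 := by rw [enorm_neg, hκ]
  have hcontr : ∀ u w, IsPath q r T u → IsPath q r T w → X u ≤ 2 * ε → X w ≤ 2 * ε →
      X (fun t => Φ u t - Φ w t) ≤ 2⁻¹ * X (fun t => u t - w t) ∧
      ∀ t ∈ Icc 0 T, ‖Φ u t - Φ w t‖ₑ ≤ 2⁻¹ * X (fun t => u t - w t) := by
    intro u w hu hw hXu hXw
    obtain ⟨e1, e2⟩ := hK T 0 T u w hT le_rfl le_rfl hu hw (by simp)
    constructor
    · simp only [hdiff]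
      rw [hX, timeNorm_smul hq, hκ', one_mul]
      exact e1.trans (hfac u w hXu hXw _)
    · intro t ht
      rw [hdiff, enorm_smul, hκ', one_mul, ← eH_zero_coeffs, coeffs_sub,
        coeffs_toL2 (eH_zero_causalConv_lt_top h.s_nonneg (ht.2.trans hT) (hu.isSource h hT)),
        coeffs_toL2 (eH_zero_causalConv_lt_top h.s_nonneg (ht.2.trans hT) (hw.isSource h hT))]
      exact (eH_mono_exp h.s_nonneg _).trans ((e2 t ht).trans (hfac u w hXu hXw _))
  have hconv0 : ∀ t, toL2 (causalConv kerS T (source p fun _ => (0 : L2)) t) = 0 := fun t => by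
    have e : causalConv kerS T (source p fun _ => (0 : L2)) t = 0 := by
      funext n; simp [causalConv, source_zero]
    refine eq_of_coeffs_eq ?_
    rw [e, coeffs_toL2 (by rw [eH_zero]; exact ENNReal.zero_lt_top)]
    have := coeffs_sub (0 : L2) 0
    rw [sub_self, sub_self] at this
    exact this.symm
  have hΦ0 : ∀ t, Φ (fun _ => 0) t = toL2 (propV t u₀ u₁) := fun t => by
    simp only [hΦ, duhamelMap, hconv0, smul_zero, sub_zero]
  have hX0 : X (fun _ => 0) ≤ 2 * ε := by rw [hX, timeNorm_zero hq]; exact zero_le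
  have hball : ∀ u, IsPath q r T u → X u ≤ 2 * ε → X (Φ u) ≤ 2 * ε := by
    intro u hu hXu
    have e1 := (hcontr u _ hu hzero hXu hX0).1
    have hPu := isPath_duhamelMap (κ := κ) h hT h₀ h₁ hu
    have hP0 := isPath_duhamelMap (κ := κ) h hT h₀ h₁ hzero
    have e2 := timeNorm_add_le hq1 hr1 (ν := volume.restrict (Icc 0 T))
      (u := fun t => Φ u t - Φ (fun _ => 0) t) (w := Φ fun _ => 0)
      (aemeasurable_eLpNorm hr (hPu.sub hq1 hr1 hP0).1) (aemeasurable_eLpNorm hr hP0.1)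
    simp only [sub_add_cancel, sub_zero] at e1 e2
    calc X (Φ u) ≤ _ := e2
      _ ≤ 2⁻¹ * (2 * ε) + ε := add_le_add (e1.trans (mul_le_mul_right hXu _)) (by
          rw [show (Φ fun _ => 0) = fun t => toL2 (propV t u₀ u₁) from funext hΦ0]; exact hV)
      _ = 2 * ε := by
          rw [← mul_assoc, ENNReal.inv_mul_cancel (by norm_num) (by norm_num), one_mul, two_mul]
  obtain ⟨u, hu, hfix, hS⟩ := exists_fixedPoint_of_contraction hq hr hεt
    (fun u hu => isPath_duhamelMap (κ := κ) h hT h₀ h₁ hu) hball hcontr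
  refine ⟨u, hu, hfix, fun hr₀ hr₁ => hS {f | IsRealValued (coeffs f)} ?_ ?_ fun w hw hwr t ht => ?_⟩
  · exact IsSeqClosed.isClosed fun f g hf hfg => isRealValued_of_tendsto hfg hf
  · have := coeffs_sub (0 : L2) 0
    rw [sub_self, sub_self] at this
    change IsRealValued (coeffs (0 : L2))
    rw [this]
    exact isRealValued_zero
  · change IsRealValued _
    rw [coeffs_duhamelMap h hT ht h₀ h₁ hw]
    exact (isRealValued_propV hr₀ hr₁).sub ((isRealValued_causalConv kerS_neg fun τ hτ =>
      isRealValued_source (hwr τ hτ)).smul κ)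

end

section

variable {p s q r : ℝ}

/-! ### Uniqueness and the solution class -/

/-- Uniqueness: two solutions of the Duhamel formula agree on successive short intervals, on which
the Duhamel map is a contraction. -/
theorem eq_of_fixedPoint (h : Admissible p s q r) {κ T : ℝ} (hκ : ‖(κ : ℂ)‖ₑ = 1) (hT : T ≤ 1)
    {u₀ u₁ : Dist} {u w : ℝ → L2} (hu : IsPath q r T u) (hw : IsPath q r T w) (h0 : u 0 = w 0)
    (hfu : ∀ t ∈ Icc 0 T, duhamelMap κ p T u₀ u₁ u t = u t)
    (hfw : ∀ t ∈ Icc 0 T, duhamelMap κ p T u₀ u₁ w t = w t) : ∀ t ∈ Icc 0 T, u t = w t := by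
  have hq : 0 < q := by linarith [h.two_le_q]
  obtain ⟨K, hK⟩ := duhamel_sub_le h
  obtain ⟨ε, hε0, hεt, hKε⟩ := exists_contraction_radius K (e := p - 1) (by linarith [h.one_lt_p])
  obtain ⟨δ₁, hδ₁, hsu⟩ := exists_timeNorm_le hq hu.2 hε0
  obtain ⟨δ₂, hδ₂, hsw⟩ := exists_timeNorm_le hq hw.2 hε0
  set δ := min δ₁ δ₂
  have hδ : 0 < δ := lt_min hδ₁ hδ₂
  have hdiff : ∀ t ∈ Icc 0 T, u t - w t = (-κ : ℂ) • (toL2 (causalConv kerS T (source p u) t)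
      - toL2 (causalConv kerS T (source p w) t)) := fun t ht => by
    rw [← hfu t ht, ← hfw t ht]
    simp only [duhamelMap, neg_smul, smul_sub]; abel
  have hκ' : ‖(-κ : ℂ)‖ₑ = 1 := by rw [enorm_neg, hκ]
  have hmain : ∀ k : ℕ, ∀ t ∈ Icc 0 T, t ≤ k * δ → u t = w t := by
    intro k
    induction k with
    | zero =>
      intro t ht htk
      have : t = 0 := le_antisymm (by simpa using htk) ht.1
      rw [this, h0]
    | succ k ih =>
      intro t₁ ht₁ htk
      rcases le_or_gt t₁ (k * δ) with hle | hgt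
      · exact ih t₁ ht₁ hle
      set t₀ := k * δ
      have ht₀ : 0 ≤ t₀ := by positivity
      have hlen : t₁ - t₀ ≤ δ := by
        push_cast at htk; simp only [t₀]; linarith
      obtain ⟨e1, e2⟩ := hK T t₀ t₁ u w hT ht₀ ht₁.2 hu hw fun t ht =>
        ih t ⟨ht.1, (ht.2.le.trans hgt.le).trans ht₁.2⟩ ht.2.le
      set X : (ℝ → L2) → ℝ≥0∞ := timeNorm q r (volume.restrict (Icc t₀ t₁)) with hX
      have hfac : K * (X (fun t => u t - w t) * (X u + X w) ^ (p - 1))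
          ≤ 2⁻¹ * X (fun t => u t - w t) := by
        calc _ ≤ K * (X (fun t => u t - w t) * (4 * ε) ^ (p - 1)) := by
              refine mul_le_mul_right (mul_le_mul_right (ENNReal.rpow_le_rpow ?_
                (by linarith [h.one_lt_p])) _) _
              refine (add_le_add (hsu t₀ t₁ ht₀ ht₁.2 (hlen.trans (min_le_left _ _)))
                (hsw t₀ t₁ ht₀ ht₁.2 (hlen.trans (min_le_right _ _)))).trans ?_
              rw [← two_mul]
              exact mul_le_mul_left (by norm_num) _
          _ = (K * (4 * ε) ^ (p - 1)) * X (fun t => u t - w t) := by ring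
          _ ≤ _ := mul_le_mul_left hKε _
      have hXeq : X (fun t => u t - w t) = X fun t => toL2 (causalConv kerS T (source p u) t)
          - toL2 (causalConv kerS T (source p w) t) := by
        rw [hX, timeNorm_congr fun t ht => hdiff t ⟨ht₀.trans ht.1, ht.2.trans ht₁.2⟩,
          timeNorm_smul hq, hκ', one_mul]
      have hXfin : X (fun t => u t - w t) ≠ ∞ :=
        ((timeNorm_mono hq (restrict_le ht₀ ht₁.2) _).trans_lt
          (hu.sub (by linarith [h.two_le_q]) (by linarith [h.two_lt_r]) hw).2).ne
      -- the difference is at most half of itself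
      have hX0 : X (fun t => u t - w t) = 0 := by
        by_contra hne
        refine absurd (hXeq.trans_le (e1.trans hfac)) (not_le.2 ?_)
        rw [mul_comm, ← div_eq_mul_inv]
        exact ENNReal.half_lt_self hne hXfin
      have e3 := (eH_mono_exp h.s_nonneg _).trans
        ((e2 t₁ ⟨hgt.le, le_rfl⟩).trans (hfac.trans (by rw [hX0, mul_zero])))
      have ht1 := ht₁.2.trans hT
      have e4 : ‖u t₁ - w t₁‖ₑ = 0 := by
        rw [hdiff t₁ ht₁, enorm_smul, hκ', one_mul, ← eH_zero_coeffs, coeffs_sub,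
          coeffs_toL2 (eH_zero_causalConv_lt_top h.s_nonneg ht1 (hu.isSource h hT)),
          coeffs_toL2 (eH_zero_causalConv_lt_top h.s_nonneg ht1 (hw.isSource h hT))]
        exact le_antisymm e3 zero_le
      rwa [enorm_eq_zero, sub_eq_zero] at e4
  intro t ht
  obtain ⟨k, hk⟩ := exists_nat_ge (t / δ)
  exact hmain k t ht ((div_le_iff₀ hδ).1 hk)

/-- The time derivative of the solution of the Duhamel formula. -/
def velocity (κ p T : ℝ) (u₀ u₁ : Dist) (u : ℝ → L2) (t : ℝ) : Dist :=
  propVderiv t u₀ u₁ - (κ : ℂ) • causalConv kerD T (source p u) t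

theorem propV_zero (φ₀ φ₁ : Dist) : propV 0 φ₀ φ₁ = φ₀ := by
  funext n; simp [propV, propS, symbolC, symbolS]

theorem propVderiv_zero (φ₀ φ₁ : Dist) : propVderiv 0 φ₀ φ₁ = φ₁ := by
  funext n; simp [propVderiv, symbolD, symbolS]

theorem causalConv_zero {k : Freq → ℝ → ℝ} {m : ℝ} (hk : IsCausal k m) {T : ℝ} (F : ℝ → Dist) :
    causalConv k T F 0 = 0 := by
  funext n
  refine setIntegral_eq_zero_of_ae_eq_zero ?_
  have : ∀ᵐ τ : ℝ, τ ≠ 0 := by simp [ae_iff]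
  filter_upwards [this] with τ hτ0 hτ
  rw [hk.eq_zero n _ (by have := lt_of_le_of_ne hτ.1 (Ne.symm hτ0); linarith)]
  simp

theorem coeffs_eq_of_fixedPoint (h : Admissible p s q r) {κ T t : ℝ} (hT : T ≤ 1)
    {u₀ u₁ : Dist} (h₀ : eH s u₀ < ∞) (h₁ : eH (s - 1) u₁ < ∞) {u : ℝ → L2}
    (hu : IsPath q r T u) (hfu : ∀ t ∈ Icc 0 T, duhamelMap κ p T u₀ u₁ u t = u t)
    (ht : t ∈ Icc 0 T) :
    coeffs (u t) = propV t u₀ u₁ - (κ : ℂ) • causalConv kerS T (source p u) t := by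
  rw [← coeffs_duhamelMap h hT ht h₀ h₁ hu, hfu t ht]

theorem hasDerivWithinAt_of_fixedPoint (h : Admissible p s q r) {κ T t : ℝ} (hT : T ≤ 1)
    {u₀ u₁ : Dist} (h₀ : eH s u₀ < ∞) (h₁ : eH (s - 1) u₁ < ∞) {u : ℝ → L2}
    (hu : IsPath q r T u) (hfu : ∀ t ∈ Icc 0 T, duhamelMap κ p T u₀ u₁ u t = u t)
    (ht : t ∈ Icc 0 T) (n : Freq) : HasDerivWithinAt (fun τ => coeffs (u τ) n)
      (velocity κ p T u₀ u₁ u t n) (Icc 0 T) t := by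
  have h1 := (hasDerivAt_propV t u₀ u₁ n).fun_sub ((hasDerivAt_causalConv_kerS (ht.2.trans hT)
    ((hu.isSource h hT).integrable n)).const_mul (κ : ℂ))
  refine h1.hasDerivWithinAt.congr (fun τ hτ => ?_) ?_
  · rw [coeffs_eq_of_fixedPoint h hT h₀ h₁ hu hfu hτ]; rfl
  · rw [coeffs_eq_of_fixedPoint h hT h₀ h₁ hu hfu ht]; rfl

theorem isSolution_of_fixedPoint (h : Admissible p s q r) {κ T : ℝ} (hT₀ : 0 ≤ T) (hT : T ≤ 1)
    {u₀ u₁ : Dist} (h₀ : eH s u₀ < ∞) (h₁ : eH (s - 1) u₁ < ∞) {u : ℝ → L2}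
    (hu : IsPath q r T u) (hfu : ∀ t ∈ Icc 0 T, duhamelMap κ p T u₀ u₁ u t = u t) :
    IsSolution κ p T u₀ u₁ u (velocity κ p T u₀ u₁ u) where
  init_fst := by
    rw [coeffs_eq_of_fixedPoint h hT h₀ h₁ hu hfu ⟨le_rfl, hT₀⟩, propV_zero,
      causalConv_zero isCausal_kerS, smul_zero, sub_zero]
  init_snd := by
    rw [velocity, propVderiv_zero, causalConv_zero isCausal_kerD, smul_zero, sub_zero]
  integrable := lintegral_nonlin_lt_top h hT hu.1 hu.2
  duhamel t ht n := by
    rw [coeffs_eq_of_fixedPoint h hT h₀ h₁ hu hfu ht, Pi.sub_apply, Pi.smul_apply,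
      causalConv_kerS_eq ht]
    rfl

theorem fixedPoint_of_isSolution (h : Admissible p s q r) {κ T : ℝ} (hT : T ≤ 1)
    {u₀ u₁ : Dist} (h₀ : eH s u₀ < ∞) (h₁ : eH (s - 1) u₁ < ∞) {u : ℝ → L2} {v : ℝ → Dist}
    (hu : IsPath q r T u) (hsol : IsSolution κ p T u₀ u₁ u v) :
    ∀ t ∈ Icc 0 T, duhamelMap κ p T u₀ u₁ u t = u t := fun t ht => by
  refine eq_of_coeffs_eq ?_
  rw [coeffs_duhamelMap h hT ht h₀ h₁ hu]
  funext n
  rw [hsol.duhamel t ht n, Pi.sub_apply, Pi.smul_apply, causalConv_kerS_eq ht]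
  rfl

theorem isRealValued_velocity {κ T t : ℝ} {u₀ u₁ : Dist} (h₀ : IsRealValued u₀)
    (h₁ : IsRealValued u₁) {u : ℝ → L2} (hu : ∀ t ∈ Icc 0 T, IsRealValued (coeffs (u t))) :
    IsRealValued (velocity κ p T u₀ u₁ u t) :=
  (isRealValued_propVderiv h₀ h₁).sub ((isRealValued_causalConv kerD_neg fun τ hτ =>
    isRealValued_source (hu τ hτ)).smul κ)

/-- The solution of the Duhamel formula is as regular as the Duhamel terms of its source. -/
theorem inSolutionClass_of_fixedPoint (h : Admissible p s q r) {s' κ T : ℝ} (hT : T ≤ 1)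
    {u₀ u₁ : Dist} (hss : s ≤ s') (h₀ : eH s' u₀ < ∞) (h₁ : eH (s' - 1) u₁ < ∞) {u : ℝ → L2}
    (hu : IsPath q r T u) (hfu : ∀ t ∈ Icc 0 T, duhamelMap κ p T u₀ u₁ u t = u t)
    (hS : ContinuousInSobolev s' T (causalConv kerS T (source p u)))
    (hD : ContinuousInSobolev (s' - 1) T (causalConv kerD T (source p u))) :
    InSolutionClass s' q r T u (velocity κ p T u₀ u₁ u) := by
  have h₀' := (eH_mono_exp hss _).trans_lt h₀
  have h₁' := (eH_mono_exp (sub_le_sub_right hss 1) _).trans_lt h₁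
  refine ⟨?_, ?_, fun n t ht => hasDerivWithinAt_of_fixedPoint h hT h₀' h₁' hu hfu ht n,
    (memLqLr_iff (by linarith [h.two_le_q])).2 hu.2⟩
  · refine ((continuousInSobolev_propV hT h₀ h₁).add (hS.smul (-κ))).congr fun t ht => ?_
    rw [coeffs_eq_of_fixedPoint h hT h₀' h₁' hu hfu ht, neg_smul, sub_eq_add_neg]
  · refine ((continuousInSobolev_propVderiv hT h₀ h₁).add (hD.smul (-κ))).congr fun t ht => ?_
    rw [velocity, neg_smul, sub_eq_add_neg]

/-- Well-posedness for data in `H^{s'} × H^{s'-1}` in the solution class of exponents that are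
admissible at a regularity `s ≤ s'`, given that solutions inherit the regularity `s'`. -/
theorem wellPosed_of_regularity (h : Admissible p s q r) {s' κ : ℝ} (hss : s ≤ s')
    (hκ : ‖(κ : ℂ)‖ₑ = 1)
    (hreg : ∀ (T : ℝ) (u₀ u₁ : Dist) (u : ℝ → L2), T ≤ 1 → eH s' u₀ < ∞ → eH (s' - 1) u₁ < ∞ →
      IsPath q r T u → (∀ t ∈ Icc 0 T, duhamelMap κ p T u₀ u₁ u t = u t) →
      ContinuousInSobolev s' T (causalConv kerS T (source p u)) ∧
      ContinuousInSobolev (s' - 1) T (causalConv kerD T (source p u)))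
    {u₀ u₁ : Dist} (h₀ : eH s' u₀ < ∞) (h₁ : eH (s' - 1) u₁ < ∞) :
    ∃ T : ℝ, 0 < T ∧ T ≤ 1 ∧ ∃ (u : ℝ → L2) (v : ℝ → Dist), InSolutionClass s' q r T u v ∧
      IsSolution κ p T u₀ u₁ u v ∧
      (∀ (u' : ℝ → L2) (v' : ℝ → Dist), InSolutionClass s' q r T u' v' →
        IsSolution κ p T u₀ u₁ u' v' → ∀ t ∈ Icc 0 T, u' t = u t ∧ v' t = v t) ∧
      (IsRealValued u₀ → IsRealValued u₁ → ∀ t ∈ Icc 0 T,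
        IsRealValued (coeffs (u t)) ∧ IsRealValued (v t)) := by
  have h₀' := (eH_mono_exp hss _).trans_lt h₀
  have h₁' := (eH_mono_exp (sub_le_sub_right hss 1) _).trans_lt h₁
  obtain ⟨T, hT0, hT, u, hu, hfu, hreal⟩ := exists_fixedPoint h hκ h₀' h₁'
  obtain ⟨hS, hD⟩ := hreg T u₀ u₁ u hT h₀ h₁ hu hfu
  have hsol := isSolution_of_fixedPoint h hT0.le hT h₀' h₁' hu hfu
  refine ⟨T, hT0, hT, u, _, inSolutionClass_of_fixedPoint h hT hss h₀ h₁ hu hfu hS hD, hsol,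
    fun u' v' hc' hsol' => ?_, fun hr₀ hr₁ t ht =>
      ⟨hreal hr₀ hr₁ t ht, isRealValued_velocity hr₀ hr₁ (hreal hr₀ hr₁)⟩⟩
  have hu' : IsPath q r T u' :=
    ⟨continuousOn_of_continuousInSobolev (h.s_nonneg.trans hss) hc'.continuous_fst,
      (memLqLr_iff (by linarith [h.two_le_q])).1 hc'.mem_LqLr⟩
  have heq := eq_of_fixedPoint h hκ hT hu' hu
    (eq_of_coeffs_eq (hsol'.init_fst.trans hsol.init_fst.symm))
    (fixedPoint_of_isSolution h hT h₀' h₁' hu' hsol') hfu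
  refine fun t ht => ⟨heq t ht, funext fun n => ?_⟩
  have e1 := hasDerivWithinAt_of_fixedPoint h hT h₀' h₁' hu hfu ht n
  have e2 := (hc'.deriv_eq n t ht).congr (f₁ := fun τ => coeffs (u τ) n)
    (fun τ hτ => by simp only [heq τ hτ]) (by simp only [heq t ht])
  exact (uniqueDiffOn_Icc hT0 t ht).eq_deriv _ e2 e1

end

section

open scoped ContDiff

/-! ### Derivatives along the coordinate directions of the torus -/

/-- The point of the torus with `e`-th coordinate `t` and other coordinate zero. -/
def shift (e : Fin 2) (t : ℝ) : Torus := Pi.single e (t : UnitAddCircle)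

theorem shift_zero (e : Fin 2) : shift e 0 = 0 := by simp [shift]

theorem shift_add (e : Fin 2) (t t' : ℝ) : shift e (t + t') = shift e t + shift e t' := by
  rw [shift, shift, shift, AddCircle.coe_add, Pi.single_add]

/-- The symbol of the partial derivative `∂_e`. -/
def dsymbol (e : Fin 2) (n : Freq) : ℂ := 2 * Real.pi * Complex.I * n e

theorem mFourier_shift (n : Freq) (e : Fin 2) (t : ℝ) :
    UnitAddTorus.mFourier n (shift e t) = Complex.exp (dsymbol e n * t) := by
  simp only [UnitAddTorus.mFourier, ContinuousMap.coe_mk, shift]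
  rw [Finset.prod_eq_single e]
  · rw [Pi.single_eq_same, fourier_coe_apply, dsymbol]; congr 1; push_cast; ring
  · intro i _ hi
    rw [Pi.single_eq_of_ne hi, fourier_eval_zero]
  · simp

theorem mFourier_add_apply (n : Freq) (x y : Torus) :
    UnitAddTorus.mFourier n (x + y) = UnitAddTorus.mFourier n x * UnitAddTorus.mFourier n y := by
  simp only [UnitAddTorus.mFourier, ContinuousMap.coe_mk, Pi.add_apply, ← Finset.prod_mul_distrib]
  refine Finset.prod_congr rfl fun i _ => ?_
  rw [fourier_apply, smul_add, AddCircle.toCircle_add, Circle.coe_mul, fourier_apply, fourier_apply]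

/-- `G` is the partial derivative `∂_e F` at every point. -/
def HasDerivAlong (e : Fin 2) (F G : C(Torus, ℂ)) : Prop :=
  ∀ x, HasDerivAt (fun t : ℝ => F (x + shift e t)) (G x) 0

theorem HasDerivAlong.hasDerivAt {e : Fin 2} {F G : C(Torus, ℂ)} (h : HasDerivAlong e F G)
    (x : Torus) (t : ℝ) : HasDerivAt (fun t : ℝ => F (x + shift e t)) (G (x + shift e t)) t := by
  have h1 := h (x + shift e t)
  rw [← sub_self t] at h1
  refine (h1.comp_sub_const t t).congr_of_eventuallyEq (Eventually.of_forall fun y => ?_)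
  simp only
  rw [add_assoc, ← shift_add, add_sub_cancel]

theorem hasDerivAt_mFourier_shift (n : Freq) (e : Fin 2) (t : ℝ) :
    HasDerivAt (fun t : ℝ => UnitAddTorus.mFourier n (shift e t))
      (dsymbol e n * UnitAddTorus.mFourier n (shift e t)) t := by
  simp only [mFourier_shift]
  have h := (((hasDerivAt_id t).ofReal_comp).const_mul (dsymbol e n)).cexp
  simpa [mul_comm] using h

theorem coeffs_of_hasDerivAlong {e : Fin 2} {F G : C(Torus, ℂ)} (h : HasDerivAlong e F G)
    (n : Freq) : coeffs G n = dsymbol e n * coeffs F n := by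
  have hint : ∀ f : C(Torus, ℂ), Integrable f torusMeasure := fun f =>
    Integrable.of_bound f.continuous.aestronglyMeasurable ‖f‖
      (Eventually.of_forall fun x => f.norm_coe_le_norm x)
  have e1 : HasDerivAt (fun t : ℝ => ∫ x, UnitAddTorus.mFourier (-n) x * F (x + shift e t)
      ∂torusMeasure) (∫ x, UnitAddTorus.mFourier (-n) x * G (x + shift e 0) ∂torusMeasure) 0 := by
    refine (hasDerivAt_integral_of_dominated_loc_of_deriv_le (s := univ) (bound := fun _ => ‖G‖)
      (F := fun (t : ℝ) x => UnitAddTorus.mFourier (-n) x * F (x + shift e t))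
      (F' := fun (t : ℝ) x => UnitAddTorus.mFourier (-n) x * G (x + shift e t))
      univ_mem ?_ ?_ ?_ ?_ (integrable_const _) ?_).2
    · refine Eventually.of_forall fun t => Continuous.aestronglyMeasurable ?_
      fun_prop
    · exact hint ⟨fun x => UnitAddTorus.mFourier (-n) x * F (x + shift e 0), by fun_prop⟩
    · refine Continuous.aestronglyMeasurable ?_
      fun_prop
    · refine Eventually.of_forall fun x t _ => ?_
      rw [norm_mul, mFourier_norm_apply, one_mul]
      exact G.norm_coe_le_norm _
    · exact Eventually.of_forall fun x t _ => (h.hasDerivAt x t).const_mul _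
  have e2 : (fun t : ℝ => ∫ x, UnitAddTorus.mFourier (-n) x * F (x + shift e t) ∂torusMeasure)
      = fun t => UnitAddTorus.mFourier n (shift e t) * coeffs F n := by
    funext t
    rw [coeffs_eq, ← integral_const_mul, ← integral_add_right_eq_self (μ := torusMeasure)
      (fun x => UnitAddTorus.mFourier n (shift e t) * (UnitAddTorus.mFourier (-n) x * F x))
      (shift e t)]
    refine integral_congr_ae (Eventually.of_forall fun x => ?_)
    simp only
    rw [mFourier_add_apply]
    have h3 : UnitAddTorus.mFourier n (shift e t) * UnitAddTorus.mFourier (-n) (shift e t) = 1 := by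
      rw [← UnitAddTorus.mFourier_add, add_neg_cancel, UnitAddTorus.mFourier_zero]; rfl
    linear_combination (UnitAddTorus.mFourier (-n) x * F (x + shift e t)) * (-h3)
  rw [e2] at e1
  have e3 := (hasDerivAt_mFourier_shift n e 0).mul_const (coeffs F n)
  have e4 := e1.unique e3
  simp only [shift_zero, add_zero] at e4
  rw [coeffs_eq, e4]
  have : UnitAddTorus.mFourier n (0 : Torus) = 1 := by
    have := mFourier_shift n e 0
    simpa [shift_zero] using this
  rw [this, mul_one]

theorem integral_eq_zero_of_hasDerivAlong {e : Fin 2} {F G : C(Torus, ℂ)}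
    (h : HasDerivAlong e F G) : ∫ x, G x ∂torusMeasure = 0 := by
  have := coeffs_of_hasDerivAlong h 0
  rw [coeffs_eq] at this
  simpa [dsymbol, UnitAddTorus.mFourier_zero] using this

/-- The coefficients of the partial derivative `∂_e`. -/
def deriv1 (e : Fin 2) (a : Dist) : Dist := fun n => dsymbol e n * a n

theorem hasDerivAlong_trigPoly (e : Fin 2) (S : Finset Freq) (a : Dist) :
    HasDerivAlong e (trigPoly S a) (trigPoly S (deriv1 e a)) := fun x => by
  simp only [trigPoly_apply, mFourier_add_apply]
  refine HasDerivAt.fun_sum fun n _ => ?_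
  have h := (((hasDerivAt_mFourier_shift n e 0).const_mul (UnitAddTorus.mFourier n x)).const_mul
    (a n))
  refine h.congr_deriv ?_
  have : UnitAddTorus.mFourier n (shift e 0) = 1 := by rw [mFourier_shift]; simp
  rw [this, deriv1]; ring

theorem contDiff_trigPoly_shift (e : Fin 2) (S : Finset Freq) (a : Dist) (x : Torus) :
    ContDiff ℝ ∞ fun t : ℝ => trigPoly S a (x + shift e t) := by
  simp only [trigPoly_apply, mFourier_add_apply, mFourier_shift]
  refine ContDiff.sum fun n _ => contDiff_const.mul (contDiff_const.mul ?_)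
  exact (contDiff_const.mul Complex.ofRealCLM.contDiff).cexp

/-- All derivatives along a coordinate direction of a smooth function of a trigonometric
polynomial exist and are continuous on the torus. -/
theorem exists_derivSeq (e : Fin 2) {Ψ : ℂ → ℂ} (hΨ : ContDiff ℝ ∞ Ψ) (S : Finset Freq) (a : Dist) :
    ∃ G : ℕ → C(Torus, ℂ), (∀ x, G 0 x = Ψ (trigPoly S a x)) ∧
      ∀ k, HasDerivAlong e (G k) (G (k + 1)) := by
  -- the torus is embedded in a finite dimensional space on which translations act linearly
  set w : Torus → S → ℂ := fun x n => UnitAddTorus.mFourier n.1 x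
  have hw : Continuous w := continuous_pi fun n => (UnitAddTorus.mFourier n.1).continuous
  set L : (S → ℂ) →L[ℝ] (S → ℂ) := ContinuousLinearMap.pi fun n =>
    ((ContinuousLinearMap.mul ℝ ℂ (dsymbol e n.1)).comp (ContinuousLinearMap.proj n))
  have hL : ∀ v n, L v n = dsymbol e n.1 * v n := fun v n => rfl
  have hcurve : ∀ x, HasDerivAt (fun t : ℝ => w (x + shift e t)) (L (w x)) 0 := fun x => by
    rw [hasDerivAt_pi]
    intro n
    have h := ((hasDerivAt_mFourier_shift n.1 e 0).const_mul (UnitAddTorus.mFourier n.1 x))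
    simp only [w, mFourier_add_apply, hL]
    refine h.congr_deriv ?_
    have : UnitAddTorus.mFourier n.1 (shift e 0) = 1 := by rw [mFourier_shift]; simp
    rw [this]; ring
  set step : {Φ : (S → ℂ) → ℂ // ContDiff ℝ ∞ Φ} → {Φ : (S → ℂ) → ℂ // ContDiff ℝ ∞ Φ} :=
    fun Φ => ⟨fun v => fderiv ℝ Φ.1 v (L v),
      (Φ.2.fderiv_right (m := ∞) (by simp)).clm_apply L.contDiff⟩
  set Φ₀ : {Φ : (S → ℂ) → ℂ // ContDiff ℝ ∞ Φ} := ⟨fun v => Ψ (∑ n : S, a n.1 * v n),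
    hΨ.comp (ContDiff.sum fun n _ => contDiff_const.mul (contDiff_apply ℝ ℂ n))⟩
  set Φ : ℕ → {Φ : (S → ℂ) → ℂ // ContDiff ℝ ∞ Φ} := fun k => step^[k] Φ₀
  have hΦs : ∀ k v, (Φ (k + 1)).1 v = fderiv ℝ (Φ k).1 v (L v) := fun k v => by
    simp only [Φ, Function.iterate_succ_apply']; rfl
  refine ⟨fun k => ⟨fun x => (Φ k).1 (w x), (Φ k).2.continuous.comp hw⟩, fun x => ?_,
    fun k x => ?_⟩
  · simp only [ContinuousMap.coe_mk, Φ, Function.iterate_zero, id, Φ₀, w]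
    rw [trigPoly_apply, Finset.sum_coe_sort S fun n => a n * UnitAddTorus.mFourier n x]
  · simp only [ContinuousMap.coe_mk, hΦs]
    have h1 : HasFDerivAt (Φ k).1 (fderiv ℝ (Φ k).1 (w x)) (w (x + shift e 0)) := by
      rw [shift_zero, add_zero]
      exact ((Φ k).2.differentiable (by simp) _).hasFDerivAt
    exact h1.comp_hasDerivAt 0 (hcurve x)

theorem iteratedDeriv_of_derivSeq {e : Fin 2} {G : ℕ → C(Torus, ℂ)}
    (hG : ∀ k, HasDerivAlong e (G k) (G (k + 1))) (k : ℕ) (x : Torus) (t : ℝ) :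
    iteratedDeriv k (fun t : ℝ => G 0 (x + shift e t)) t = G k (x + shift e t) := by
  induction k generalizing t with
  | zero => simp
  | succ k ih =>
    rw [iteratedDeriv_succ, funext ih]
    exact ((hG k).hasDerivAt x t).deriv

theorem coeffs_of_derivSeq {e : Fin 2} {G : ℕ → C(Torus, ℂ)}
    (hG : ∀ k, HasDerivAlong e (G k) (G (k + 1))) (k : ℕ) (n : Freq) :
    coeffs (G k) n = dsymbol e n ^ k * coeffs (G 0) n := by
  induction k with
  | zero => simp
  | succ k ih => rw [coeffs_of_hasDerivAlong (hG k), ih, pow_succ]; ring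

end

/-! ### The gradient on small level sets -/

theorem integrable_continuousMap {E : Type*} [NormedAddCommGroup E] (f : C(Torus, E)) :
    Integrable f torusMeasure :=
  Integrable.of_bound f.continuous.aestronglyMeasurable ‖f‖
    (Eventually.of_forall fun x => f.norm_coe_le_norm x)

/-- For `g = Re f`, the derivative of `∂_e g · ρ arctan (g / ρ)` has mean zero and contains
`(∂_e g)² / (1 + (g / ρ)²)`, which is comparable to `(∂_e g)²` on the strip. -/
theorem integral_strip_re_le {e : Fin 2} {f f₁ f₂ : C(Torus, ℂ)} (h₁ : HasDerivAlong e f f₁)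
    (h₂ : HasDerivAlong e f₁ f₂) {ρ : ℝ} (hρ : 0 < ρ) :
    ∫ x, {x | ‖f x‖ ≤ ρ}.indicator (fun x => (f₁ x).re ^ 2) x ∂torusMeasure
      ≤ Real.pi * ρ * ∫ x, ‖f₂ x‖ ∂torusMeasure := by
  set θ : Torus → ℝ := fun x => ρ * Real.arctan ((f x).re / ρ)
  set g : Torus → ℝ := fun x => (f₁ x).re ^ 2 / (1 + ((f x).re / ρ) ^ 2)
  have hθc : Continuous θ := continuous_const.mul
    (Real.continuous_arctan.comp ((Complex.continuous_re.comp f.continuous).div_const ρ))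
  have hden : ∀ x, 0 < 1 + ((f x).re / ρ) ^ 2 := fun x => by positivity
  have hgc : Continuous g := ((Complex.continuous_re.comp f₁.continuous).pow 2).div
    (continuous_const.add (((Complex.continuous_re.comp f.continuous).div_const ρ).pow 2))
    fun x => (hden x).ne'
  have hre : ∀ {F G : C(Torus, ℂ)}, HasDerivAlong e F G → ∀ x,
      HasDerivAt (fun t : ℝ => (F (x + shift e t)).re) (G x).re 0 := fun h x =>
    Complex.reCLM.hasFDerivAt.comp_hasDerivAt (0 : ℝ) (h x)
  -- the flux `f₁ · ρ arctan (f / ρ)` has mean zero derivative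
  set F : C(Torus, ℂ) := ⟨fun x => (((f₁ x).re * θ x : ℝ) : ℂ), by fun_prop⟩
  set G : C(Torus, ℂ) := ⟨fun x => (((f₂ x).re * θ x + g x : ℝ) : ℂ), by fun_prop⟩
  have hFG : HasDerivAlong e F G := fun x => by
    have e1 := hre h₁ x
    have e2 := hre h₂ x
    have e3 := ((e1.div_const ρ).arctan).const_mul ρ
    have e4 := (e2.fun_mul e3).ofReal_comp
    refine e4.congr_deriv ?_
    simp only [G, ContinuousMap.coe_mk, shift_zero, add_zero, θ, g]
    congr 1
    field_simp
  have h0 := integral_eq_zero_of_hasDerivAlong hFG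
  have h0' : ∫ x, ((f₂ x).re * θ x + g x) ∂torusMeasure = 0 := by
    have : ((∫ x, ((f₂ x).re * θ x + g x) ∂torusMeasure : ℝ) : ℂ) = 0 := by
      rw [← integral_complex_ofReal]; exact h0
    exact_mod_cast this
  have hig : Integrable g torusMeasure := integrable_continuousMap (⟨g, hgc⟩ : C(Torus, ℝ))
  have hif : Integrable (fun x => (f₂ x).re * θ x) torusMeasure :=
    integrable_continuousMap (⟨fun x => (f₂ x).re * θ x, by fun_prop⟩ : C(Torus, ℝ))
  have hin : Integrable (fun x => ‖f₂ x‖) torusMeasure := (integrable_continuousMap f₂).norm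
  rw [integral_add hif hig] at h0'
  have hθ : ∀ x, |θ x| ≤ ρ * (Real.pi / 2) := fun x => by
    rw [abs_mul, abs_of_pos hρ]
    refine mul_le_mul_of_nonneg_left ?_ hρ.le
    rw [abs_le]
    exact ⟨(Real.neg_pi_div_two_lt_arctan _).le, (Real.arctan_lt_pi_div_two _).le⟩
  have hflux : -∫ x, (f₂ x).re * θ x ∂torusMeasure
      ≤ ρ * (Real.pi / 2) * ∫ x, ‖f₂ x‖ ∂torusMeasure := by
    rw [← integral_neg, ← integral_const_mul]
    refine integral_mono hif.neg (hin.const_mul _) fun x => ?_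
    refine (neg_le_abs _).trans ?_
    rw [abs_mul, mul_comm]
    exact mul_le_mul (hθ x) (Complex.abs_re_le_norm _) (abs_nonneg _) (by positivity)
  -- the weight in `g` is at least one half on the strip
  have hstrip : ∫ x, {x | ‖f x‖ ≤ ρ}.indicator (fun x => (f₁ x).re ^ 2) x ∂torusMeasure
      ≤ ∫ x, 2 * g x ∂torusMeasure := by
    refine integral_mono_of_nonneg (Eventually.of_forall fun x =>
      indicator_nonneg (fun _ _ => sq_nonneg _) x) (hig.const_mul 2)
      (Eventually.of_forall fun x => ?_)
    by_cases hx : ‖f x‖ ≤ ρ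
    · rw [indicator_of_mem (show x ∈ {x | ‖f x‖ ≤ ρ} from hx)]
      have h3 : ((f x).re / ρ) ^ 2 ≤ 1 := by
        rw [sq_le_one_iff_abs_le_one, abs_div, abs_of_pos hρ, div_le_one hρ]
        exact (Complex.abs_re_le_norm _).trans hx
      simp only [g]
      rw [← mul_div_assoc, le_div_iff₀ (hden x)]
      nlinarith [sq_nonneg (f₁ x).re]
    · rw [indicator_of_notMem (show x ∉ {x | ‖f x‖ ≤ ρ} from hx)]
      have := hden x
      simp only [g]; positivity
  rw [integral_const_mul] at hstrip
  linarith

/-- On the set where `|f| ≤ ρ`, the mean square of `∂_e f` is at most a multiple of `ρ` times the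
`L¹` norm of `∂_e² f`. -/
theorem integral_strip_le {e : Fin 2} {f f₁ f₂ : C(Torus, ℂ)} (h₁ : HasDerivAlong e f f₁)
    (h₂ : HasDerivAlong e f₁ f₂) {ρ : ℝ} (hρ : 0 < ρ) :
    ∫ x, {x | ‖f x‖ ≤ ρ}.indicator (fun x => ‖f₁ x‖ ^ 2) x ∂torusMeasure
      ≤ 2 * Real.pi * ρ * ∫ x, ‖f₂ x‖ ∂torusMeasure := by
  have hm : ∀ {F G : C(Torus, ℂ)}, HasDerivAlong e F G →
      HasDerivAlong e (-Complex.I • F) (-Complex.I • G) := fun h x => (h x).const_mul _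
  have e1 := integral_strip_re_le h₁ h₂ hρ
  have e2 := integral_strip_re_le (hm h₁) (hm h₂) hρ
  simp only [ContinuousMap.smul_apply, smul_eq_mul, norm_mul, norm_neg, Complex.norm_I, one_mul]
    at e2
  have hS : MeasurableSet {x : Torus | ‖f x‖ ≤ ρ} :=
    (isClosed_le f.continuous.norm continuous_const).measurableSet
  have hi1 : Integrable ({x | ‖f x‖ ≤ ρ}.indicator fun x => (f₁ x).re ^ 2) torusMeasure :=
    (integrable_continuousMap (⟨fun x => (f₁ x).re ^ 2, by fun_prop⟩ : C(Torus, ℝ))).indicator hS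
  have hi2 : Integrable ({x | ‖f x‖ ≤ ρ}.indicator fun x => (-Complex.I * f₁ x).re ^ 2)
      torusMeasure :=
    (integrable_continuousMap (⟨fun x => (-Complex.I * f₁ x).re ^ 2, by fun_prop⟩ :
      C(Torus, ℝ))).indicator hS
  have e3 : ∀ x, {x | ‖f x‖ ≤ ρ}.indicator (fun x => ‖f₁ x‖ ^ 2) x
      = {x | ‖f x‖ ≤ ρ}.indicator (fun x => (f₁ x).re ^ 2) x
        + {x | ‖f x‖ ≤ ρ}.indicator (fun x => (-Complex.I * f₁ x).re ^ 2) x := fun x => by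
    by_cases hx : x ∈ {x | ‖f x‖ ≤ ρ}
    · simp only [indicator_of_mem hx]
      rw [Complex.sq_norm, Complex.normSq_apply]
      simp only [neg_mul, Complex.neg_re, Complex.mul_re, Complex.I_re, Complex.I_im]
      ring
    · simp only [indicator_of_notMem hx, add_zero]
  simp only [e3]
  rw [integral_add hi1 hi2]
  linarith

/-! ### Sobolev norms through derivatives -/

theorem eH_zero_coeffs_continuousMap (F : C(Torus, ℂ)) :
    eH 0 (coeffs F) = ENNReal.ofReal √(∫ x, ‖F x‖ ^ 2 ∂torusMeasure) := by
  have hae := ContinuousMap.coeFn_toLp (p := 2) (𝕜 := ℂ) torusMeasure F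
  rw [← coeffs_congr_ae hae, eH_zero_coeffs, ← ofReal_norm, @norm_eq_sqrt_re_inner ℂ,
    L2.inner_def]
  congr 2
  have : ∀ᵐ x ∂torusMeasure, inner ℂ (ContinuousMap.toLp (E := ℂ) 2 torusMeasure ℂ F x)
      (ContinuousMap.toLp (E := ℂ) 2 torusMeasure ℂ F x) = ((‖F x‖ ^ 2 : ℝ) : ℂ) := by
    filter_upwards [hae] with x hx
    rw [hx, inner_self_eq_norm_sq_to_K]; norm_cast
  rw [integral_congr_ae this, integral_complex_ofReal]
  simp

theorem norm_dsymbol (e : Fin 2) (n : Freq) : ‖dsymbol e n‖ = 2 * Real.pi * |(n e : ℝ)| := by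
  rw [dsymbol]
  simp [abs_of_pos Real.pi_pos]

theorem abs_le_norm_dsymbol (e : Fin 2) (n : Freq) : |(n e : ℝ)| ≤ ‖dsymbol e n‖ := by
  rw [norm_dsymbol]
  have := Real.pi_gt_three
  nlinarith [abs_nonneg (n e : ℝ)]

theorem norm_dsymbol_le (e : Fin 2) (n : Freq) : ‖dsymbol e n‖ ≤ 7 * bracket n := by
  rw [norm_dsymbol]
  have h1 := (abs_apply_le_freqNorm n e).trans (freqNorm_le_bracket n)
  have := Real.pi_lt_d2
  nlinarith [abs_nonneg (n e : ℝ)]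

theorem rpow_le_interpolate {y l σ : ℝ} {k : ℕ} (hy : 0 ≤ y) (hl : 0 < l) (h1 : 1 ≤ σ)
    (hk : σ ≤ k) : y ^ σ ≤ l ^ (σ - 1) * y + l ^ (σ - k) * y ^ k := by
  rcases hy.eq_or_lt with rfl | hy0
  · rw [Real.zero_rpow (by linarith)]
    have := Real.rpow_pos_of_pos hl (σ - k)
    positivity
  rcases le_total y l with h | h
  · have : y ^ σ = y ^ (σ - 1) * y := by
      rw [← Real.rpow_add_one hy0.ne']; congr 1; ring
    rw [this]
    have h2 := Real.rpow_le_rpow hy h (by linarith : 0 ≤ σ - 1)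
    have h3 := Real.rpow_pos_of_pos hl (σ - k)
    have h4 : 0 ≤ l ^ (σ - k) * y ^ k := by positivity
    nlinarith
  · have : y ^ σ = y ^ (σ - k) * y ^ k := by
      rw [← Real.rpow_natCast, ← Real.rpow_add hy0]; congr 1; ring
    rw [this]
    have h2 := Real.rpow_le_rpow_of_nonpos hl h (by linarith : σ - k ≤ 0)
    have h3 := Real.rpow_pos_of_pos hl (σ - 1)
    have h4 : 0 ≤ l ^ (σ - 1) * y := by positivity
    have h5 : 0 ≤ y ^ k := by positivity
    nlinarith

theorem bracket_rpow_le (n : Freq) {σ : ℝ} (hσ : 0 ≤ σ) :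
    bracket n ^ σ ≤ 3 ^ σ * (1 + ∑ e, |(n e : ℝ)| ^ σ) := by
  have h1 : bracket n ≤ 1 + |(n 0 : ℝ)| + |(n 1 : ℝ)| := by
    rw [bracket, freqNorm_sq, Fin.sum_univ_two]
    refine Real.sqrt_le_iff.2 ⟨by positivity, ?_⟩
    nlinarith [abs_nonneg (n 0 : ℝ), abs_nonneg (n 1 : ℝ), sq_abs (n 0 : ℝ), sq_abs (n 1 : ℝ),
      mul_nonneg (abs_nonneg (n 0 : ℝ)) (abs_nonneg (n 1 : ℝ))]
  set m := max 1 (max |(n 0 : ℝ)| |(n 1 : ℝ)|) with hm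
  have h2 : bracket n ≤ 3 * m := by
    have e1 : 1 ≤ m := le_max_left _ _
    have e2 : |(n 0 : ℝ)| ≤ m := (le_max_left _ _).trans (le_max_right _ _)
    have e3 : |(n 1 : ℝ)| ≤ m := (le_max_right _ _).trans (le_max_right _ _)
    linarith
  have hm0 : 0 ≤ m := zero_le_one.trans (le_max_left _ _)
  have h3 : m ^ σ ≤ 1 + ∑ e, |(n e : ℝ)| ^ σ := by
    rw [Fin.sum_univ_two]
    have p0 : 0 ≤ |(n 0 : ℝ)| ^ σ := by positivity
    have p1 : 0 ≤ |(n 1 : ℝ)| ^ σ := by positivity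
    rcases max_choice 1 (max |(n 0 : ℝ)| |(n 1 : ℝ)|) with h | h <;> rw [hm, h]
    · rw [Real.one_rpow]; linarith
    · rcases max_choice |(n 0 : ℝ)| |(n 1 : ℝ)| with h' | h' <;> rw [h'] <;> linarith
  calc bracket n ^ σ ≤ (3 * m) ^ σ := Real.rpow_le_rpow (bracket_pos n).le h2 hσ
    _ = 3 ^ σ * m ^ σ := Real.mul_rpow (by norm_num) hm0
    _ ≤ _ := mul_le_mul_of_nonneg_left h3 (by positivity)

theorem eH_ofReal_norm (s : ℝ) (a : Dist) : eH s (fun n => ((‖a n‖ : ℝ) : ℂ)) = eH s a := by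
  refine le_antisymm (eH_mono le_rfl fun n => ?_) (eH_mono le_rfl fun n => ?_) <;>
  · rw [← ofReal_norm, ← ofReal_norm, Complex.norm_real, norm_norm]

/-- Sobolev norms through derivatives in the coordinate directions, interpolated at the scale `l`
between the first and the `k`-th order. -/
theorem eH_coeffs_le_of_derivSeq {σ l : ℝ} {k : ℕ} (h1 : 1 ≤ σ) (hk : σ ≤ k) (hl : 0 < l)
    {F : C(Torus, ℂ)} {G : Fin 2 → ℕ → C(Torus, ℂ)} (hG0 : ∀ e, G e 0 = F)
    (hG : ∀ e k, HasDerivAlong e (G e k) (G e (k + 1))) :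
    eH σ (coeffs F) ≤ ENNReal.ofReal (3 ^ σ) * (eH 0 (coeffs F) + ∑ e,
      (ENNReal.ofReal (l ^ (σ - 1)) * eH 0 (coeffs (G e 1))
        + ENNReal.ofReal (l ^ (σ - k)) * eH 0 (coeffs (G e k)))) := by
  set A : Dist → Dist := fun a n => ((‖a n‖ : ℝ) : ℂ)
  have hl1 := Real.rpow_pos_of_pos hl (σ - 1)
  have hlk := Real.rpow_pos_of_pos hl (σ - k)
  set b : Dist := A (coeffs F) + ∑ e, (((l ^ (σ - 1) : ℝ) : ℂ) • A (coeffs (G e 1))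
    + ((l ^ (σ - k) : ℝ) : ℂ) • A (coeffs (G e k)))
  have hb : ∀ n, b n = ((‖coeffs F n‖ + ∑ e, (l ^ (σ - 1) * ‖coeffs (G e 1) n‖
      + l ^ (σ - k) * ‖coeffs (G e k) n‖) : ℝ) : ℂ) := fun n => by
    simp [b, A]
  have h : eH σ (coeffs F) ≤ ENNReal.ofReal (3 ^ σ) * eH 0 b := by
    refine eH_le_mul fun n => ?_
    rw [hb, Real.rpow_zero, ENNReal.ofReal_one, one_mul, ← ofReal_norm, ← ofReal_norm,
      Complex.norm_real, ← ENNReal.ofReal_mul (by positivity [bracket_pos n]),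
      ← ENNReal.ofReal_mul (by positivity)]
    refine ENNReal.ofReal_le_ofReal ?_
    rw [Real.norm_of_nonneg (by positivity)]
    have hbp := bracket_rpow_le n (by linarith : 0 ≤ σ)
    refine (mul_le_mul_of_nonneg_right hbp (norm_nonneg _)).trans ?_
    rw [mul_assoc]
    refine mul_le_mul_of_nonneg_left ?_ (by positivity)
    rw [add_mul, one_mul, Finset.sum_mul]
    refine add_le_add le_rfl (Finset.sum_le_sum fun e _ => ?_)
    have e1 := coeffs_of_derivSeq (hG e) 1 n
    have e2 := coeffs_of_derivSeq (hG e) k n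
    rw [hG0] at e1 e2
    rw [e1, e2, norm_mul, norm_mul, norm_pow, norm_pow, pow_one, ← mul_assoc, ← mul_assoc,
      ← add_mul]
    refine mul_le_mul_of_nonneg_right ?_ (norm_nonneg _)
    refine (Real.rpow_le_rpow (abs_nonneg _) (abs_le_norm_dsymbol e n) (by linarith)).trans ?_
    exact rpow_le_interpolate (norm_nonneg _) hl h1 hk
  refine h.trans (mul_le_mul_right ?_ _)
  have hc : ∀ c : ℝ, 0 < c → ‖(c : ℂ)‖ₑ = ENNReal.ofReal c := fun c hc => by
    rw [← ofReal_norm, Complex.norm_real, Real.norm_of_nonneg hc.le]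
  refine (eH_add_le _ _ _).trans (add_le_add (eH_ofReal_norm 0 _).le ?_)
  rw [Fin.sum_univ_two, Fin.sum_univ_two]
  have hterm : ∀ e, eH 0 (((l ^ (σ - 1) : ℝ) : ℂ) • A (coeffs (G e 1))
      + ((l ^ (σ - k) : ℝ) : ℂ) • A (coeffs (G e k)))
      ≤ ENNReal.ofReal (l ^ (σ - 1)) * eH 0 (coeffs (G e 1))
        + ENNReal.ofReal (l ^ (σ - k)) * eH 0 (coeffs (G e k)) := fun e => by
    refine (eH_add_le _ _ _).trans (add_le_add ?_ ?_)
    · refine (eH_smul_le _ _ _).trans (le_of_eq ?_)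
      rw [hc _ hl1, eH_ofReal_norm]
    · refine (eH_smul_le _ _ _).trans (le_of_eq ?_)
      rw [hc _ hlk, eH_ofReal_norm]
  exact (eH_add_le _ _ _).trans (add_le_add (hterm 0) (hterm 1))

section

open scoped ContDiff

/-! ### Smooth functions of trigonometric polynomials -/

theorem sum_norm_le_eH {c : ℝ} (hc : 1 < c) : ∃ C : ℝ, 0 ≤ C ∧ ∀ (S : Finset Freq) (a : Dist) (M : ℝ),
    0 ≤ M → eH c a ≤ ENNReal.ofReal M → ∑ n ∈ S, ‖a n‖ ≤ C * M := by
  have hsum := summable_bracket hc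
  refine ⟨√(∑' n : Freq, bracket n ^ (-(2 * c))), Real.sqrt_nonneg _, fun S a M hM h => ?_⟩
  have hmem : MemSobolev c a := memSobolev_iff.2 (h.trans_lt ENNReal.ofReal_lt_top)
  have hnorm : √(∑' n, bracket n ^ (2 * c) * ‖a n‖ ^ 2) ≤ M := by
    have := sobolevNorm_eq (s := c) a
    rw [sobolevNorm] at this
    rw [this]
    exact ENNReal.toReal_le_of_le_ofReal hM h
  have e1 : ∀ n, ‖a n‖ = bracket n ^ (-c) * (bracket n ^ c * ‖a n‖) := fun n => by
    rw [← mul_assoc, ← Real.rpow_add (bracket_pos n), neg_add_cancel, Real.rpow_zero, one_mul]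
  have e2 : ∀ n, (bracket n ^ (-c)) ^ 2 = bracket n ^ (-(2 * c)) := fun n => by
    rw [← Real.rpow_natCast, ← Real.rpow_mul (bracket_pos n).le]; congr 1; push_cast; ring
  have e3 : ∀ n, (bracket n ^ c * ‖a n‖) ^ 2 = bracket n ^ (2 * c) * ‖a n‖ ^ 2 := fun n => by
    rw [mul_pow, ← Real.rpow_natCast, ← Real.rpow_mul (bracket_pos n).le]
    congr 2; push_cast; ring
  calc ∑ n ∈ S, ‖a n‖ = ∑ n ∈ S, bracket n ^ (-c) * (bracket n ^ c * ‖a n‖) :=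
        Finset.sum_congr rfl fun n _ => e1 n
    _ ≤ √(∑ n ∈ S, (bracket n ^ (-c)) ^ 2) * √(∑ n ∈ S, (bracket n ^ c * ‖a n‖) ^ 2) :=
        Real.sum_mul_le_sqrt_mul_sqrt _ _ _
    _ ≤ _ := by
        simp only [e2, e3]
        refine mul_le_mul (Real.sqrt_le_sqrt (hsum.sum_le_tsum _ fun n _ =>
          (Real.rpow_pos_of_pos (bracket_pos n) _).le)) ((Real.sqrt_le_sqrt
            (hmem.sum_le_tsum _ fun n _ => ?_)).trans hnorm) (Real.sqrt_nonneg _)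
            (Real.sqrt_nonneg _)
        have := bracket_pos n
        positivity

theorem eH_deriv1_le (σ : ℝ) (e : Fin 2) (a : Dist) : eH σ (deriv1 e a) ≤ 7 * eH (σ + 1) a := by
  refine eH_le_mul fun n => ?_
  have hb := bracket_pos n
  rw [deriv1, enorm_mul, Real.rpow_add_one hb.ne', ENNReal.ofReal_mul (by positivity),
    ← mul_assoc, ← mul_assoc]
  refine mul_le_mul_left ?_ _
  rw [mul_left_comm]
  refine mul_le_mul_right ?_ _
  rw [← ofReal_norm, show (7 : ℝ≥0∞) = ENNReal.ofReal 7 by norm_num,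
    ← ENNReal.ofReal_mul (by norm_num)]
  exact ENNReal.ofReal_le_ofReal (norm_dsymbol_le e n)

theorem eH_deriv1_iterate_le (σ : ℝ) (e : Fin 2) (a : Dist) (i : ℕ) :
    eH σ ((deriv1 e)^[i] a) ≤ 7 ^ i * eH (σ + i) a := by
  induction i generalizing σ with
  | zero => simp
  | succ i ih =>
    rw [Function.iterate_succ_apply']
    refine (eH_deriv1_le σ e _).trans ((mul_le_mul_right (ih (σ + 1)) _).trans (le_of_eq ?_))
    rw [← mul_assoc, ← pow_succ']
    push_cast
    congr 2; ring

theorem eH_coeffs_trigPoly_le (s : ℝ) (S : Finset Freq) (a : Dist) :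
    eH s (coeffs (trigPoly S a)) ≤ eH s a := by
  classical
  refine eH_mono le_rfl fun n => ?_
  rw [coeffs_trigPoly]
  split_ifs <;> simp

theorem norm_iteratedDeriv_comp_le {φ : ℂ → ℂ} (hφ : ContDiff ℝ ∞ φ) {h : ℝ → ℂ}
    (hh : ContDiff ℝ ∞ h) {k : ℕ} {B D l t : ℝ} (hl : 0 ≤ l)
    (hB : ∀ i ≤ k, ‖iteratedFDeriv ℝ i φ (l * h t)‖ ≤ B)
    (hD : ∀ i, 1 ≤ i → i ≤ k → l * ‖iteratedDeriv i h t‖ ≤ D ^ i) :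
    ‖iteratedDeriv k (fun t => φ (l * h t)) t‖ ≤ (k.factorial : ℝ) * B * D ^ k := by
  rw [← norm_iteratedFDeriv_eq_norm_iteratedDeriv]
  refine norm_iteratedFDeriv_comp_le (N := ∞) hφ (f := fun t => (l : ℂ) * h t)
    (contDiff_const.mul hh) (by exact_mod_cast le_top) t hB fun i hi1 hik => ?_
  rw [norm_iteratedFDeriv_eq_norm_iteratedDeriv, iteratedDeriv_const_mul_field, norm_mul,
    Complex.norm_real, Real.norm_of_nonneg hl]
  exact hD i hi1 hik

/-- The higher chain rule, with the middle order derivatives bounded by `A`. Only the `k`-th power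
of the first derivative comes with the full factor `l^k`. -/
theorem norm_iteratedDeriv_comp_le_of_bounded {φ : ℂ → ℂ} (hφ : ContDiff ℝ ∞ φ) {h : ℝ → ℂ}
    (hh : ContDiff ℝ ∞ h) {k : ℕ} (hk : 2 ≤ k) {A B l t : ℝ} (hl : 1 ≤ l) (hA0 : 0 ≤ A)
    (hB : ∀ i ≤ k, ‖iteratedFDeriv ℝ i φ (l * h t)‖ ≤ B)
    (hA : ∀ i < k, ‖iteratedDeriv i h t‖ ≤ A) :
    ‖iteratedDeriv k (fun t => φ (l * h t)) t‖ ≤ (k.factorial : ℝ) * B * (3 ^ k * (l ^ k * ‖deriv h t‖ ^ k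
      + (1 + A) ^ k * l ^ (k - 1) + l * ‖iteratedDeriv k h t‖)) := by
  have hk0 : (k : ℝ) ≠ 0 := by positivity
  have hl0 : 0 < l := by linarith
  have hB0 : 0 ≤ B := (norm_nonneg _).trans (hB 0 (Nat.zero_le _))
  set x := l * ‖deriv h t‖ with hx
  set y := (1 + A) * l ^ (((k - 1 : ℕ) : ℝ) / k) with hy
  set z := (l * ‖iteratedDeriv k h t‖) ^ (1 / k : ℝ) with hz
  have hx0 : 0 ≤ x := by positivity
  have hy0 : 0 ≤ y := by positivity
  have hz0 : 0 ≤ z := by positivity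
  have hyk : y ^ k = (1 + A) ^ k * l ^ (k - 1) := by
    rw [hy, mul_pow, ← Real.rpow_natCast (l ^ _), ← Real.rpow_mul hl0.le,
      div_mul_cancel₀ _ hk0, Real.rpow_natCast]
  have hzk : z ^ k = l * ‖iteratedDeriv k h t‖ := by
    rw [hz, ← Real.rpow_natCast, ← Real.rpow_mul (by positivity), one_div_mul_cancel hk0,
      Real.rpow_one]
  refine (norm_iteratedDeriv_comp_le hφ hh (D := x + y + z) hl0.le hB fun i hi1 hik => ?_).trans ?_
  · rcases hi1.eq_or_lt with rfl | hi2
    · rw [iteratedDeriv_one, pow_one]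
      linarith
    rcases hik.eq_or_lt with rfl | hlt
    · rw [← hzk]
      exact pow_le_pow_left₀ hz0 (by linarith) _
    · refine le_trans ?_ (pow_le_pow_left₀ hy0 (by linarith : y ≤ x + y + z) i)
      rw [hy, mul_pow, ← Real.rpow_natCast (l ^ _), ← Real.rpow_mul hl0.le, mul_comm]
      refine mul_le_mul ((hA i hlt).trans ?_) ?_ hl0.le (by positivity)
      · calc A ≤ 1 + A := by linarith
          _ ≤ (1 + A) ^ i := le_self_pow₀ (by linarith) (by omega)
      · -- `i (k - 1) / k ≥ 1` because `i, k ≥ 2`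
        calc l = l ^ (1 : ℝ) := (Real.rpow_one l).symm
          _ ≤ _ := by
            refine Real.rpow_le_rpow_of_exponent_le hl ?_
            rw [div_mul_eq_mul_div, le_div_iff₀ (by positivity), one_mul,
              Nat.cast_sub (by omega)]
            have h2 : (2 : ℝ) ≤ i := by exact_mod_cast hi2
            have h3 : (2 : ℝ) ≤ k := by exact_mod_cast hk
            push_cast
            nlinarith
  · have hmax : x + y + z ≤ 3 * max x (max y z) := by
      have := le_max_left x (max y z)
      have := (le_max_left y z).trans (le_max_right x (max y z))
      have := (le_max_right y z).trans (le_max_right x (max y z))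
      linarith
    have hpow : (x + y + z) ^ k ≤ 3 ^ k * (x ^ k + y ^ k + z ^ k) := by
      refine (pow_le_pow_left₀ (by positivity) hmax k).trans ?_
      rw [mul_pow]
      refine mul_le_mul_of_nonneg_left ?_ (by positivity)
      have px : 0 ≤ x ^ k := by positivity
      have py : 0 ≤ y ^ k := by positivity
      have pz : 0 ≤ z ^ k := by positivity
      rcases max_choice x (max y z) with h' | h' <;> rw [h']
      · linarith
      · rcases max_choice y z with h'' | h'' <;> rw [h''] <;> linarith
    rw [hyk, hzk, hx, mul_pow] at hpow
    exact mul_le_mul_of_nonneg_left hpow (by positivity)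

end

section

open scoped ContDiff

theorem integral_norm_sq_le_of_eH {F : C(Torus, ℂ)} {A : ℝ} (hA : 0 ≤ A)
    (h : eH 0 (coeffs F) ≤ ENNReal.ofReal A) : ∫ x, ‖F x‖ ^ 2 ∂torusMeasure ≤ A ^ 2 := by
  rw [eH_zero_coeffs_continuousMap, ENNReal.ofReal_le_ofReal_iff hA] at h
  rwa [Real.sqrt_le_left hA] at h

theorem eH_le_of_integral_norm_sq {F : C(Torus, ℂ)} {A : ℝ}
    (h : ∫ x, ‖F x‖ ^ 2 ∂torusMeasure ≤ A) : eH 0 (coeffs F) ≤ ENNReal.ofReal √A := by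
  rw [eH_zero_coeffs_continuousMap]
  exact ENNReal.ofReal_le_ofReal (Real.sqrt_le_sqrt h)

/-- In `H^{s'}`, `s' > k`, the derivatives of order less than `k` are bounded, and those of order
`k` are square integrable. -/
theorem trigPoly_deriv_bounds {k : ℕ} {s' : ℝ} (hs : k < s') (M : ℝ) (hM : 0 ≤ M) :
    ∃ A : ℝ, 0 ≤ A ∧ ∀ (S : Finset Freq) (a : Dist), eH s' a ≤ ENNReal.ofReal M → ∀ e,
      (∀ i < k, ∀ x, ‖trigPoly S ((deriv1 e)^[i] a) x‖ ≤ A) ∧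
      ∀ i ≤ k, ∫ x, ‖trigPoly S ((deriv1 e)^[i] a) x‖ ^ 2 ∂torusMeasure ≤ A ^ 2 := by
  obtain ⟨C, hC0, hC⟩ := sum_norm_le_eH (c := s' - k + 1) (by linarith)
  have h7 : ∀ i ≤ k, (7 : ℝ≥0∞) ^ i * ENNReal.ofReal M ≤ ENNReal.ofReal (7 ^ k * M) := fun i hi => by
    rw [ENNReal.ofReal_mul (by positivity), ENNReal.ofReal_pow (by norm_num)]
    norm_num
    exact mul_le_mul_left (pow_le_pow_right₀ (by norm_num) hi) _
  refine ⟨C * (7 ^ k * M) + 7 ^ k * M, by positivity, fun S a ha e => ⟨fun i hi x => ?_,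
    fun i hi => ?_⟩⟩
  · refine (norm_trigPoly_le S _ x).trans ((hC S _ (7 ^ k * M) (by positivity) ?_).trans
      (le_add_of_nonneg_right (by positivity)))
    refine (eH_deriv1_iterate_le _ e a i).trans (le_trans (mul_le_mul_right ?_ _) (h7 i hi.le))
    refine (eH_mono_exp ?_ a).trans ha
    have : (i : ℝ) + 1 ≤ k := by exact_mod_cast hi
    linarith
  · refine integral_norm_sq_le_of_eH (by positivity) ?_
    refine (eH_coeffs_trigPoly_le 0 S _).trans ((eH_deriv1_iterate_le _ e a i).trans
      (le_trans (mul_le_mul_right ?_ _) ((h7 i hi).trans (ENNReal.ofReal_le_ofReal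
        (le_add_of_nonneg_left (by positivity))))))
    refine (eH_mono_exp ?_ a).trans ha
    have : (i : ℝ) ≤ k := by exact_mod_cast hi
    linarith

theorem exists_iteratedFDeriv_bound {φ : ℂ → ℂ} (hφ : ContDiff ℝ ∞ φ) (hc : HasCompactSupport φ)
    (k : ℕ) : ∃ B R : ℝ, 0 ≤ B ∧ 0 < R ∧ (∀ i ≤ k, ∀ z, ‖iteratedFDeriv ℝ i φ z‖ ≤ B) ∧
      ∀ i z, R < ‖z‖ → iteratedFDeriv ℝ i φ z = 0 := by
  have h1 : ∀ i : ℕ, ∃ B, ∀ z, ‖iteratedFDeriv ℝ i φ z‖ ≤ B := fun i =>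
    (hc.iteratedFDeriv i).exists_bound_of_continuous (hφ.continuous_iteratedFDeriv
      (by exact_mod_cast le_top))
  choose B hB using h1
  have hB0 : ∀ i, 0 ≤ B i := fun i => (norm_nonneg _).trans (hB i 0)
  obtain ⟨R, hR⟩ := hc.isCompact.isBounded.subset_closedBall (0 : ℂ)
  refine ⟨∑ i ∈ Finset.range (k + 1), B i, max R 1, Finset.sum_nonneg fun i _ => hB0 i,
    lt_max_of_lt_right one_pos, fun i hi z => (hB i z).trans
      (Finset.single_le_sum (f := B) (fun i _ => hB0 i) (Finset.mem_range.2 (by omega))),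
    fun i z hz => ?_⟩
  by_contra hne
  have := hR (support_iteratedFDeriv_subset i (Function.mem_support.2 hne))
  rw [mem_closedBall_zero_iff] at this
  exact absurd (this.trans (le_max_left R 1)) (not_le.2 hz)

theorem hasDerivAlong_iterate (e : Fin 2) (S : Finset Freq) (a : Dist) (i : ℕ) :
    HasDerivAlong e (trigPoly S ((deriv1 e)^[i] a)) (trigPoly S ((deriv1 e)^[i + 1] a)) := by
  rw [Function.iterate_succ_apply']
  exact hasDerivAlong_trigPoly e S _

theorem iteratedDeriv_trigPoly (e : Fin 2) (S : Finset Freq) (a : Dist) (i : ℕ) (x : Torus) :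
    iteratedDeriv i (fun t : ℝ => trigPoly S a (x + shift e t)) 0
      = trigPoly S ((deriv1 e)^[i] a) x := by
  have := iteratedDeriv_of_derivSeq (G := fun i => trigPoly S ((deriv1 e)^[i] a))
    (hasDerivAlong_iterate e S a) i x 0
  simpa [shift_zero] using this

/-- Mean square bounds for the derivatives of `φ(l f)`, for a compactly supported `φ`, at large
scales `l`. -/
theorem integral_derivSeq_sq_le {k : ℕ} (hk : 2 ≤ k) {s' : ℝ} (hs : k < s') {φ : ℂ → ℂ}
    (hφ : ContDiff ℝ ∞ φ) (hc : HasCompactSupport φ) {M : ℝ} (hM : 0 ≤ M) :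
    ∃ C : ℝ, 0 ≤ C ∧ ∀ (l : ℝ) (S : Finset Freq) (a : Dist), 1 ≤ l → eH s' a ≤ ENNReal.ofReal M →
      ∀ (e : Fin 2) (G : ℕ → C(Torus, ℂ)), (∀ x, G 0 x = φ (l * trigPoly S a x)) →
        (∀ k, HasDerivAlong e (G k) (G (k + 1))) →
        ∫ x, ‖G 1 x‖ ^ 2 ∂torusMeasure ≤ C * l ∧
        ∫ x, ‖G k x‖ ^ 2 ∂torusMeasure ≤ C * l ^ (2 * k - 1) := by
  obtain ⟨A, hA0, hA⟩ := trigPoly_deriv_bounds hs M hM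
  obtain ⟨B, R, hB0, hR0, hB, hR⟩ := exists_iteratedFDeriv_bound hφ hc k
  set c₀ : ℝ := (k.factorial : ℝ) * B * 3 ^ k with hc₀
  set E : ℝ := 2 * Real.pi * R * (1 + A ^ 2) with hE
  have hE0 : 0 ≤ E := by positivity
  have hc00 : 0 ≤ c₀ := by positivity
  set C₁ := 3 * c₀ ^ 2 * (A ^ (2 * (k - 1)) * E + (1 + A) ^ (2 * k) + A ^ 2)
  refine ⟨B ^ 2 * E + C₁, by positivity, fun l S a hl ha e G hG0 hG => ?_⟩
  obtain ⟨hA1, hA2⟩ := hA S a ha e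
  have hl0 : 0 < l := by linarith
  set H : ℕ → C(Torus, ℂ) := fun i => trigPoly S ((deriv1 e)^[i] a) with hH
  have hH0 : H 0 = trigPoly S a := rfl
  have hHd : ∀ i, HasDerivAlong e (H i) (H (i + 1)) := hasDerivAlong_iterate e S a
  -- `φ(l f)` vanishes off the strip `|f| ≤ R / l`, on which the gradient is small
  set I : Torus → ℝ := {x | ‖H 0 x‖ ≤ R / l}.indicator fun x => ‖H 1 x‖ ^ 2 with hI
  have hI0 : ∀ x, 0 ≤ I x := fun x => indicator_nonneg (fun _ _ => by positivity) x
  have hIint : Integrable I torusMeasure :=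
    (integrable_continuousMap (⟨fun x => ‖H 1 x‖ ^ 2, by fun_prop⟩ : C(Torus, ℝ))).indicator
      (isClosed_le (H 0).continuous.norm continuous_const).measurableSet
  have hsq : ∀ i, Integrable (fun x => ‖H i x‖ ^ 2) torusMeasure := fun i =>
    integrable_continuousMap (⟨fun x => ‖H i x‖ ^ 2, by fun_prop⟩ : C(Torus, ℝ))
  have hIle : ∫ x, I x ∂torusMeasure ≤ E / l := by
    refine (integral_strip_le (hHd 0) (hHd 1) (div_pos hR0 hl0)).trans ?_
    have h2 : ∫ x, ‖H 2 x‖ ∂torusMeasure ≤ 1 + A ^ 2 := by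
      calc ∫ x, ‖H 2 x‖ ∂torusMeasure ≤ ∫ x, (1 + ‖H 2 x‖ ^ 2) ∂torusMeasure := by
            refine integral_mono (integrable_continuousMap (H 2)).norm
              ((integrable_const 1).add (hsq 2)) fun x => ?_
            nlinarith [sq_nonneg (‖H 2 x‖ - 1)]
        _ = 1 + ∫ x, ‖H 2 x‖ ^ 2 ∂torusMeasure := by
            rw [integral_add (integrable_const 1) (hsq 2)]; simp
        _ ≤ _ := by linarith [hA2 2 hk]
    calc _ ≤ 2 * Real.pi * (R / l) * (1 + A ^ 2) :=
          mul_le_mul_of_nonneg_left h2 (by positivity)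
      _ = E / l := by rw [hE]; ring
  -- the chain rule on the strip where `φ(l f)` does not vanish
  have hpt : ∀ i x, G i x = iteratedDeriv i (fun t : ℝ => φ (l * trigPoly S a (x + shift e t))) 0 :=
    fun i x => by
      have := iteratedDeriv_of_derivSeq hG i x 0
      rw [shift_zero, add_zero] at this
      rw [← this]
      simp only [hG0]
  have hoff : ∀ i x, ¬ ‖H 0 x‖ ≤ R / l → G i x = 0 := fun i x hx => by
    have h1 : R < ‖(l : ℂ) * trigPoly S a (x + shift e 0)‖ := by
      rw [shift_zero, add_zero, norm_mul, Complex.norm_real, Real.norm_of_nonneg hl0.le]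
      rw [not_le, div_lt_iff₀ hl0, hH0] at hx
      linarith
    rw [hpt, ← norm_le_zero_iff]
    refine (norm_iteratedDeriv_comp_le hφ (contDiff_trigPoly_shift e S a x) (B := 0)
      (D := 1 + ∑ i ∈ Finset.range (i + 1), l * ‖iteratedDeriv i
        (fun t : ℝ => trigPoly S a (x + shift e t)) 0‖) hl0.le
      (fun i _ => by rw [hR i _ h1, norm_zero]) fun j hj hji => ?_).trans (by simp)
    have h2 := Finset.single_le_sum (f := fun i => l * ‖iteratedDeriv i
      (fun t : ℝ => trigPoly S a (x + shift e t)) 0‖) (fun i _ => by positivity)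
      (Finset.mem_range.2 (by omega : j < i + 1))
    have h3 : 0 ≤ ∑ i ∈ Finset.range (i + 1), l * ‖iteratedDeriv i
      (fun t : ℝ => trigPoly S a (x + shift e t)) 0‖ :=
      Finset.sum_nonneg fun i _ => by positivity
    exact (h2.trans (by linarith)).trans (le_self_pow₀ (by linarith) (by omega))
  have hd1 : ∀ x, deriv (fun t : ℝ => trigPoly S a (x + shift e t)) 0 = H 1 x := fun x => by
    rw [← iteratedDeriv_one, iteratedDeriv_trigPoly]
  have hon1 : ∀ x, ‖G 1 x‖ ≤ B * (l * ‖H 1 x‖) := fun x => by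
    rw [hpt]
    refine (norm_iteratedDeriv_comp_le hφ (contDiff_trigPoly_shift e S a x) (B := B)
      (D := l * ‖H 1 x‖) hl0.le (fun i hi => hB i (by omega) _) fun j hj hji => ?_).trans (by simp)
    obtain rfl : j = 1 := by omega
    rw [pow_one, iteratedDeriv_trigPoly]
  have honk : ∀ x, ‖G k x‖ ≤ c₀ * (l ^ k * (A ^ (k - 1) * ‖H 1 x‖) + (1 + A) ^ k * l ^ (k - 1)
      + l * ‖H k x‖) := fun x => by
    rw [hpt]
    refine (norm_iteratedDeriv_comp_le_of_bounded hφ (contDiff_trigPoly_shift e S a x) hk hl hA0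
      (fun i hi => hB i hi _) fun i hi => ?_).trans ?_
    · rw [iteratedDeriv_trigPoly]; exact hA1 i hi x
    · rw [hd1, iteratedDeriv_trigPoly, hc₀, ← mul_assoc]
      refine mul_le_mul_of_nonneg_left ?_ (by positivity)
      have h1 : ‖H 1 x‖ ^ k ≤ A ^ (k - 1) * ‖H 1 x‖ := by
        conv_lhs => rw [show k = (k - 1) + 1 by omega, pow_succ]
        exact mul_le_mul_of_nonneg_right (pow_le_pow_left₀ (norm_nonneg _)
          (hA1 1 (by omega) x) _) (norm_nonneg _)
      gcongr
  constructor
  · have h1 : ∀ x, ‖G 1 x‖ ^ 2 ≤ B ^ 2 * l ^ 2 * I x := fun x => by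
      by_cases hx : ‖H 0 x‖ ≤ R / l
      · rw [hI, indicator_of_mem (show x ∈ {x | ‖H 0 x‖ ≤ R / l} from hx)]
        refine (pow_le_pow_left₀ (norm_nonneg _) (hon1 x) 2).trans (le_of_eq (by ring))
      · rw [hoff 1 x hx, norm_zero, zero_pow two_ne_zero]
        have := hI0 x
        positivity
    calc ∫ x, ‖G 1 x‖ ^ 2 ∂torusMeasure ≤ ∫ x, B ^ 2 * l ^ 2 * I x ∂torusMeasure :=
          integral_mono_of_nonneg (Eventually.of_forall fun x => by positivity)
            (hIint.const_mul _) (Eventually.of_forall h1)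
      _ ≤ B ^ 2 * l ^ 2 * (E / l) := by
          rw [integral_const_mul]
          exact mul_le_mul_of_nonneg_left hIle (by positivity)
      _ = B ^ 2 * E * l := by field_simp
      _ ≤ _ := mul_le_mul_of_nonneg_right (le_add_of_nonneg_right (by positivity)) hl0.le
  · have h1 : ∀ x, ‖G k x‖ ^ 2 ≤ 3 * c₀ ^ 2 * (l ^ (2 * k) * A ^ (2 * (k - 1)) * I x
        + (1 + A) ^ (2 * k) * l ^ (2 * (k - 1)) + l ^ 2 * ‖H k x‖ ^ 2) := fun x => by
      by_cases hx : ‖H 0 x‖ ≤ R / l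
      · rw [hI, indicator_of_mem (show x ∈ {x | ‖H 0 x‖ ≤ R / l} from hx)]
        refine (pow_le_pow_left₀ (norm_nonneg _) (honk x) 2).trans ?_
        have h3 : ∀ u v w : ℝ, (c₀ * (u + v + w)) ^ 2 ≤ 3 * c₀ ^ 2 * (u ^ 2 + v ^ 2 + w ^ 2) :=
          fun u v w => by
            rw [mul_pow, mul_comm 3, mul_assoc]
            refine mul_le_mul_of_nonneg_left ?_ (sq_nonneg _)
            nlinarith [sq_nonneg (u - v), sq_nonneg (v - w), sq_nonneg (u - w)]
        refine (h3 _ _ _).trans (le_of_eq ?_)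
        simp only [mul_pow, ← pow_mul, mul_comm 2]
        ring
      · rw [hoff k x hx, norm_zero, zero_pow two_ne_zero]
        have := hI0 x
        positivity
    have hint2 : Integrable (fun x => l ^ (2 * k) * A ^ (2 * (k - 1)) * I x
        + (1 + A) ^ (2 * k) * l ^ (2 * (k - 1))) torusMeasure :=
      (hIint.const_mul _).add (integrable_const _)
    have hp1 : l ^ (2 * k) / l = l ^ (2 * k - 1) := by
      rw [div_eq_iff hl0.ne', ← pow_succ]; congr 1; omega
    have hp2 : l ^ (2 * (k - 1)) ≤ l ^ (2 * k - 1) := pow_le_pow_right₀ hl (by omega)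
    have hp3 : l ^ 2 ≤ l ^ (2 * k - 1) := pow_le_pow_right₀ hl (by omega)
    calc ∫ x, ‖G k x‖ ^ 2 ∂torusMeasure
        ≤ ∫ x, 3 * c₀ ^ 2 * (l ^ (2 * k) * A ^ (2 * (k - 1)) * I x
          + (1 + A) ^ (2 * k) * l ^ (2 * (k - 1)) + l ^ 2 * ‖H k x‖ ^ 2) ∂torusMeasure :=
          integral_mono_of_nonneg (Eventually.of_forall fun x => by positivity)
            ((hint2.add ((hsq k).const_mul _)).const_mul _) (Eventually.of_forall h1)
      _ = 3 * c₀ ^ 2 * (l ^ (2 * k) * A ^ (2 * (k - 1)) * (∫ x, I x ∂torusMeasure)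
          + (1 + A) ^ (2 * k) * l ^ (2 * (k - 1)) + l ^ 2 * ∫ x, ‖H k x‖ ^ 2 ∂torusMeasure) := by
          rw [integral_const_mul, integral_add hint2 ((hsq k).const_mul _),
            integral_add (hIint.const_mul _) (integrable_const _)]
          simp [integral_const_mul]
      _ ≤ 3 * c₀ ^ 2 * (l ^ (2 * k) * A ^ (2 * (k - 1)) * (E / l)
          + (1 + A) ^ (2 * k) * l ^ (2 * k - 1) + l ^ (2 * k - 1) * A ^ 2) := by
          have := hA2 k le_rfl
          gcongr
      _ = C₁ * l ^ (2 * k - 1) := by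
          rw [← hp1]; ring
      _ ≤ _ := mul_le_mul_of_nonneg_right (le_add_of_nonneg_left (by positivity)) (by positivity)

end

section

open scoped ContDiff

theorem eH_zero_comp_le {φ : ℂ → ℂ} {B : ℝ} (hB0 : 0 ≤ B)
    (hB : ∀ z, ‖φ z‖ ≤ B) (F : C(Torus, ℂ)) (hF : ∃ f : Torus → ℂ, ∀ x, F x = φ (f x)) :
    eH 0 (coeffs F) ≤ ENNReal.ofReal B := by
  obtain ⟨f, hf⟩ := hF
  have h : ∫ x, ‖F x‖ ^ 2 ∂torusMeasure ≤ B ^ 2 := by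
    have h1 := integral_mono_of_nonneg (μ := torusMeasure) (f := fun x => ‖F x‖ ^ 2)
      (g := fun _ => B ^ 2) (Eventually.of_forall fun x => by positivity) (integrable_const _)
      (Eventually.of_forall fun x => by
        simp only [hf]; exact pow_le_pow_left₀ (norm_nonneg _) (hB _) 2)
    simpa using h1
  refine (eH_le_of_integral_norm_sq h).trans (le_of_eq ?_)
  rw [Real.sqrt_sq hB0]

theorem exists_derivSeq_comp {φ : ℂ → ℂ} (hφ : ContDiff ℝ ∞ φ) (l : ℝ) (S : Finset Freq)
    (a : Dist) : ∃ (F : C(Torus, ℂ)) (G : Fin 2 → ℕ → C(Torus, ℂ)),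
      (∀ x, F x = φ (l * trigPoly S a x)) ∧ (∀ e, G e 0 = F) ∧
      ∀ e k, HasDerivAlong e (G e k) (G e (k + 1)) := by
  have h1 : ∀ e, ∃ G : ℕ → C(Torus, ℂ), (∀ x, G 0 x = φ (l * trigPoly S a x)) ∧
      ∀ k, HasDerivAlong e (G k) (G (k + 1)) := fun e =>
    exists_derivSeq e (Ψ := fun z => φ (l * z)) (hφ.comp (contDiff_const.mul contDiff_id)) S a
  choose G hG0 hG using h1
  exact ⟨G 0 0, G, hG0 0, fun e => ContinuousMap.ext fun x => by rw [hG0, hG0], hG⟩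

/-- A compactly supported smooth function of a function `f` that is bounded in `H^{s'}`, at the
scale `l`: the level sets `|f| ~ 1 / l` carry a fraction `1 / l` of the mean square of `∇f`,
which gains half a derivative over the scaling `l^σ`. -/
theorem eH_comp_trigPoly_le {k : ℕ} (hk : 2 ≤ k) {s' σ : ℝ} (hs : k < s') (h1 : 1 ≤ σ)
    (hσ : σ ≤ k) {φ : ℂ → ℂ} (hφ : ContDiff ℝ ∞ φ) (hc : HasCompactSupport φ) {M : ℝ}
    (hM : 0 ≤ M) : ∃ C : ℝ, 0 ≤ C ∧ ∀ (l : ℝ) (S : Finset Freq) (a : Dist), 1 ≤ l →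
      eH s' a ≤ ENNReal.ofReal M →
      eH σ (coeffs fun x => φ (l * trigPoly S a x)) ≤ ENNReal.ofReal (C * l ^ (σ - 1 / 2)) := by
  obtain ⟨C, hC0, hC⟩ := integral_derivSeq_sq_le hk hs hφ hc hM
  obtain ⟨B, hB⟩ := hc.exists_bound_of_continuous hφ.continuous
  have hB0 : 0 ≤ B := (norm_nonneg _).trans (hB 0)
  refine ⟨3 ^ σ * (B + 4 * √C), by positivity, fun l S a hl ha => ?_⟩
  have hl0 : 0 < l := by linarith
  obtain ⟨F, G, hF, hG0, hG⟩ := exists_derivSeq_comp hφ l S a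
  have hFc : (fun x => φ (l * trigPoly S a x)) = F := funext fun x => (hF x).symm
  rw [hFc]
  have hb := fun e => hC l S a hl ha e (G e) (fun x => by rw [hG0, hF]) (hG e)
  refine (eH_coeffs_le_of_derivSeq h1 hσ hl0 hG0 hG).trans ?_
  have hl1 := Real.rpow_pos_of_pos hl0 (σ - 1)
  have hlk := Real.rpow_pos_of_pos hl0 (σ - k)
  have hlh := Real.rpow_pos_of_pos hl0 (σ - 1 / 2)
  have e1 : l ^ (σ - 1) * √(C * l) = √C * l ^ (σ - 1 / 2) := by
    rw [Real.sqrt_mul hC0, Real.sqrt_eq_rpow l, mul_left_comm, ← Real.rpow_add hl0]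
    congr 2; ring
  have e2 : l ^ (σ - k) * √(C * l ^ (2 * k - 1)) = √C * l ^ (σ - 1 / 2) := by
    rw [Real.sqrt_mul hC0, Real.sqrt_eq_rpow (l ^ _), mul_left_comm, ← Real.rpow_natCast l,
      ← Real.rpow_mul hl0.le, ← Real.rpow_add hl0, Nat.cast_sub (by omega)]
    congr 2; push_cast; ring
  have hterm : ∀ e, ENNReal.ofReal (l ^ (σ - 1)) * eH 0 (coeffs (G e 1))
      + ENNReal.ofReal (l ^ (σ - k)) * eH 0 (coeffs (G e k))
      ≤ ENNReal.ofReal (2 * (√C * l ^ (σ - 1 / 2))) := fun e => by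
    rw [two_mul, ENNReal.ofReal_add (by positivity) (by positivity)]
    refine add_le_add ?_ ?_
    · rw [← e1, ENNReal.ofReal_mul hl1.le]
      exact mul_le_mul_right (eH_le_of_integral_norm_sq (hb e).1) _
    · rw [← e2, ENNReal.ofReal_mul hlk.le]
      exact mul_le_mul_right (eH_le_of_integral_norm_sq (hb e).2) _
  have hzero := eH_zero_comp_le hB0 hB F ⟨_, hF⟩
  rw [Fin.sum_univ_two, mul_assoc, ENNReal.ofReal_mul (by positivity)]
  refine mul_le_mul_right ((add_le_add hzero (add_le_add (hterm 0) (hterm 1))).trans ?_) _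
  rw [← ENNReal.ofReal_add (by positivity) (by positivity),
    ← ENNReal.ofReal_add hB0 (by positivity)]
  refine ENNReal.ofReal_le_ofReal ?_
  have : 1 ≤ l ^ (σ - 1 / 2) := Real.one_le_rpow hl (by linarith)
  nlinarith

theorem eH_one_comp_trigPoly_le {s' : ℝ} (hs : 1 < s') {φ : ℂ → ℂ} (hφ : ContDiff ℝ ∞ φ)
    (hc : HasCompactSupport φ) {M : ℝ} (hM : 0 ≤ M) : ∃ C : ℝ, 0 ≤ C ∧
      ∀ (l : ℝ) (S : Finset Freq) (a : Dist), 1 ≤ l → eH s' a ≤ ENNReal.ofReal M →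
      eH 1 (coeffs fun x => φ (l * trigPoly S a x)) ≤ ENNReal.ofReal (C * l ^ (1 : ℝ)) := by
  obtain ⟨A, hA0, hA⟩ := trigPoly_deriv_bounds (k := 1) (by simpa using hs) M hM
  obtain ⟨B, R, hB0, -, hB, -⟩ := exists_iteratedFDeriv_bound hφ hc 1
  have hBφ : ∀ z, ‖φ z‖ ≤ B := fun z => by simpa using hB 0 (by omega) z
  refine ⟨3 * (B + 4 * (B * A)), by positivity, fun l S a hl ha => ?_⟩
  have hl0 : 0 < l := by linarith
  obtain ⟨F, G, hF, hG0, hG⟩ := exists_derivSeq_comp hφ l S a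
  have hFc : (fun x => φ (l * trigPoly S a x)) = F := funext fun x => (hF x).symm
  rw [hFc]
  have hpt : ∀ e x, ‖G e 1 x‖ ≤ B * (l * ‖trigPoly S ((deriv1 e)^[1] a) x‖) := fun e x => by
    have h2 := iteratedDeriv_of_derivSeq (hG e) 1 x 0
    rw [shift_zero, add_zero] at h2
    rw [← h2, hG0]
    simp only [hF]
    refine (norm_iteratedDeriv_comp_le hφ (contDiff_trigPoly_shift e S a x) (B := B)
      (D := l * ‖trigPoly S ((deriv1 e)^[1] a) x‖) hl0.le (fun i hi => hB i hi _)
      fun j hj hji => ?_).trans (by simp)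
    obtain rfl : j = 1 := by omega
    rw [pow_one, iteratedDeriv_trigPoly]
  have hG1 : ∀ e, eH 0 (coeffs (G e 1)) ≤ ENNReal.ofReal (B * A * l) := fun e => by
    have h3 : ∫ x, ‖G e 1 x‖ ^ 2 ∂torusMeasure ≤ (B * A * l) ^ 2 := by
      calc ∫ x, ‖G e 1 x‖ ^ 2 ∂torusMeasure
          ≤ ∫ x, (B * l) ^ 2 * ‖trigPoly S ((deriv1 e)^[1] a) x‖ ^ 2 ∂torusMeasure :=
            integral_mono_of_nonneg (Eventually.of_forall fun x => by positivity)
              ((integrable_continuousMap (⟨fun x => ‖trigPoly S ((deriv1 e)^[1] a) x‖ ^ 2,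
                by fun_prop⟩ : C(Torus, ℝ))).const_mul _) (Eventually.of_forall fun x => by
                refine (pow_le_pow_left₀ (norm_nonneg _) (hpt e x) 2).trans (le_of_eq (by ring)))
        _ ≤ (B * l) ^ 2 * A ^ 2 := by
            rw [integral_const_mul]
            exact mul_le_mul_of_nonneg_left ((hA S a ha e).2 1 le_rfl) (by positivity)
        _ = _ := by ring
    refine (eH_le_of_integral_norm_sq h3).trans (le_of_eq ?_)
    rw [Real.sqrt_sq (by positivity)]
  have h := eH_coeffs_le_of_derivSeq (σ := 1) (k := 1) le_rfl (by simp) hl0 hG0 hG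
  refine h.trans ?_
  simp only [sub_self, Nat.cast_one, Real.rpow_zero, ENNReal.ofReal_one, one_mul, Real.rpow_one]
  have hzero := eH_zero_comp_le hB0 hBφ F ⟨_, hF⟩
  rw [Fin.sum_univ_two, mul_assoc, ENNReal.ofReal_mul (by positivity)]
  refine mul_le_mul_right ((add_le_add hzero (add_le_add (add_le_add (hG1 0) (hG1 0))
    (add_le_add (hG1 1) (hG1 1)))).trans ?_) _
  rw [← ENNReal.ofReal_add (by positivity) (by positivity),
    ← ENNReal.ofReal_add (by positivity) (by positivity), ← ENNReal.ofReal_add hB0 (by positivity)]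
  refine ENNReal.ofReal_le_ofReal ?_
  nlinarith

/-! ### The power nonlinearity in Sobolev spaces -/

theorem powerNonlin_real_mul {p c : ℝ} (hc : 0 < c) (z : ℂ) :
    powerNonlin p (c * z) = (c ^ p : ℝ) * powerNonlin p z := by
  have h : c ^ p = c ^ (p - 1) * c := by rw [← Real.rpow_add_one hc.ne']; congr 1; ring
  rw [powerNonlin, powerNonlin, norm_mul, Complex.norm_real, Real.norm_of_nonneg hc.le,
    Real.mul_rpow hc.le (norm_nonneg _), h]
  push_cast; ring

theorem contDiffAt_powerNonlin (p : ℝ) {z : ℂ} (hz : z ≠ 0) :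
    ContDiffAt ℝ ∞ (powerNonlin p) z :=
  (Complex.ofRealCLM.contDiff.contDiffAt.comp z ((contDiffAt_norm ℝ hz).rpow_const_of_ne
    (norm_ne_zero_iff.2 hz))).mul contDiffAt_id

theorem contDiff_powerNonlin_odd {p : ℝ} {m : ℕ} (hp : p = 2 * m + 1) :
    ContDiff ℝ ∞ (powerNonlin p) := by
  have h : powerNonlin p = fun z => (((‖z‖ ^ 2) ^ m : ℝ) : ℂ) * z := by
    funext z
    rw [powerNonlin, hp, add_sub_cancel_right, ← pow_mul, ← Real.rpow_natCast]
    push_cast; rfl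
  rw [h]
  exact (Complex.ofRealCLM.contDiff.comp ((contDiff_norm_sq ℝ).pow m)).mul contDiff_id

theorem coeffs_sum {ι : Type*} (J : Finset ι) (F : ι → C(Torus, ℂ)) (n : Freq) :
    coeffs (fun x => ∑ j ∈ J, F j x) n = ∑ j ∈ J, coeffs (F j) n := by
  simp only [coeffs_eq, Finset.mul_sum]
  rw [integral_finsetSum]
  exact fun j _ => integrable_continuousMap
    (⟨fun x => UnitAddTorus.mFourier (-n) x * F j x, by fun_prop⟩ : C(Torus, ℂ))

theorem eH_sum_le {ι : Type*} (s : ℝ) (J : Finset ι) (a : ι → Dist) :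
    eH s (∑ j ∈ J, a j) ≤ ∑ j ∈ J, eH s (a j) := by
  classical
  induction J using Finset.induction_on with
  | empty => simp [eH_zero]
  | insert j J hj ih =>
    rw [Finset.sum_insert hj, Finset.sum_insert hj]
    exact (eH_add_le _ _ _).trans (add_le_add le_rfl ih)

/-- On bounded sets the nonlinearity is a sum of dyadic rescalings `2^{-jp} φ(2^j z)` of one smooth
compactly supported `φ`. If `φ(l f)` grows like `l^β` in `H^σ` with `β < p`, the contributions
form a convergent geometric series. -/
theorem eH_powerNonlin_trigPoly_le_of_scaling {p β σ s' M : ℝ} (hp : 1 < p) (hβ : β < p)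
    (hs : 1 < s') (hM : 0 ≤ M)
    (hscale : ∀ φ : ℂ → ℂ, ContDiff ℝ ∞ φ → HasCompactSupport φ → ∃ C : ℝ, 0 ≤ C ∧
      ∀ (l : ℝ) (S : Finset Freq) (a : Dist), 1 ≤ l → eH s' a ≤ ENNReal.ofReal M →
        eH σ (coeffs fun x => φ (l * trigPoly S a x)) ≤ ENNReal.ofReal (C * l ^ β)) :
    ∃ C : ℝ, ∀ (S : Finset Freq) (a : Dist), eH s' a ≤ ENNReal.ofReal M →
      eH σ (coeffs fun x => powerNonlin p (trigPoly S a x)) ≤ ENNReal.ofReal C := by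
  obtain ⟨C₀, hC₀, hsup⟩ := sum_norm_le_eH hs
  set A : ℝ := C₀ * M + 1
  have hA : 0 < A := by positivity
  have hpc := continuous_powerNonlin hp
  set b : ContDiffBump (0 : ℂ) := ⟨A, 2 * A, hA, by linarith⟩
  -- `φ` vanishes near the origin, where the nonlinearity fails to be smooth
  set φ : ℂ → ℂ := fun z => ((b z - b (2 * z) : ℝ) : ℂ) * powerNonlin p z
  have hb1 : ∀ z, ‖z‖ ≤ A → b z = 1 := fun z hz =>
    b.one_of_mem_closedBall (by rwa [mem_closedBall_zero_iff])
  have hb0 : ∀ z, 2 * A ≤ ‖z‖ → b z = 0 := fun z hz =>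
    b.zero_of_le_dist (by rwa [dist_zero_right])
  have hφ : ContDiff ℝ ∞ φ := by
    refine contDiff_iff_contDiffAt.2 fun z => ?_
    rcases eq_or_ne z 0 with rfl | hz
    · refine (contDiffAt_const (c := (0 : ℂ))).congr_of_eventuallyEq ?_
      filter_upwards [Metric.ball_mem_nhds (0 : ℂ) (by positivity : 0 < A / 2)] with y hy
      rw [mem_ball_zero_iff] at hy
      simp only [φ]
      rw [hb1 y (by linarith), hb1 (2 * y) (by rw [norm_mul, Complex.norm_ofNat]; linarith)]
      simp
    · refine ContDiffAt.mul (Complex.ofRealCLM.contDiff.contDiffAt.comp z ?_)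
        (contDiffAt_powerNonlin p hz)
      exact (b.contDiff (n := ⊤)).contDiffAt.sub ((b.contDiff (n := ⊤)).comp
        (contDiff_const.mul contDiff_id)).contDiffAt
  have hφc : HasCompactSupport φ := by
    refine HasCompactSupport.intro (isCompact_closedBall (0 : ℂ) (2 * A)) fun z hz => ?_
    rw [mem_closedBall_zero_iff, not_le] at hz
    simp only [φ]
    rw [hb0 z hz.le, hb0 (2 * z) (by rw [norm_mul, Complex.norm_ofNat]; linarith)]
    simp
  obtain ⟨C, hC0, hC⟩ := hscale φ hφ hφc
  set ϑ : ℝ := 2 ^ (β - p)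
  have hϑ0 : 0 < ϑ := by positivity
  have hϑ1 : ϑ < 1 := Real.rpow_lt_one_of_one_lt_of_neg (by norm_num) (by linarith)
  refine ⟨C * (1 - ϑ)⁻¹, fun S a ha => ?_⟩
  have hf : ∀ x, ‖trigPoly S a x‖ ≤ A := fun x =>
    (norm_trigPoly_le S a x).trans ((hsup S a M hM ha).trans (by simp [A]))
  -- the dyadic pieces
  set c : ℕ → ℝ := fun j => (((2 : ℝ) ^ j) ^ p)⁻¹
  have hc : ∀ j, 0 < c j := fun j => by positivity
  set F : ℕ → C(Torus, ℂ) := fun j =>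
    ⟨fun x => (c j : ℂ) * φ (((2 ^ j : ℝ) : ℂ) * trigPoly S a x), by
      have := hφ.continuous; fun_prop⟩
  have hF : ∀ j x, F j x = ((b (2 ^ j * trigPoly S a x) - b (2 ^ (j + 1) * trigPoly S a x) : ℝ) : ℂ)
      * powerNonlin p (trigPoly S a x) := fun j x => by
    simp only [F, ContinuousMap.coe_mk, φ]
    rw [powerNonlin_real_mul (by positivity), mul_left_comm, ← mul_assoc (c j : ℂ),
      ← Complex.ofReal_mul, inv_mul_cancel₀ (by positivity), Complex.ofReal_one, one_mul,
      ← mul_assoc (2 : ℂ), pow_succ']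
    push_cast; rfl
  have hsum : ∀ J x, ∑ j ∈ Finset.range J, F j x
      = ((b (trigPoly S a x) - b (2 ^ J * trigPoly S a x) : ℝ) : ℂ)
        * powerNonlin p (trigPoly S a x) := fun J x => by
    simp only [hF, ← Finset.sum_mul]
    congr 1
    rw [← Complex.ofReal_sum, Finset.sum_range_sub' fun j => b (2 ^ j * trigPoly S a x)]
    simp
  have hlim : ∀ n, Tendsto (fun J => coeffs (fun x => ∑ j ∈ Finset.range J, F j x) n) atTop
      (𝓝 (coeffs (fun x => powerNonlin p (trigPoly S a x)) n)) := fun n => by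
    simp only [coeffs_eq]
    refine tendsto_integral_of_dominated_convergence (fun _ => A ^ p) (fun J => ?_)
      (integrable_const _) (fun J => Eventually.of_forall fun x => ?_)
      (Eventually.of_forall fun x => ?_)
    · exact Continuous.aestronglyMeasurable (by fun_prop)
    · rw [norm_mul, mFourier_norm_apply, one_mul, hsum, norm_mul, Complex.norm_real,
        norm_powerNonlin (by linarith)]
      have h1 : ‖b (trigPoly S a x) - b (2 ^ J * trigPoly S a x)‖ ≤ 1 := by
        rw [Real.norm_eq_abs, abs_le]
        have := b.nonneg (x := trigPoly S a x)
        have := b.nonneg (x := 2 ^ J * trigPoly S a x)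
        have := b.le_one (x := trigPoly S a x)
        have := b.le_one (x := 2 ^ J * trigPoly S a x)
        constructor <;> linarith
      calc _ ≤ 1 * A ^ p := mul_le_mul h1 (Real.rpow_le_rpow (norm_nonneg _) (hf x) (by linarith))
            (by positivity) zero_le_one
        _ = _ := one_mul _
    · refine Tendsto.const_mul _ ?_
      simp only [hsum]
      rcases eq_or_ne (trigPoly S a x) 0 with h0 | h0
      · simp [h0, powerNonlin_zero]
      · refine tendsto_const_nhds.congr' ?_
        have h2 := tendsto_pow_atTop_atTop_of_one_lt (one_lt_two (α := ℝ))
        filter_upwards [h2.eventually_ge_atTop (2 * A / ‖trigPoly S a x‖)] with J hJ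
        rw [hb1 _ (hf x), hb0 (2 ^ J * trigPoly S a x)]
        · simp
        · rw [norm_mul, norm_pow, Complex.norm_ofNat]
          exact (div_le_iff₀ (norm_pos_iff.2 h0)).1 hJ
  refine eH_le_of_tendsto hlim (Eventually.of_forall fun J => ?_)
  have e1 : (coeffs fun x => ∑ j ∈ Finset.range J, F j x) = ∑ j ∈ Finset.range J, coeffs (F j) := by
    funext n; rw [coeffs_sum, Finset.sum_apply]
  rw [e1]
  have hpiece : ∀ j, eH σ (coeffs (F j)) ≤ ENNReal.ofReal (C * ϑ ^ j) := fun j => by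
    have e2 : coeffs (F j) = (c j : ℂ) • coeffs fun x => φ (((2 ^ j : ℝ) : ℂ) * trigPoly S a x) := by
      funext n
      rw [Pi.smul_apply, smul_eq_mul, coeffs_eq, coeffs_eq, ← integral_const_mul]
      refine integral_congr_ae (Eventually.of_forall fun x => ?_)
      simp only [F, ContinuousMap.coe_mk]
      ring
    rw [e2]
    refine (eH_smul_le _ _ _).trans ((mul_le_mul_right (hC (2 ^ j) S a
      (one_le_pow₀ one_le_two) ha) _).trans (le_of_eq ?_))
    rw [← ofReal_norm, Complex.norm_real, Real.norm_of_nonneg (hc j).le,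
      ← ENNReal.ofReal_mul (hc j).le]
    congr 1
    simp only [c, ϑ]
    rw [← Real.rpow_neg (by positivity), mul_left_comm, ← Real.rpow_add (by positivity),
      ← Real.rpow_natCast, ← Real.rpow_natCast, ← Real.rpow_mul (by norm_num),
      ← Real.rpow_mul (by norm_num)]
    congr 2; ring
  refine (eH_sum_le σ _ _).trans ((Finset.sum_le_sum fun j _ => hpiece j).trans ?_)
  rw [← ENNReal.ofReal_sum_of_nonneg fun j _ => by positivity]
  refine ENNReal.ofReal_le_ofReal ?_
  rw [← Finset.mul_sum]
  refine mul_le_mul_of_nonneg_left ?_ hC0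
  rw [← tsum_geometric_of_lt_one hϑ0.le hϑ1]
  exact (summable_geometric_of_lt_one hϑ0.le hϑ1).sum_le_tsum _ fun j _ => by positivity

end

section

open scoped ContDiff

/-- For general `p` the dyadic sum converges in `H^σ` if `σ - 1/2 < p`; for odd `p` the nonlinearity
is smooth and one dyadic piece suffices. -/
theorem eH_powerNonlin_trigPoly_le {p s' σ M : ℝ} {k : ℕ} (hp : 1 < p) (hk : 1 ≤ k) (hs : k < s')
    (hσk : σ ≤ k) (hσ : σ < p + 1 / 2 ∨ ∃ m : ℕ, p = 2 * (m : ℝ) + 1) (hM : 0 ≤ M) :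
    ∃ C : ℝ, ∀ (S : Finset Freq) (a : Dist), eH s' a ≤ ENNReal.ofReal M →
      eH σ (coeffs fun x => powerNonlin p (trigPoly S a x)) ≤ ENNReal.ofReal C := by
  have hk1 : (1 : ℝ) ≤ k := by exact_mod_cast hk
  rcases hk.eq_or_lt with rfl | hk2
  · obtain ⟨C, hC⟩ := eH_powerNonlin_trigPoly_le_of_scaling (σ := 1) (s' := s') hp hp
      (by linarith) hM fun φ hφ hc => eH_one_comp_trigPoly_le (by linarith) hφ hc hM
    exact ⟨C, fun S a ha => (eH_mono_exp (by simpa using hσk) _).trans (hC S a ha)⟩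
  have h1 : 1 ≤ max σ 1 := le_max_right _ _
  have h2 : max σ 1 ≤ k := max_le hσk hk1
  rcases hσ with hσ | ⟨m, hm⟩
  · have h3 : max σ 1 - 1 / 2 < p := by
      rcases max_choice σ 1 with h | h <;> rw [h] <;> linarith
    obtain ⟨C, hC⟩ := eH_powerNonlin_trigPoly_le_of_scaling (σ := max σ 1) (s' := s') hp h3
      (by linarith) hM fun φ hφ hc => eH_comp_trigPoly_le hk2 hs h1 h2 hφ hc hM
    exact ⟨C, fun S a ha => (eH_mono_exp (le_max_left _ _) _).trans (hC S a ha)⟩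
  · -- the nonlinearity is smooth, and it is only evaluated on a bounded set
    obtain ⟨C₀, hC₀, hsup⟩ := sum_norm_le_eH (c := s') (by linarith)
    have hA : 0 < C₀ * M + 1 := by positivity
    set b : ContDiffBump (0 : ℂ) := ⟨C₀ * M + 1, C₀ * M + 2, hA, by linarith⟩
    have hφ : ContDiff ℝ ∞ fun z => (b z : ℂ) * powerNonlin p z :=
      (Complex.ofRealCLM.contDiff.comp (b.contDiff (n := ⊤))).mul (contDiff_powerNonlin_odd hm)
    have hc : HasCompactSupport fun z => (b z : ℂ) * powerNonlin p z :=
      HasCompactSupport.mul_right (b.hasCompactSupport.comp_left (g := fun y : ℝ => (y : ℂ)) (by simp))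
    obtain ⟨C, -, hC⟩ := eH_comp_trigPoly_le hk2 hs h1 h2 hφ hc hM
    refine ⟨C * 1 ^ (max σ 1 - 1 / 2), fun S a ha =>
      (eH_mono_exp (le_max_left σ 1) _).trans ?_⟩
    refine le_trans (le_of_eq ?_) (hC 1 S a le_rfl ha)
    congr 1
    congr 1
    funext x
    rw [Complex.ofReal_one, one_mul, b.one_of_mem_closedBall, Complex.ofReal_one, one_mul]
    rw [mem_closedBall_zero_iff]
    exact (norm_trigPoly_le S a x).trans ((hsup S a M hM ha).trans (by linarith))

/-- The nonlinearity maps bounded sets of `H^{s'}` to bounded sets of `H^σ`. -/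
theorem eH_powerNonlin_le {p s' σ M : ℝ} {k : ℕ} (hp : 1 < p) (hk : 1 ≤ k) (hs : k < s')
    (hσk : σ ≤ k) (hσ : σ < p + 1 / 2 ∨ ∃ m : ℕ, p = 2 * (m : ℝ) + 1) (hM : 0 ≤ M) :
    ∃ C : ℝ, ∀ f : L2, eH s' (coeffs f) ≤ ENNReal.ofReal M →
      eH σ (coeffs fun x => powerNonlin p (f x)) ≤ ENNReal.ofReal C := by
  obtain ⟨C, hC⟩ := eH_powerNonlin_trigPoly_le hp hk hs hσk hσ hM
  have hk1 : (1 : ℝ) ≤ k := by exact_mod_cast hk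
  obtain ⟨C₀, hC₀, hsup⟩ := sum_norm_le_eH (c := s') (by linarith)
  refine ⟨C, fun f hf => ?_⟩
  have hpc := continuous_powerNonlin hp
  -- the partial Fourier sums converge almost everywhere along a sequence
  have h1 : Tendsto (fun S : Finset Freq => toL2 (coeffs (trigPoly S (coeffs f)))) atTop (𝓝 f) := by
    have e1 := UnitAddTorus.hasSum_mFourier_series_L2 f
    rw [HasSum] at e1
    refine e1.congr fun S => ?_
    have e2 : toL2 (coeffs (trigPoly S (coeffs f)))
        = ContinuousMap.toLp (E := ℂ) 2 torusMeasure ℂ (trigPoly S (coeffs f)) := by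
      refine Lp.ext ((coeFn_toL2_indicator S _).trans (ContinuousMap.coeFn_toLp _ _).symm)
    rw [e2, trigPoly, map_sum]
    refine Finset.sum_congr rfl fun n _ => ?_
    rw [map_smul]
    rfl
  obtain ⟨ns, -, hns⟩ := (tendstoInMeasure_of_tendsto_Lp h1).exists_seq_tendsto_ae'
  have h2 : ∀ᵐ x ∂torusMeasure, Tendsto (fun i => trigPoly (ns i) (coeffs f) x) atTop (𝓝 (f x)) := by
    have h3 : ∀ᵐ x ∂torusMeasure, ∀ i, toL2 (coeffs (trigPoly (ns i) (coeffs f))) x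
        = trigPoly (ns i) (coeffs f) x := ae_all_iff.2 fun i => coeFn_toL2_indicator _ _
    filter_upwards [hns, h3] with x hx hx3
    exact hx.congr hx3
  refine eH_le_of_tendsto (l := atTop) (a := fun i : ℕ => coeffs fun x =>
    powerNonlin p (trigPoly (ns i) (coeffs f) x)) (fun n => ?_)
    (Eventually.of_forall fun i => hC (ns i) _ hf)
  simp only [coeffs_eq]
  refine tendsto_integral_of_dominated_convergence (fun _ => (C₀ * M) ^ p) (fun i => ?_)
    (integrable_const _) (fun i => Eventually.of_forall fun x => ?_) ?_
  · exact Continuous.aestronglyMeasurable (by fun_prop)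
  · rw [norm_mul, mFourier_norm_apply, one_mul, norm_powerNonlin hp]
    exact Real.rpow_le_rpow (norm_nonneg _) ((norm_trigPoly_le _ _ x).trans
      (hsup _ _ M hM hf)) (by linarith)
  · filter_upwards [h2] with x hx
    exact ((hpc.tendsto _).comp hx).const_mul _

/-- The case of square integrable sources, from the embedding `H¹ ⊂ L^{2p}`. -/
theorem eH_zero_powerNonlin_le {p : ℝ} (hp : 1 < p) : ∃ C : NNReal, ∀ f : L2,
    eH 0 (coeffs fun x => powerNonlin p (f x)) ≤ (C * eH 1 (coeffs f)) ^ p := by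
  have hp0 : 0 < p := by linarith
  obtain ⟨C, hC⟩ := sobolev_embedding (r := 2 * p) (by linarith)
  refine ⟨C, fun f => ?_⟩
  have h1 : eLpNorm f (ENNReal.ofReal (2 * p)) torusMeasure ≤ C * eH 1 (coeffs f) := by
    refine (hC f).trans (mul_le_mul_right (eH_mono_exp ?_ _) _)
    have : 0 < 2 / (2 * p) := by positivity
    linarith
  have h2 : eLpNorm (fun x => powerNonlin p (f x)) 2 torusMeasure
      = eLpNorm f (ENNReal.ofReal (2 * p)) torusMeasure ^ p := by
    rw [eLpNorm_congr_norm_ae (g := fun x => ‖f x‖ ^ p) (Eventually.of_forall fun x => by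
      rw [norm_powerNonlin hp, Real.norm_of_nonneg (by positivity)]), eLpNorm_norm_rpow _ hp0,
      ENNReal.ofReal_mul (by norm_num), ENNReal.ofReal_ofNat]
  rcases eq_or_ne (C * eH 1 (coeffs f)) ∞ with htop | htop
  · rw [htop, ENNReal.top_rpow_of_pos hp0]; exact le_top
  have hm : MemLp (fun x => powerNonlin p (f x)) 2 torusMeasure := by
    refine ⟨(continuous_powerNonlin hp).comp_aestronglyMeasurable (Lp.aestronglyMeasurable f), ?_⟩
    rw [h2]
    exact ENNReal.rpow_lt_top_of_nonneg hp0.le (h1.trans_lt htop.lt_top).ne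
  rw [← coeffs_congr_ae hm.coeFn_toLp, eH_zero_coeffs, Lp.enorm_toLp, h2]
  exact ENNReal.rpow_le_rpow h1 hp0.le

end

section

variable {p q r : ℝ}

/-! ### Persistence of regularity -/

theorem eH_propV_le {s t : ℝ} (ht : t ∈ Icc (0 : ℝ) 1) (u₀ u₁ : Dist) :
    eH s (propV t u₀ u₁) ≤ eH s fun n => (majorantV u₀ u₁ n : ℂ) := by
  refine eH_mono le_rfl fun n => ?_
  rw [← ofReal_norm, ← ofReal_norm, Complex.norm_real,
    Real.norm_of_nonneg (majorantV_nonneg _ _ _)]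
  exact ENNReal.ofReal_le_ofReal ((norm_propV_le ht.1 ht.2 _ _ n).trans
    (mul_le_of_le_one_left (majorantV_nonneg _ _ _) (decay_le_one n ht.1)))

/-- A solution whose Duhamel term is bounded in `H^{s₁}` is bounded in `H^{min(s, s₁)}`, for data
in `H^s × H^{s-1}`. -/
theorem solution_bounded (h : Admissible p 1 q r) {s s₁ κ T : ℝ} (hκ : ‖(κ : ℂ)‖ₑ = 1)
    (hs : 1 ≤ s) (hT : T ≤ 1)
    {u₀ u₁ : Dist} (h₀ : eH s u₀ < ∞) (h₁ : eH (s - 1) u₁ < ∞) {u : ℝ → L2}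
    (hu : IsPath q r T u) (hfu : ∀ t ∈ Icc 0 T, duhamelMap κ p T u₀ u₁ u t = u t)
    {A : ℝ≥0∞} (hA : A ≠ ∞) (hconv : ∀ t ∈ Icc 0 T, eH s₁ (causalConv kerS T (source p u) t) ≤ A) :
    ∃ M : ℝ, 0 ≤ M ∧ ∀ t ∈ Icc 0 T, eH (min s s₁) (coeffs (u t)) ≤ ENNReal.ofReal M := by
  have h₀' := (eH_mono_exp hs _).trans_lt h₀
  have h₁' := (eH_mono_exp (sub_le_sub_right hs 1) _).trans_lt h₁
  have hV := eH_majorantV_lt_top h₀ h₁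
  set B := (eH s fun n => (majorantV u₀ u₁ n : ℂ)) + A
  have hB : B ≠ ∞ := ENNReal.add_ne_top.2 ⟨hV.ne, hA⟩
  refine ⟨B.toReal, ENNReal.toReal_nonneg, fun t ht => ?_⟩
  rw [ENNReal.ofReal_toReal hB, coeffs_eq_of_fixedPoint h hT h₀' h₁' hu hfu ht]
  refine (eH_sub_le _ _ _).trans (add_le_add ?_ ?_)
  · exact (eH_mono_exp (min_le_left _ _) _).trans (eH_propV_le ⟨ht.1, ht.2.trans hT⟩ _ _)
  · refine (eH_smul_le _ _ _).trans ?_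
    rw [hκ, one_mul]
    exact (eH_mono_exp (min_le_right _ _) _).trans (hconv t ht)

/-- An exponent for the source strictly above `x`, within the range of the composition estimate. -/
theorem exists_between_exponent {x p : ℝ} {k : ℕ} (hx : x < k)
    (hxp : x < p + 1 / 2 ∨ ∃ m : ℕ, p = 2 * (m : ℝ) + 1) :
    ∃ σ : ℝ, x < σ ∧ σ ≤ k ∧ (σ < p + 1 / 2 ∨ ∃ m : ℕ, p = 2 * (m : ℝ) + 1) := by
  rcases hxp with hxp | hodd
  · obtain ⟨σ, h1, h2⟩ := exists_between (lt_min hx hxp)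
    exact ⟨σ, h1, h2.le.trans (min_le_left _ _), Or.inl (h2.trans_le (min_le_right _ _))⟩
  · exact ⟨k, hx, le_rfl, Or.inr hodd⟩

theorem source_bounded {s' σ T : ℝ} {k : ℕ} (hp : 1 < p) (hk : 1 ≤ k) (hs : k < s')
    (hσk : σ ≤ k) (hσ : σ < p + 1 / 2 ∨ ∃ m : ℕ, p = 2 * (m : ℝ) + 1) {M : ℝ} (hM : 0 ≤ M)
    {u : ℝ → L2} (hu : ∀ t ∈ Icc 0 T, eH s' (coeffs (u t)) ≤ ENNReal.ofReal M) :
    ∃ A : ℝ≥0∞, A ≠ ∞ ∧ ∀ τ ∈ Icc 0 T, eH σ (source p u τ) ≤ A := by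
  obtain ⟨C, hC⟩ := eH_powerNonlin_le hp hk hs hσk hσ hM
  exact ⟨_, ENNReal.ofReal_ne_top, fun τ hτ => hC _ (hu τ hτ)⟩

/-- Each use of the composition estimate and of the smoothing of the Duhamel term raises the
regularity of the solution, up to that of the data. -/
theorem solution_bounded_above (h : Admissible p 1 q r) {s κ T : ℝ} (hκ : ‖(κ : ℂ)‖ₑ = 1)
    (hreg : s < p + 5 / 2 ∨ ∃ m : ℕ, p = 2 * (m : ℝ) + 1) (hT : T ≤ 1)
    {u₀ u₁ : Dist} (h₀ : eH s u₀ < ∞) (h₁ : eH (s - 1) u₁ < ∞) {u : ℝ → L2}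
    (hu : IsPath q r T u) (hfu : ∀ t ∈ Icc 0 T, duhamelMap κ p T u₀ u₁ u t = u t) (j : ℕ) :
    ((j + 1 : ℕ) : ℝ) < s → ∃ s' M : ℝ, ((j + 1 : ℕ) : ℝ) < s' ∧ 0 ≤ M ∧
      ∀ t ∈ Icc 0 T, eH s' (coeffs (u t)) ≤ ENNReal.ofReal M := by
  have hp := h.one_lt_p
  have hsrc := hu.isSource h hT
  -- one step: a bound for the source gives a bound for the solution
  have hstep : ∀ {σ x : ℝ}, σ < x → x < σ + 1 → 1 ≤ s → x + 1 < s →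
      (∃ A : ℝ≥0∞, A ≠ ∞ ∧ ∀ τ ∈ Icc 0 T, eH σ (source p u τ) ≤ A) →
      ∃ s' M : ℝ, x + 1 < s' ∧ 0 ≤ M ∧
        ∀ t ∈ Icc 0 T, eH s' (coeffs (u t)) ≤ ENNReal.ofReal M := by
    intro σ x hσx hxσ hs hxs ⟨A, hA, hAb⟩
    obtain ⟨C, hC⟩ := eH_causalConv_smoothing isCausal_kerS (γ := (x - σ + 1) / 2)
      (by linarith) (by linarith)
    obtain ⟨M, hM, hMb⟩ := solution_bounded h hκ hs hT h₀ h₁ hu hfu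
      (s₁ := σ + 1 + (x - σ + 1) / 2) (A := C * A) (ENNReal.mul_ne_top ENNReal.coe_ne_top hA)
      fun t ht => hC σ T t _ A (ht.2.trans hT) hsrc.aemeasurable hAb
    exact ⟨_, M, lt_min hxs (by linarith), hM, hMb⟩
  induction j with
  | zero =>
    intro hs
    simp only [zero_add, Nat.cast_one] at hs ⊢
    -- the regularity `H¹` of the space-time estimates makes the nonlinearity square integrable
    obtain ⟨M, hM, hMb⟩ := solution_bounded h hκ hs.le hT h₀ h₁ hu hfu (s₁ := 1)
      (A := 4 * ∫⁻ τ in Icc 0 T, eH (1 - 1) (source p u τ))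
      (ENNReal.mul_ne_top (by norm_num) hsrc.lintegral_lt_top.ne) fun t ht => by
        have := eH_causalConv_le isCausal_kerS (σ := 1 - 1) hsrc.aemeasurable (ht.2.trans hT)
        rwa [sub_add_cancel] at this
    obtain ⟨C, hC⟩ := eH_zero_powerNonlin_le hp
    obtain ⟨x, hx0, hx1⟩ := exists_between (lt_min (sub_pos.2 hs) one_pos)
    obtain ⟨s', M', hs', hM', hb⟩ := hstep (σ := 0) (x := x) hx0
      (by linarith [hx1.trans_le (min_le_right _ _)]) hs.le
      (by linarith [hx1.trans_le (min_le_left _ _)])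
      ⟨(C * ENNReal.ofReal M) ^ p, ENNReal.rpow_ne_top_of_nonneg (by linarith)
        (ENNReal.mul_ne_top ENNReal.coe_ne_top ENNReal.ofReal_ne_top), fun τ hτ =>
        (hC (u τ)).trans (ENNReal.rpow_le_rpow (mul_le_mul_right ((eH_mono_exp
          (le_min hs.le le_rfl) _).trans (hMb τ hτ)) _) (by linarith))⟩
    exact ⟨s', M', by linarith, hM', hb⟩
  | succ j ih =>
    intro hs
    have hs2 : ((j + 1 : ℕ) : ℝ) + 1 < s := by exact_mod_cast hs
    obtain ⟨s₁, M, hs₁, hM, hMb⟩ := ih (by linarith)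
    obtain ⟨σ, hσ1, hσ2, hσ3⟩ := exists_between_exponent (k := j + 1)
      (x := ((j + 1 : ℕ) : ℝ) - 1) (p := p) (by linarith)
      (hreg.imp_left fun h => by linarith)
    have hb := source_bounded hp (by omega) hs₁ hσ2 hσ3 hM hMb
    obtain ⟨σ', hσ', hσσ⟩ := exists_between hσ1
    obtain ⟨A, hA, hAb⟩ := hb
    obtain ⟨s', M', hs', hM', hb'⟩ := hstep (σ := σ') (x := ((j + 1 : ℕ) : ℝ))
      (by linarith) (by linarith) (by
        have : (0 : ℝ) ≤ ((j + 1 : ℕ) : ℝ) := Nat.cast_nonneg _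
        linarith) hs2
      ⟨A, hA, fun τ hτ => (eH_mono_exp hσσ.le _).trans (hAb τ hτ)⟩
    exact ⟨s', M', by push_cast at hs' ⊢; linarith, hM', hb'⟩

theorem continuousInSobolev_causalConv_of_bounded {k : Freq → ℝ → ℝ} {m : ℝ} (hk : IsCausal k m)
    {σ s T : ℝ} (hT : T ≤ 1) (hσ : s < σ + m + 1) {F : ℝ → Dist}
    (hF : ∀ n, Integrable (fun τ => F τ n) (volume.restrict (Icc 0 T))) {A : ℝ≥0∞} (hA : A ≠ ∞)
    (hb : ∀ τ ∈ Icc 0 T, eH σ (F τ) ≤ A) : ContinuousInSobolev s T (causalConv k T F) := by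
  obtain ⟨γ, hγ0, hγ1⟩ := exists_between (max_lt (by linarith : s - σ - m < 1) one_pos)
  obtain ⟨C, hC⟩ := eH_causalConv_smoothing hk ((le_max_right _ _).trans hγ0.le) hγ1
  refine continuousInSobolev_of_bounded (δ := σ + m + γ - s)
    (by linarith [(le_max_left _ _).trans_lt hγ0])
    (fun n => continuousOn_causalConv hk hT (hF n)) (A := C * A)
    (ENNReal.mul_ne_top ENNReal.coe_ne_top hA) fun t ht => ?_
  rw [add_sub_cancel]
  exact hC σ T t F A (ht.2.trans hT) (fun n => (hF n).aestronglyMeasurable.aemeasurable) hb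

/-- For data in `H^s × H^{s-1}`, `s > 1`, the source is bounded in some `H^σ` with `σ > s - 2`, and
the Duhamel terms gain almost two, respectively almost one, derivatives over it. -/
theorem persistence_of_regularity (h : Admissible p 1 q r) {s κ T : ℝ} (hκ : ‖(κ : ℂ)‖ₑ = 1)
    (hs : 1 < s) (hreg : s < p + 5 / 2 ∨ ∃ m : ℕ, p = 2 * (m : ℝ) + 1) (hT : T ≤ 1)
    {u₀ u₁ : Dist} (h₀ : eH s u₀ < ∞) (h₁ : eH (s - 1) u₁ < ∞) {u : ℝ → L2}
    (hu : IsPath q r T u) (hfu : ∀ t ∈ Icc 0 T, duhamelMap κ p T u₀ u₁ u t = u t) :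
    ContinuousInSobolev s T (causalConv kerS T (source p u)) ∧
      ContinuousInSobolev (s - 1) T (causalConv kerD T (source p u)) := by
  obtain ⟨j, hj1, hj2⟩ : ∃ j : ℕ, ((j + 1 : ℕ) : ℝ) < s ∧ s ≤ ((j + 1 : ℕ) : ℝ) + 1 := by
    have hc : 1 < ⌈s⌉₊ := Nat.lt_ceil.2 (by simpa using hs)
    refine ⟨⌈s⌉₊ - 2, Nat.lt_ceil.1 (by omega), ?_⟩
    have := Nat.le_ceil s
    rw [← Nat.cast_add_one, show ⌈s⌉₊ - 2 + 1 + 1 = ⌈s⌉₊ by omega]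
    exact this
  obtain ⟨s', M, hs', hM, hMb⟩ := solution_bounded_above h hκ hreg hT h₀ h₁ hu hfu j hj1
  obtain ⟨σ, hσ1, hσ2, hσ3⟩ := exists_between_exponent (k := j + 1) (x := s - 2) (p := p)
    (by linarith) (hreg.imp_left fun h => by linarith)
  obtain ⟨A, hA, hAb⟩ := source_bounded h.one_lt_p (by omega) hs' hσ2 hσ3 hM hMb
  have hint := (hu.isSource h hT).integrable
  exact ⟨continuousInSobolev_causalConv_of_bounded isCausal_kerS hT (by linarith) hint hA hAb,
    continuousInSobolev_causalConv_of_bounded isCausal_kerD hT (by linarith) hint hA hAb⟩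

/-! ### Choice of the exponents -/

/-- Exponents for the regularity `σ = min(s, 1)`: the nonlinearity fits into `H^{σ-1}` for
`r ≥ 2p / (2 - σ)`, and `q = max(p, 2)`. For `p ≥ 2` and `σ > 0` equality is chosen, and then the
condition `1 - 2/r ≤ σ + 1/q` says that `σ` is not below the critical regularity; at `σ = 0`,
`p = 3` the conditions force `r = p`, where the dual Sobolev embedding fails. -/
theorem exists_admissible {p s : ℝ} (hp : 1 < p) (hs : sCrit p ≤ s) (hs3 : p = 3 → sCrit p < s) :
    ∃ q r : ℝ, Admissible p (min s 1) q r := by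
  have hc : 1 - 2 / (p - 1) ≤ sCrit p := le_max_left _ _
  have hs0 : 0 ≤ s := (le_max_right _ _).trans hs
  have hp1 : 0 < p - 1 := by linarith
  set σ := min s 1
  have hσ0 : 0 ≤ σ := le_min hs0 zero_le_one
  have hσ1 : σ ≤ 1 := min_le_right _ _
  have hσc : p - 3 ≤ (p - 1) * σ := by
    have h1 : 1 - 2 / (p - 1) ≤ σ := le_min (hc.trans hs) (by
      have : 0 < 2 / (p - 1) := by positivity
      linarith)
    have h2 := mul_le_mul_of_nonneg_left h1 hp1.le
    rw [mul_sub, mul_one, mul_div_cancel₀ _ hp1.ne'] at h2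
    linarith
  rcases lt_or_ge p 2 with hp2 | hp2
  · refine ⟨2, 2 * p, hp, hσ0, le_rfl, hp2.le, by linarith, by linarith, le_rfl, ?_, ?_⟩
    · have : 1 / 2 ≤ 2 / (2 * p) := by
        rw [div_le_div_iff₀ (by norm_num) (by linarith)]; linarith
      linarith
    · rw [div_self (by linarith)]; linarith
  rcases hσ0.lt_or_eq with hpos | hzero
  · have h2 : 0 < 2 - σ := by linarith
    have hr : p < 2 * p / (2 - σ) := by rw [lt_div_iff₀ h2]; nlinarith
    refine ⟨p, 2 * p / (2 - σ), hp, hσ0, hp2, le_rfl, by linarith, hr, ?_, ?_, ?_⟩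
    · rw [div_le_iff₀ h2]; nlinarith
    · rw [div_div_eq_mul_div, mul_div_mul_left _ _ two_ne_zero]
      have : σ + 1 / p - (1 - (2 - σ) / p) = ((p - 1) * σ - (p - 3)) / p := by
        field_simp; ring
      have h3 : 0 ≤ ((p - 1) * σ - (p - 3)) / p := div_nonneg (by linarith) (by linarith)
      linarith
    · rw [div_div_cancel₀ (by linarith)]; linarith
  · have hsz : s = 0 := by
      rcases min_choice s 1 with h | h
      · exact h.symm.trans hzero.symm
      · exact absurd (h.symm.trans hzero.symm) one_ne_zero
    have hp3 : p < 3 := by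
      refine lt_of_le_of_ne ?_ fun h => ?_
      · rw [← hzero, mul_zero] at hσc; linarith
      · have := hs3 h
        rw [hsz] at this
        exact absurd (le_max_right (1 - 2 / (p - 1)) 0) (not_le.2 this)
    rw [← hzero]
    have hr : 2 < 2 * p / (p - 1) := by rw [lt_div_iff₀ hp1]; linarith
    refine ⟨p, 2 * p / (p - 1), hp, le_rfl, hp2, le_rfl, hr, ?_, ?_, ?_, ?_⟩
    · rw [lt_div_iff₀ hp1]; nlinarith
    · rw [div_le_iff₀ hp1]; nlinarith
    · rw [div_div_eq_mul_div, mul_div_mul_left _ _ two_ne_zero, zero_add]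
      have : 1 - (p - 1) / p = 1 / p := by field_simp; ring
      exact this.le
    · rw [div_div_cancel₀ (by linarith)]; linarith

end

end VNLW

end

theorem theoremA1 (p s : ℝ) (hp : 1 < p)
    (hs : VNLW.sCrit p ≤ s) (hs3 : p = 3 → VNLW.sCrit p < s)
    (hreg : s < p + 5 / 2 ∨ ∃ k : ℕ, p = 2 * (k : ℝ) + 1)
    (κ : ℝ) (hκ : κ = 1 ∨ κ = -1) :
    ∃ q r : ℝ, 2 ≤ q ∧ 2 ≤ r ∧ p ≤ q ∧ p ≤ r ∧
      ∀ u₀ u₁ : VNLW.Dist, VNLW.MemSobolev s u₀ → VNLW.MemSobolev (s - 1) u₁ →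
        ∃ T : ℝ, 0 < T ∧ T ≤ 1 ∧
          ∃ (u : ℝ → VNLW.L2) (v : ℝ → VNLW.Dist),
            VNLW.InSolutionClass s q r T u v ∧
            VNLW.IsSolution κ p T u₀ u₁ u v ∧
            (∀ (u' : ℝ → VNLW.L2) (v' : ℝ → VNLW.Dist),
              VNLW.InSolutionClass s q r T u' v' → VNLW.IsSolution κ p T u₀ u₁ u' v' →
                ∀ t ∈ Set.Icc 0 T, u' t = u t ∧ v' t = v t) ∧
            (VNLW.IsRealValued u₀ → VNLW.IsRealValued u₁ →
              ∀ t ∈ Set.Icc 0 T,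
                VNLW.IsRealValued (VNLW.coeffs (u t)) ∧ VNLW.IsRealValued (v t)) := by
  obtain ⟨q, r, h⟩ := VNLW.exists_admissible hp hs hs3
  have hκ1 : ‖(κ : ℂ)‖ₑ = 1 := by
    rcases hκ with rfl | rfl <;> simp
  refine ⟨q, r, h.two_le_q, h.two_lt_r.le, h.p_le_q, h.p_lt_r.le, fun u₀ u₁ h₀ h₁ => ?_⟩
  refine VNLW.wellPosed_of_regularity h (min_le_left s 1) hκ1 ?_ (VNLW.memSobolev_iff.1 h₀)
    (VNLW.memSobolev_iff.1 h₁)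
  intro T u₀ u₁ u hT h₀ h₁ hu hfu
  rcases le_or_gt s 1 with hs1 | hs1
  · rw [min_eq_left hs1] at h
    have hsrc := hu.isSource h hT
    have e1 := VNLW.continuousInSobolev_causalConv VNLW.isCausal_kerS hT hsrc
    have e2 := VNLW.continuousInSobolev_causalConv VNLW.isCausal_kerD hT hsrc
    rw [sub_add_cancel] at e1
    rw [add_zero] at e2
    exact ⟨e1, e2⟩
  · rw [min_eq_right hs1.le] at h
    exact VNLW.persistence_of_regularity h hκ1 hs1 hreg hT h₀ h₁ hu hfu
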